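/- Identify $\mathbb{R}^2$ with $\mathbb{C}$ and put $\Delta=\{z\in\mathbb{C}:|z|>1\}$. Let $\mathcal{C}\subset\mathbb{C}$ be a connected compact set with $\mathrm{cap}(\mathcal{C})>0$, where $$\mathrm{cap}(E)=\inf\{\|v\|_{H^1(\mathbb{R}^2)}^2 : v\in H^1(\mathbb{R}^2),\ v\ge 1\text{ a.e. in a neighbourhood of }E\}$$ is the Sobolev $H^1$ capacity, $\|v\|_{H^1}^2=\|v\|_{L^2}^2+\|\nabla v\|_{L^2}^2$. Let $\Omega=\mathbb{C}\setminus\mathcal{C}$ and let $\Pi$ be the unbounded connected component of $\Omega$. For an open set $U$ that contains a neighbourhood of infinity, a biholomorphism $T:U\to\Delta$ is said to satisfy $T(\infty)=\infty$, $T'(\infty)>0$ if $T(z)\sim\lambda z$ as $|z|\to\infty$ for some real $\lambda>0$. There is a unique biholomorphism $\mathcal{T}:\Pi\to\Delta$ with $\mathcal{T}(\infty)=\infty$ and $\mathcal{T}'(\infty)>0$. Moreover, let $(O_n)_{n\in\mathbb{N}}$ be any sequence of smooth Jordan domains (bounded domains whose boundary is a smooth regular simple closed curve) such that $\overline{O_n}$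 converges to $\mathcal{C}$ in the Hausdorff distance, let $\Omega_n=\mathbb{C}\setminus\overline{O_n}$, and let $\mathcal{T}_n:\Omega_n\to\Delta$ be the biholomorphism with $\mathcal{T}_n(\infty)=\infty$ and $\mathcal{T}_n'(\infty)>0$. Then every compact subset of $\Omega$ is contained in $\Omega_n$ for all sufficiently large $n$ (so that the convergences in (ii) and (iii) make sense), and, as $n\to\infty$: (i) $\mathcal{T}_n^{-1}\to\mathcal{T}^{-1}$ locally uniformly on $\Delta$; (ii) $\mathcal{T}_n\to\mathcal{T}$ and $\mathcal{T}_n'\to\mathcal{T}'$ locally uniformly on $\Pi$; (iii) $|\mathcal{T}_n|\to 1$ locally uniformly on $\Omega\setminus\Pi$. -/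

import Mathlib

open Set Filter Topology MeasureTheory
open scoped ContDiff ENNReal

/-- `g` is the weak gradient of `v` on the plane `ℂ = ℝ²`: the real part of `g` is the weak
derivative of `v` in the direction `1`, its imaginary part the one in the direction `I`
(tested against real smooth compactly supported functions). -/
def HasWeakGradient (v : ℂ → ℝ) (g : ℂ → ℂ) : Prop :=
  ∀ φ : ℂ → ℝ, ContDiff ℝ ∞ φ → HasCompactSupport φ →
    (∫ z, v z * fderiv ℝ φ z 1 = -∫ z, (g z).re * φ z) ∧
    (∫ z, v z * fderiv ℝ φ z Complex.I = -∫ z, (g z).im * φ z)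

/-- The Sobolev `H¹` capacity of a subset `E` of the plane: the infimum of
`‖v‖²_{H¹} = ‖v‖²_{L²} + ‖∇v‖²_{L²}` over all `v ∈ H¹(ℝ²)` with `v ≥ 1` almost everywhere in a
neighbourhood of `E` (and `∞` if there is no such `v`). -/
noncomputable def sobolevCapacity (E : Set ℂ) : ℝ≥0∞ :=
  sInf {c : ℝ≥0∞ | ∃ (v : ℂ → ℝ) (g : ℂ → ℂ),
    MemLp v 2 volume ∧ MemLp g 2 volume ∧ HasWeakGradient v g ∧
    (∃ U : Set ℂ, IsOpen U ∧ E ⊆ U ∧ ∀ᵐ z ∂volume, z ∈ U → 1 ≤ v z) ∧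
    c = (∫⁻ z, ‖v z‖ₑ ^ 2) + ∫⁻ z, ‖g z‖ₑ ^ 2}

/-- A smooth Jordan domain: a bounded connected open set whose boundary is a smooth (regular)
simple closed curve. -/
structure IsSmoothJordanDomain (O : Set ℂ) : Prop where
  isOpen : IsOpen O
  isConnected : IsConnected O
  isBounded : Bornology.IsBounded O
  boundary : ∃ γ : ℝ → ℂ, ContDiff ℝ ∞ γ ∧ Function.Periodic γ 1 ∧ InjOn γ (Ico 0 1) ∧
    (∀ t, deriv γ t ≠ 0) ∧ frontier O = range γ

/-- The exterior `{|z| > 1}` of the closed unit disk. -/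
def unitDiskExterior : Set ℂ := {z | 1 < ‖z‖}

/-- The unbounded connected component of `U`, described as the set of points of `U` whose
connected component in `U` is unbounded. (The complement of a compact set of the plane has exactly
one unbounded component.) -/
def unboundedComponent (U : Set ℂ) : Set ℂ :=
  {z ∈ U | ¬ Bornology.IsBounded (connectedComponentIn U z)}

/-- `f` restricts to a biholomorphism from `U` onto `V`; its inverse is
`Function.invFunOn f U : V → U`. Values of `f` outside `U` are irrelevant. -/
structure IsBiholomorphism (f : ℂ → ℂ) (U V : Set ℂ) : Prop where
  bijOn : BijOn f U V
  differentiableOn : DifferentiableOn ℂ f U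
  differentiableOn_inv : DifferentiableOn ℂ (Function.invFunOn f U) V

/-- `T` is a biholomorphism from the exterior domain `U` onto `{|z| > 1}` with `T(∞) = ∞` and
`T'(∞) > 0`, which means `T(z) ∼ λ z` as `|z| → ∞` for some real `λ > 0`. -/
structure IsNormalizedExteriorMap (T : ℂ → ℂ) (U : Set ℂ) : Prop where
  isBiholomorphism : IsBiholomorphism T U unitDiskExterior
  normalized : ∃ l : ℝ, 0 < l ∧ Tendsto (fun z => T z / z) (Bornology.cobounded ℂ) (𝓝 (l : ℂ))

/-! A point has zero capacity, so positive capacity serves to guarantee that `C` has two distinct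
points.

Existence of the map. The inversion about a point `c₀` of `C` turns the unbounded component together
with infinity into a domain `U` containing `0`. A holomorphic function on `U` is, by a smooth cutoff
and a Cauchy–Pompeiu formula, locally a superposition of kernels `1 / (c - z)` with poles near the
frontier of `U` or far away. Since `C` is connected, a pole near the frontier can be moved to
infinity inside the complement of `U`, and nearby poles differ by the derivative of a single-valued
logarithm. Hence every holomorphic function on `U` has a primitive, every zero-free one has a square
root, and Koebe's extremal argument maps `U` onto the disk (`exists_isDiskEmbedding_surjOn`,
`exists_isNormalizedExteriorMap`). Uniqueness is the equality case of the Schwarz lemma at infinity.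

Convergence. In the coordinate at infinity the inverse maps become `ζ ↦ ζ * Sₙ⁻¹ (1 / ζ)`,
holomorphic on the unit disk and uniformly bounded by the Schwarz lemma, hence a normal family. Let
`H` be a subsequential limit. For `c` in `C`, Hurwitz' theorem makes `H ζ - c ζ` zero-free or
identically zero; two distinct points of `C` exclude the second case. So `G w = w * H (1 / w)` maps
the exterior disk into the unbounded component, and `T ∘ G` is a self-map of the exterior disk. The
Schwarz lemma bounds its derivative at infinity below by `1`; applied to `Sₙ ∘ T⁻¹` on `{|w| > r}`
with `r` decreasing to `1`, it gives the opposite bound. Rigidity forces `T ∘ G = id`, so every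
subsequential limit is the inverse of `T` (`eqOn_of_tendstoLocallyUniformlyOn`).

Convergence of the direct maps follows from a quantitative open mapping theorem, that of the
derivatives from Weierstrass' theorem. On bounded components, values of `Sₙ` staying away from the
unit circle would place the points close to a compact subset of the unbounded component. -/

/-! ### Normal families and Hurwitz' theorem -/

-- Montel's theorem: Cauchy estimates give a common local Lipschitz constant, so convergence on a
-- dense sequence spreads to locally uniform convergence.
open Metric in
theorem exists_subseq_tendstoLocallyUniformlyOn_of_bounded {U : Set ℂ} (hU : IsOpen U)
    {f : ℕ → ℂ → ℂ} (hf : ∀ n, DifferentiableOn ℂ (f n) U) {M : ℝ}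
    (hM : ∀ n, ∀ z ∈ U, ‖f n z‖ ≤ M) :
    ∃ (g : ℂ → ℂ) (φ : ℕ → ℕ), StrictMono φ ∧
      TendstoLocallyUniformlyOn (fun n => f (φ n)) g atTop U := by
  classical
  -- Tychonoff compactness of a countable product of closed balls replaces the diagonal extraction;
  -- the default `0` outside `U` keeps every coordinate in its ball.
  set x : ℕ → ℕ → ℂ := fun n k =>
    if TopologicalSpace.denseSeq ℂ k ∈ U then f n (TopologicalSpace.denseSeq ℂ k) else 0 with hx
  have hcomp : IsCompact (Set.pi univ fun _ : ℕ => closedBall (0 : ℂ) |M|) :=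
    isCompact_univ_pi fun _ => isCompact_closedBall _ _
  have hmem : ∀ n, x n ∈ Set.pi univ fun _ : ℕ => closedBall (0 : ℂ) |M| := by
    intro n k _
    rw [mem_closedBall_zero_iff]
    simp only [hx]
    split_ifs with h
    · exact (hM n _ h).trans (le_abs_self M)
    · simp
  obtain ⟨y, -, φ, hφ, hy⟩ := hcomp.tendsto_subseq hmem
  have key : ∀ z₀ ∈ U, ∀ ε > 0, ∃ δ > 0, ∃ N, ∀ m ≥ N, ∀ n ≥ N, ∀ w ∈ ball z₀ δ,
      dist (f (φ m) w) (f (φ n) w) < ε := by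
    intro z₀ hz₀ ε hε
    obtain ⟨s, hs, hsU⟩ := Metric.isOpen_iff.1 hU z₀ hz₀
    set r := s / 2 with hr
    have hr0 : 0 < r := by positivity
    set A := 2 * (|M| + 1) / r with hA
    have hA0 : 0 < A := by positivity
    have hL : ∀ n, ∀ w ∈ ball z₀ (r / 2), ∀ z ∈ ball z₀ (r / 2),
        dist (f n w) (f n z) ≤ A * dist w z := by
      intro n w hw z hz
      rw [mem_ball] at hw hz
      have hsub : ball z r ⊆ U := by
        refine Subset.trans ?_ hsU
        apply ball_subset_ball'
        linarith
      have hzU : z ∈ U := hsub (mem_ball_self hr0)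
      refine Complex.dist_le_div_mul_dist_of_mapsTo_ball ((hf n).mono hsub) ?_ ?_
      · intro u hu
        rw [mem_closedBall]
        calc dist (f n u) (f n z) ≤ ‖f n u‖ + ‖f n z‖ := dist_le_norm_add_norm _ _
          _ ≤ 2 * (|M| + 1) := by
            linarith [hM n u (hsub hu), hM n z hzU, le_abs_self M]
      · rw [mem_ball]
        linarith [dist_triangle_right w z z₀]
    -- Points of the ball are within `2 * δ` of the dense point `d`, so each Lipschitz error is at
    -- most `ε / 4`; the Cauchy property at `d` supplies the other `ε / 2`.
    set δ := min (r / 2) (ε / (8 * A)) with hδ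
    have hδ0 : 0 < δ := by positivity
    obtain ⟨k, hk⟩ := (TopologicalSpace.denseRange_denseSeq ℂ).exists_dist_lt z₀ hδ0
    set d := TopologicalSpace.denseSeq ℂ k with hd
    have hdm : d ∈ ball z₀ δ := by rwa [mem_ball, dist_comm]
    have hdr : d ∈ ball z₀ (r / 2) := ball_subset_ball (min_le_left _ _) hdm
    have hdU : d ∈ U := hsU (ball_subset_ball (by linarith) hdr)
    have hc : CauchySeq fun n => f (φ n) d := by
      have h1 := ((continuous_apply k).tendsto y).comp hy
      have h2 : (fun n => f (φ n) d) = (fun p : ℕ → ℂ => p k) ∘ (x ∘ φ) := by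
        ext n
        simp only [hx, Function.comp]
        rw [if_pos hdU]
      rw [h2]
      exact h1.cauchySeq
    obtain ⟨N, hN⟩ := Metric.cauchySeq_iff.1 hc (ε / 2) (by positivity)
    refine ⟨δ, hδ0, N, fun m hm n hn w hw => ?_⟩
    have hwr : w ∈ ball z₀ (r / 2) := ball_subset_ball (min_le_left _ _) hw
    have h1 := hL (φ m) w hwr d hdr
    have h2 := hL (φ n) d hdr w hwr
    have h3 := hN m hm n hn
    rw [mem_ball] at hw hdm
    have h4 : dist w d ≤ 2 * (ε / (8 * A)) := by
      have := dist_triangle_right w d z₀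
      have h5 : δ ≤ ε / (8 * A) := min_le_right _ _
      linarith
    have h6 : A * dist w d ≤ ε / 4 := by
      calc A * dist w d ≤ A * (2 * (ε / (8 * A))) := by gcongr
        _ = ε / 4 := by field_simp; ring
    rw [dist_comm d w] at h2
    have h7 := dist_triangle4 (f (φ m) w) (f (φ m) d) (f (φ n) d) (f (φ n) w)
    linarith
  have hlim : ∀ z, ∃ l, z ∈ U → Tendsto (fun n => f (φ n) z) atTop (𝓝 l) := by
    intro z
    by_cases hz : z ∈ U
    · have : CauchySeq fun n => f (φ n) z := by
        rw [Metric.cauchySeq_iff]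
        intro ε hε
        obtain ⟨δ, hδ, N, hN⟩ := key z hz ε hε
        exact ⟨N, fun m hm n hn => hN m hm n hn z (mem_ball_self hδ)⟩
      obtain ⟨l, hl⟩ := cauchySeq_tendsto_of_complete this
      exact ⟨l, fun _ => hl⟩
    · exact ⟨0, fun h => absurd h hz⟩
  choose g hg using hlim
  refine ⟨g, φ, hφ, ?_⟩
  rw [Metric.tendstoLocallyUniformlyOn_iff]
  intro ε hε z hz
  obtain ⟨δ, hδ, N, hN⟩ := key z hz (ε / 2) (by positivity)
  refine ⟨ball z δ ∩ U, inter_mem (mem_nhdsWithin_of_mem_nhds (ball_mem_nhds z hδ))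
    self_mem_nhdsWithin, eventually_atTop.2 ⟨N, fun n hn w hw => ?_⟩⟩
  have h1 : Tendsto (fun m => dist (f (φ m) w) (f (φ n) w)) atTop
      (𝓝 (dist (g w) (f (φ n) w))) := (hg w hw.2).dist tendsto_const_nhds
  have h2 : dist (g w) (f (φ n) w) ≤ ε / 2 :=
    le_of_tendsto h1 (eventually_atTop.2 ⟨N, fun m hm => (hN m hm n hn w hw.1).le⟩)
  linarith

/-- Local form of Hurwitz' theorem: a zero of a locally uniform limit of zero-free holomorphic
functions is not isolated. -/
theorem eventually_eq_zero_of_tendstoLocallyUniformlyOn_of_ne_zero {U : Set ℂ} (hU : IsOpen U)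
    {f : ℕ → ℂ → ℂ} {g : ℂ → ℂ} (hf : ∀ᶠ n in atTop, DifferentiableOn ℂ (f n) U)
    (hne : ∀ᶠ n in atTop, ∀ z ∈ U, f n z ≠ 0)
    (hlim : TendstoLocallyUniformlyOn f g atTop U) {z₀ : ℂ} (hz₀ : z₀ ∈ U) (h0 : g z₀ = 0) :
    ∀ᶠ z in 𝓝 z₀, g z = 0 := by
  have hg : DifferentiableOn ℂ g U := hlim.differentiableOn hf hU
  have han : AnalyticAt ℂ g z₀ := hg.analyticAt (hU.mem_nhds hz₀)
  refine han.eventually_eq_zero_or_eventually_ne_zero.resolve_right fun hiso => ?_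
  rw [eventually_nhdsWithin_iff] at hiso
  obtain ⟨r, hr, hrs⟩ := Metric.nhds_basis_closedBall.mem_iff.1
    (inter_mem hiso (hU.mem_nhds hz₀))
  have hsph : ∀ z ∈ Metric.sphere z₀ r, g z ≠ 0 := fun z hz =>
    (hrs (Metric.sphere_subset_closedBall hz)).1 (Metric.ne_of_mem_sphere hz hr.ne')
  have hcbU : Metric.closedBall z₀ r ⊆ U := fun z hz => (hrs hz).2
  obtain ⟨ε, hε, hε'⟩ : ∃ ε > 0, ∀ z ∈ Metric.sphere z₀ r, ε ≤ ‖g z‖ := by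
    obtain ⟨x, hx, hmin⟩ := (isCompact_sphere z₀ r).exists_isMinOn
      (NormedSpace.sphere_nonempty.2 hr.le)
      ((hg.continuousOn.mono (Metric.sphere_subset_closedBall.trans hcbU)).norm)
    exact ⟨‖g x‖, norm_pos_iff.2 (hsph x hx), fun z hz => hmin hz⟩
  have hunif := (tendstoLocallyUniformlyOn_iff_forall_isCompact hU).1 hlim _ hcbU
    (isCompact_closedBall z₀ r)
  obtain ⟨n, hn, hdn, hnn⟩ :=
    ((Metric.tendstoUniformlyOn_iff.1 hunif (ε / 3) (by positivity)).and (hf.and hne)).exists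
  have hcl : closure (Metric.ball z₀ r) ⊆ U := Metric.closure_ball_subset_closedBall.trans hcbU
  -- Maximum principle for `1 / f n`: on the circle `‖f n‖ ≥ 2 * ε / 3`, which contradicts `‖f n z₀‖
  -- < ε / 3`.
  have hd : DiffContOnCl ℂ (fun z => (f n z)⁻¹) (Metric.ball z₀ r) := by
    refine DifferentiableOn.diffContOnCl fun z hz => ?_
    exact ((hdn.mono hcl) z hz).inv (hnn z (hcl hz))
  have hb := Complex.norm_le_of_forall_mem_frontier_norm_le (C := 3 / (2 * ε))
    Metric.isBounded_ball hd (fun z hz => ?_) (subset_closure (Metric.mem_ball_self hr))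
  · have h1 := hn z₀ (Metric.mem_closedBall_self hr.le)
    rw [h0, dist_zero_left] at h1
    have h2 : 0 < ‖f n z₀‖ := norm_pos_iff.2 (hnn z₀ hz₀)
    rw [norm_inv, inv_le_comm₀ h2 (by positivity)] at hb
    have : (3 / (2 * ε))⁻¹ = 2 * ε / 3 := by field_simp
    rw [this] at hb
    linarith
  · rw [frontier_ball z₀ hr.ne'] at hz
    have h1 := hn z (Metric.sphere_subset_closedBall hz)
    have h2 := hε' z hz
    rw [dist_eq_norm] at h1
    have h3 : 2 * ε / 3 ≤ ‖f n z‖ := by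
      have := norm_sub_norm_le (g z) (f n z)
      linarith
    rw [norm_inv]
    calc ‖f n z‖⁻¹ ≤ (2 * ε / 3)⁻¹ := by gcongr
      _ = 3 / (2 * ε) := by field_simp

/-- Hurwitz' theorem on a connected open set. -/
theorem eqOn_zero_of_tendstoLocallyUniformlyOn_of_ne_zero {U : Set ℂ} (hU : IsOpen U)
    (hUc : IsPreconnected U)
    {f : ℕ → ℂ → ℂ} {g : ℂ → ℂ} (hf : ∀ᶠ n in atTop, DifferentiableOn ℂ (f n) U)
    (hne : ∀ᶠ n in atTop, ∀ z ∈ U, f n z ≠ 0)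
    (hlim : TendstoLocallyUniformlyOn f g atTop U) {z₀ : ℂ} (hz₀ : z₀ ∈ U) (h0 : g z₀ = 0) :
    ∀ z ∈ U, g z = 0 := by
  have h := eventually_eq_zero_of_tendstoLocallyUniformlyOn_of_ne_zero hU hf hne hlim hz₀ h0
  have hg : DifferentiableOn ℂ g U := hlim.differentiableOn hf hU
  exact (hg.analyticOnNhd hU).eqOn_zero_of_preconnected_of_eventuallyEq_zero hUc hz₀ h

/-! ### Disk automorphisms and the Riemann mapping theorem -/

/-- The automorphism `w ↦ (w - b) / (1 - conj b * w)` of the unit disk. -/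
noncomputable def diskShift (b w : ℂ) : ℂ := (w - b) / (1 - starRingEnd ℂ b * w)

theorem one_sub_conj_mul_ne_zero {b w : ℂ} (hb : ‖b‖ < 1) (hw : ‖w‖ < 1) :
    1 - starRingEnd ℂ b * w ≠ 0 := by
  intro h
  have h1 : ‖starRingEnd ℂ b * w‖ = 1 := by
    rw [← sub_eq_zero.1 h, norm_one]
  rw [norm_mul, Complex.norm_conj] at h1
  nlinarith [norm_nonneg b, norm_nonneg w]

/-- This is the identity `|1 - conj b * w|² - |w - b|² = (1 - |b|²) (1 - |w|²)`. -/
theorem norm_diskShift_lt_one {b w : ℂ} (hb : ‖b‖ < 1) (hw : ‖w‖ < 1) :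
    ‖diskShift b w‖ < 1 := by
  have h0 := one_sub_conj_mul_ne_zero hb hw
  rw [diskShift, norm_div, div_lt_one (norm_pos_iff.2 h0), ← sq_lt_sq₀ (norm_nonneg _)
    (norm_nonneg _), ← Complex.normSq_eq_norm_sq, ← Complex.normSq_eq_norm_sq]
  have hb' : Complex.normSq b < 1 := by
    rw [Complex.normSq_eq_norm_sq]; nlinarith [norm_nonneg b]
  have hw' : Complex.normSq w < 1 := by
    rw [Complex.normSq_eq_norm_sq]; nlinarith [norm_nonneg w]
  simp only [Complex.normSq_apply, Complex.sub_re, Complex.sub_im, Complex.mul_re, Complex.mul_im,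
    Complex.conj_re, Complex.conj_im, Complex.one_re, Complex.one_im] at *
  nlinarith [mul_pos (sub_pos.2 hb') (sub_pos.2 hw')]

theorem hasDerivAt_diskShift {b w : ℂ} (hb : ‖b‖ < 1) (hw : ‖w‖ < 1) :
    HasDerivAt (diskShift b)
      ((1 - starRingEnd ℂ b * b) / (1 - starRingEnd ℂ b * w) ^ 2) w := by
  have h0 := one_sub_conj_mul_ne_zero hb hw
  have h := ((hasDerivAt_id w).sub_const b).div
    (((hasDerivAt_id w).const_mul (starRingEnd ℂ b)).const_sub 1) h0
  convert! h using 1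
  simp only [id]
  congr 1
  ring

theorem deriv_diskShift_ne_zero {b w : ℂ} (hb : ‖b‖ < 1) (hw : ‖w‖ < 1) :
    deriv (diskShift b) w ≠ 0 := by
  rw [(hasDerivAt_diskShift hb hw).deriv]
  exact div_ne_zero (one_sub_conj_mul_ne_zero hb hb)
    (pow_ne_zero _ (one_sub_conj_mul_ne_zero hb hw))

theorem diskShift_eq_zero_iff {b w : ℂ} (hb : ‖b‖ < 1) (hw : ‖w‖ < 1) :
    diskShift b w = 0 ↔ w = b := by
  rw [diskShift, div_eq_zero_iff, or_iff_left (one_sub_conj_mul_ne_zero hb hw), sub_eq_zero]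

theorem diskShift_injOn {b : ℂ} (hb : ‖b‖ < 1) : InjOn (diskShift b) (Metric.ball 0 1) := by
  intro z hz w hw h
  rw [mem_ball_zero_iff] at hz hw
  have h1 := one_sub_conj_mul_ne_zero hb hz
  have h2 := one_sub_conj_mul_ne_zero hb hw
  rw [diskShift, diskShift, div_eq_div_iff h1 h2] at h
  have h3 : (1 - starRingEnd ℂ b * b) * (z - w) = 0 := by linear_combination h
  exact sub_eq_zero.1 ((mul_eq_zero.1 h3).resolve_left (one_sub_conj_mul_ne_zero hb hb))

/-- Conformal embeddings of `U` into the unit disk that vanish at the origin. -/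
structure IsDiskEmbedding (f : ℂ → ℂ) (U : Set ℂ) : Prop where
  differentiableOn : DifferentiableOn ℂ f U
  mapsTo : MapsTo f U (Metric.ball 0 1)
  injOn : InjOn f U
  deriv_ne_zero : ∀ z ∈ U, deriv f z ≠ 0
  map_zero : f 0 = 0

/-- Every zero-free holomorphic function on `U` has a holomorphic square root on `U`. -/
def HasHolomorphicSqrt (U : Set ℂ) : Prop :=
  ∀ h : ℂ → ℂ, DifferentiableOn ℂ h U → (∀ z ∈ U, h z ≠ 0) →
    ∃ s : ℂ → ℂ, DifferentiableOn ℂ s U ∧ ∀ z ∈ U, s z ^ 2 = h z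

/-- Restores the normalization `f 0 = 0`, both for the initial embedding and after taking a root in
Koebe's argument. -/
theorem IsDiskEmbedding.of_diskShift {U : Set ℂ} (hU : IsOpen U) (h0 : (0 : ℂ) ∈ U) {f : ℂ → ℂ}
    (hf : DifferentiableOn ℂ f U) (hm : MapsTo f U (Metric.ball 0 1)) (hi : InjOn f U)
    (hd : ∀ z ∈ U, deriv f z ≠ 0) : IsDiskEmbedding (fun z => diskShift (f 0) (f z)) U := by
  have hb : ‖f 0‖ < 1 := mem_ball_zero_iff.1 (hm h0)
  have hlt : ∀ z ∈ U, ‖f z‖ < 1 := fun z hz => mem_ball_zero_iff.1 (hm hz)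
  have hder : ∀ z ∈ U, HasDerivAt (fun z => diskShift (f 0) (f z))
      (deriv (diskShift (f 0)) (f z) * deriv f z) z := fun z hz => by
    have h1 := (hasDerivAt_diskShift hb (hlt z hz)).differentiableAt.hasDerivAt
    exact h1.comp z (hf.differentiableAt (hU.mem_nhds hz)).hasDerivAt
  refine ⟨fun z hz => (hder z hz).differentiableAt.differentiableWithinAt, fun z hz => ?_,
    fun z hz w hw h => ?_, fun z hz => ?_, ?_⟩
  · exact mem_ball_zero_iff.2 (norm_diskShift_lt_one hb (hlt z hz))
  · exact hi hz hw (diskShift_injOn hb (hm hz) (hm hw) h)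
  · rw [(hder z hz).deriv]
    exact mul_ne_zero (deriv_diskShift_ne_zero hb (hlt z hz)) (hd z hz)
  · simp [diskShift]

theorem injOn_of_sq_injOn {U : Set ℂ} {s h : ℂ → ℂ} (hs : ∀ z ∈ U, s z ^ 2 = h z)
    (hi : InjOn h U) : InjOn s U := fun z hz w hw e =>
  hi hz hw (by rw [← hs z hz, ← hs w hw, e])

theorem two_mul_deriv_of_sq {U : Set ℂ} (hU : IsOpen U) {s h : ℂ → ℂ}
    (hsd : DifferentiableOn ℂ s U) (hs : ∀ z ∈ U, s z ^ 2 = h z) {z : ℂ} (hz : z ∈ U) :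
    2 * s z * deriv s z = deriv h z := by
  have h1 : (fun z => s z ^ 2) =ᶠ[𝓝 z] h := by
    filter_upwards [hU.mem_nhds hz] with w hw using hs w hw
  rw [← h1.deriv_eq]
  have := ((hsd.differentiableAt (hU.mem_nhds hz)).hasDerivAt.fun_pow 2).deriv
  simpa using this.symm

/-- A branch `s` of the square root of `z - a` never takes two opposite values. Its image contains a
ball about `s 0`, hence omits the ball about `-s 0`, and inverting about `-s 0` gives a bounded
injective map. -/
theorem exists_isDiskEmbedding {U : Set ℂ} (hU : IsOpen U) (h0 : (0 : ℂ) ∈ U)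
    (hne : U ≠ univ) (hsq : HasHolomorphicSqrt U) : ∃ f, IsDiskEmbedding f U := by
  obtain ⟨a, ha⟩ := (ne_univ_iff_exists_notMem U).1 hne
  obtain ⟨s, hsd, hs⟩ := hsq (fun z => z - a) (by fun_prop) fun z hz h =>
    ha (by rwa [← sub_eq_zero.1 h])
  have hsi : InjOn s U := injOn_of_sq_injOn hs fun z _ w _ h => by simpa using h
  have hs0 : ∀ z ∈ U, s z ≠ 0 := fun z hz h => by
    have := hs z hz
    rw [h, zero_pow two_ne_zero, eq_comm, sub_eq_zero] at this
    exact ha (this ▸ hz)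
  have hds : ∀ z ∈ U, deriv s z ≠ 0 := fun z hz h => by
    have := two_mul_deriv_of_sq hU hsd hs hz
    simp [h] at this
  have hnhds : s '' U ∈ 𝓝 (s 0) := by
    have han : AnalyticAt ℂ s 0 := hsd.analyticAt (hU.mem_nhds h0)
    rw [← han.hasStrictDerivAt.map_nhds_eq (hds 0 h0)]
    exact image_mem_map (hU.mem_nhds h0)
  obtain ⟨ε, hε, hεs⟩ := Metric.mem_nhds_iff.1 hnhds
  have hfar : ∀ z ∈ U, ε ≤ ‖s z + s 0‖ := by
    intro z hz
    by_contra! hlt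
    have hmem : -s z ∈ s '' U := hεs (by
      rwa [Metric.mem_ball, dist_eq_norm, show -s z - s 0 = -(s z + s 0) by ring, norm_neg])
    obtain ⟨w, hw, hwz⟩ := hmem
    have : w = z := by
      have h1 := hs w hw
      rw [hwz, neg_sq, hs z hz] at h1
      simpa using h1.symm
    rw [this] at hwz
    exact hs0 z hz (by linear_combination hwz / 2)
  have hne0 : ∀ z ∈ U, s z + s 0 ≠ 0 := fun z hz =>
    norm_pos_iff.1 (hε.trans_le (hfar z hz))
  have hder : ∀ z ∈ U, HasDerivAt (fun z => ((ε / 2 : ℝ) : ℂ) * (s z + s 0)⁻¹)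
      (((ε / 2 : ℝ) : ℂ) * (-deriv s z / (s z + s 0) ^ 2)) z := fun z hz =>
    (((hsd.differentiableAt (hU.mem_nhds hz)).hasDerivAt.add_const (s 0)).fun_inv
      (hne0 z hz)).const_mul _
  have hε2 : ((ε / 2 : ℝ) : ℂ) ≠ 0 := by
    rw [Ne, Complex.ofReal_eq_zero]; positivity
  refine ⟨_, IsDiskEmbedding.of_diskShift hU h0
    (f := fun z => ((ε / 2 : ℝ) : ℂ) * (s z + s 0)⁻¹)
    (fun z hz => (hder z hz).differentiableAt.differentiableWithinAt) (fun z hz => ?_)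
    (fun z hz w hw h => ?_) (fun z hz => ?_)⟩
  · rw [mem_ball_zero_iff, norm_mul, norm_inv, Complex.norm_real, Real.norm_of_nonneg (by positivity),
      ← div_eq_mul_inv, div_lt_one (hε.trans_le (hfar z hz))]
    linarith [hfar z hz]
  · exact hsi hz hw (by simpa using inv_injective (mul_left_cancel₀ hε2 h))
  · rw [(hder z hz).deriv]
    exact mul_ne_zero hε2 (div_ne_zero (neg_ne_zero.2 (hds z hz)) (pow_ne_zero _ (hne0 z hz)))

/-- The nonzero derivative at `0` rules out a constant limit. Then the maximum principle keeps the
limit in the open disk, and Hurwitz' theorem, applied to `f n - f n z₁` and to `deriv (f n)`,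
preserves injectivity and nonvanishing of the derivative. -/
theorem IsDiskEmbedding.of_tendstoLocallyUniformlyOn {U : Set ℂ} (hU : IsOpen U)
    (hUc : IsPreconnected U) (h0 : (0 : ℂ) ∈ U) {f : ℕ → ℂ → ℂ} {g : ℂ → ℂ}
    (hf : ∀ n, IsDiskEmbedding (f n) U) (hlim : TendstoLocallyUniformlyOn f g atTop U)
    (hg0 : deriv g 0 ≠ 0) : IsDiskEmbedding g U := by
  have hfd : ∀ᶠ n in atTop, DifferentiableOn ℂ (f n) U :=
    Eventually.of_forall fun n => (hf n).differentiableOn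
  have hgd : DifferentiableOn ℂ g U := hlim.differentiableOn hfd hU
  have hpt : ∀ z ∈ U, Tendsto (fun n => f n z) atTop (𝓝 (g z)) := fun z hz =>
    hlim.tendsto_at hz
  have hmap0 : g 0 = 0 := tendsto_nhds_unique (hpt 0 h0) (by simp [(hf _).map_zero])
  have hle : ∀ z ∈ U, ‖g z‖ ≤ 1 := fun z hz =>
    le_of_tendsto (hpt z hz).norm (Eventually.of_forall fun n =>
      (mem_ball_zero_iff.1 ((hf n).mapsTo hz)).le)
  have hnconst : ∀ c, ¬ EqOn g (fun _ => c) U := fun c hc => by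
    have : g =ᶠ[𝓝 0] fun _ => c := by
      filter_upwards [hU.mem_nhds h0] with w hw using hc hw
    exact hg0 (by rw [this.deriv_eq]; simp)
  refine ⟨hgd, fun z hz => ?_, fun z₁ hz₁ z₂ hz₂ h => ?_, fun z hz hd => ?_, hmap0⟩
  · rw [mem_ball_zero_iff]
    refine lt_of_le_of_ne (hle z hz) fun h1 => ?_
    have := Complex.norm_eqOn_of_isPreconnected_of_isMaxOn hUc hU hgd hz
      (fun w hw => by simpa [h1] using hle w hw) h0
    simp [hmap0, h1] at this
  · by_contra hne
    obtain ⟨r, hr, hrU⟩ := Metric.isOpen_iff.1 hU z₂ hz₂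
    -- The ball excludes `z₁`, so by injectivity `f n - f n z₁` has no zero in it.
    set B := Metric.ball z₂ (min r (dist z₁ z₂)) with hB
    have hBU : B ⊆ U := (Metric.ball_subset_ball (min_le_left _ _)).trans hrU
    have hz₁B : z₁ ∉ B := fun h => by
      have := (Metric.mem_ball.1 h).trans_le (min_le_right _ _)
      exact lt_irrefl _ this
    have hpos : 0 < min r (dist z₁ z₂) := lt_min hr (dist_pos.2 hne)
    have hlim' : TendstoLocallyUniformlyOn (fun n z => f n z - f n z₁) (fun z => g z - g z₁)
        atTop B := by
      rw [tendstoLocallyUniformlyOn_iff_forall_isCompact Metric.isOpen_ball]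
      intro K hK hKc
      have h1 := (tendstoLocallyUniformlyOn_iff_forall_isCompact hU).1 hlim K (hK.trans hBU) hKc
      refine h1.sub ?_
      rw [Metric.tendstoUniformlyOn_iff]
      intro ε hε
      filter_upwards [Metric.tendsto_nhds.1 (hpt z₁ hz₁) ε hε] with n hn x _
      rwa [dist_comm]
    have hz := eventually_eq_zero_of_tendstoLocallyUniformlyOn_of_ne_zero Metric.isOpen_ball
      (f := fun n z => f n z - f n z₁) (g := fun z => g z - g z₁)
      (Eventually.of_forall fun n => ((hf n).differentiableOn.mono hBU).sub_const _)
      (Eventually.of_forall fun n z hz h' => hz₁B (by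
        rwa [← (hf n).injOn (hBU hz) hz₁ (sub_eq_zero.1 h')]))
      hlim' (Metric.mem_ball_self hpos) (by simp [h])
    have := ((hgd.sub_const (g z₁)).analyticOnNhd hU).eqOn_zero_of_preconnected_of_eventuallyEq_zero
      hUc hz₂ hz
    exact hnconst (g z₁) fun w hw => sub_eq_zero.1 (this hw)
  · have h1 := eqOn_zero_of_tendstoLocallyUniformlyOn_of_ne_zero hU hUc
      (f := fun n => deriv (f n))
      (Eventually.of_forall fun n => (hf n).differentiableOn.deriv hU)
      (Eventually.of_forall fun n => (hf n).deriv_ne_zero) (hlim.deriv hfd hU) hz hd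
    exact hg0 (h1 0 h0)

/-- Koebe's square root trick. -/
theorem IsDiskEmbedding.exists_norm_deriv_lt {U : Set ℂ} (hU : IsOpen U) (h0 : (0 : ℂ) ∈ U)
    (hsq : HasHolomorphicSqrt U) {f : ℂ → ℂ} (hf : IsDiskEmbedding f U) {a : ℂ} (ha : ‖a‖ < 1)
    (haf : a ∉ f '' U) : ∃ k, IsDiskEmbedding k U ∧ ‖deriv f 0‖ < ‖deriv k 0‖ := by
  have hlt : ∀ z ∈ U, ‖f z‖ < 1 := fun z hz => mem_ball_zero_iff.1 (hf.mapsTo hz)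
  have hder : ∀ z ∈ U, HasDerivAt (fun z => diskShift a (f z))
      ((1 - starRingEnd ℂ a * a) / (1 - starRingEnd ℂ a * f z) ^ 2 * deriv f z) z := fun z hz =>
    (hasDerivAt_diskShift ha (hlt z hz)).comp z
      (hf.differentiableOn.differentiableAt (hU.mem_nhds hz)).hasDerivAt
  have hg0 : ∀ z ∈ U, diskShift a (f z) ≠ 0 := fun z hz h =>
    haf ⟨z, hz, (diskShift_eq_zero_iff ha (hlt z hz)).1 h⟩
  obtain ⟨s, hsd, hs⟩ := hsq (fun z => diskShift a (f z))
    (fun z hz => (hder z hz).differentiableAt.differentiableWithinAt) hg0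
  have hds : ∀ z ∈ U, 2 * s z * deriv s z =
      (1 - starRingEnd ℂ a * a) / (1 - starRingEnd ℂ a * f z) ^ 2 * deriv f z := fun z hz => by
    rw [two_mul_deriv_of_sq hU hsd hs hz, (hder z hz).deriv]
  have hslt : ∀ z ∈ U, ‖s z‖ < 1 := fun z hz => by
    have := norm_diskShift_lt_one ha (hlt z hz)
    rw [← hs z hz, norm_pow] at this
    nlinarith [norm_nonneg (s z)]
  have hsi : InjOn s U := injOn_of_sq_injOn hs fun z hz w hw h =>
    hf.injOn hz hw (diskShift_injOn ha (hf.mapsTo hz) (hf.mapsTo hw) h)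
  have hsd0 : ∀ z ∈ U, deriv s z ≠ 0 := fun z hz h => by
    have h1 := hds z hz
    rw [h, mul_zero, eq_comm] at h1
    refine mul_ne_zero (div_ne_zero (one_sub_conj_mul_ne_zero ha ha)
      (pow_ne_zero _ (one_sub_conj_mul_ne_zero ha (hlt z hz)))) (hf.deriv_ne_zero z hz) h1
  refine ⟨_, IsDiskEmbedding.of_diskShift hU h0 hsd (fun z hz => mem_ball_zero_iff.2 (hslt z hz))
    hsi hsd0, ?_⟩
  set b := s 0 with hb
  have hb1 : ‖b‖ < 1 := hslt 0 h0
  have hba : b ^ 2 = -a := by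
    rw [hb, hs 0 h0, hf.map_zero]
    simp [diskShift]
  have hb0 : b ≠ 0 := fun h => hg0 0 h0 (by rw [← hs 0 h0, ← hb, h]; simp)
  have hk : deriv (fun z => diskShift b (s z)) 0 =
      (1 - starRingEnd ℂ b * b)⁻¹ * deriv s 0 := by
    have h1 := (hasDerivAt_diskShift hb1 hb1).comp (0 : ℂ)
      (hsd.differentiableAt (hU.mem_nhds h0)).hasDerivAt
    have h2 := one_sub_conj_mul_ne_zero hb1 hb1
    refine Eq.trans h1.deriv ?_
    congr 1
    field_simp
  have hds0 := hds 0 h0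
  rw [hf.map_zero, mul_zero, sub_zero, one_pow, div_one, ← hb] at hds0
  have hreal : ∀ c : ℂ, ‖c‖ < 1 → ‖1 - starRingEnd ℂ c * c‖ = 1 - ‖c‖ ^ 2 := fun c hc => by
    rw [mul_comm, Complex.mul_conj, Complex.normSq_eq_norm_sq, ← Complex.ofReal_one,
      ← Complex.ofReal_sub, Complex.norm_real, Real.norm_of_nonneg]
    nlinarith [norm_nonneg c]
  have hn := congrArg norm hds0
  rw [norm_mul, norm_mul, norm_mul, hreal a ha, Complex.norm_ofNat] at hn
  have hna : ‖a‖ = ‖b‖ ^ 2 := by rw [← norm_pow, hba, norm_neg]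
  rw [hk, norm_mul, norm_inv, hreal b hb1]
  rw [hna] at hn
  have hbp : 0 < ‖b‖ := norm_pos_iff.2 hb0
  have hfp : 0 < ‖deriv f 0‖ := norm_pos_iff.2 (hf.deriv_ne_zero 0 h0)
  have h1b : 0 < 1 - ‖b‖ ^ 2 := by nlinarith
  -- With `|a| = |b|²`, the new derivative is the old one times `(1 + |b|²) / (2 |b|)`, and this
  -- factor exceeds `1`.
  have h3 : (1 - ‖b‖ ^ 2)⁻¹ * ‖deriv s 0‖ * (2 * ‖b‖) = (1 + ‖b‖ ^ 2) * ‖deriv f 0‖ := by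
    field_simp
    linear_combination hn
  have h4 : 2 * ‖b‖ < 1 + ‖b‖ ^ 2 := by nlinarith [sq_nonneg (1 - ‖b‖), mul_pos (sub_pos.2 hb1) (sub_pos.2 hb1)]
  have h5 : ‖deriv f 0‖ * (2 * ‖b‖) < (1 - ‖b‖ ^ 2)⁻¹ * ‖deriv s 0‖ * (2 * ‖b‖) := by
    rw [h3]
    nlinarith
  exact lt_of_mul_lt_mul_right h5 (by positivity)

/-- The Riemann mapping theorem for domains on which holomorphic square roots exist. -/
theorem exists_isDiskEmbedding_surjOn {U : Set ℂ} (hU : IsOpen U) (hUc : IsPreconnected U)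
    (h0 : (0 : ℂ) ∈ U) (hne : U ≠ univ) (hsq : HasHolomorphicSqrt U) :
    ∃ f, IsDiskEmbedding f U ∧ f '' U = Metric.ball 0 1 := by
  set S : Set ℝ := {x | ∃ f, IsDiskEmbedding f U ∧ ‖deriv f 0‖ = x} with hS
  obtain ⟨f₀, hf₀⟩ := exists_isDiskEmbedding hU h0 hne hsq
  have hSne : S.Nonempty := ⟨_, f₀, hf₀, rfl⟩
  obtain ⟨r, hr, hrU⟩ := Metric.isOpen_iff.1 hU 0 h0
  have hSb : BddAbove S := by
    refine ⟨1 / r, ?_⟩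
    rintro x ⟨f, hf, rfl⟩
    refine Complex.norm_deriv_le_div_of_mapsTo_ball (hf.differentiableOn.mono hrU) ?_ hr
    intro z hz
    rw [hf.map_zero]
    exact Metric.ball_subset_closedBall (hf.mapsTo (hrU hz))
  -- A maximizing sequence has a limit attaining the supremum, which is positive; an omitted value
  -- would allow a strictly larger derivative.
  obtain ⟨u, -, hu, huS⟩ := exists_seq_tendsto_sSup hSne hSb
  choose f hf hfu using huS
  obtain ⟨g, φ, hφ, hlim⟩ := exists_subseq_tendstoLocallyUniformlyOn_of_bounded hU
    (fun n => (hf n).differentiableOn) (M := 1)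
    fun n z hz => (mem_ball_zero_iff.1 ((hf n).mapsTo hz)).le
  have hd : Tendsto (fun n => ‖deriv (f (φ n)) 0‖) atTop (𝓝 ‖deriv g 0‖) :=
    ((hlim.deriv (Eventually.of_forall fun n => (hf _).differentiableOn) hU).tendsto_at h0).norm
  have hsup : ‖deriv g 0‖ = sSup S := by
    refine tendsto_nhds_unique hd ?_
    simp only [hfu]
    exact hu.comp hφ.tendsto_atTop
  have hg0 : deriv g 0 ≠ 0 := by
    rw [← norm_pos_iff, hsup]
    exact (norm_pos_iff.2 (hf₀.deriv_ne_zero 0 h0)).trans_le (le_csSup hSb ⟨f₀, hf₀, rfl⟩)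
  have hg : IsDiskEmbedding g U := IsDiskEmbedding.of_tendstoLocallyUniformlyOn hU hUc h0
    (fun n => hf (φ n)) hlim hg0
  refine ⟨g, hg, Subset.antisymm hg.mapsTo.image_subset fun a ha => ?_⟩
  by_contra hag
  obtain ⟨k, hk, hlt⟩ := hg.exists_norm_deriv_lt hU h0 hsq (mem_ball_zero_iff.1 ha) hag
  have := le_csSup hSb ⟨k, hk, rfl⟩
  linarith

/-! ### The `∂̄` operator, smooth cutoffs and existence of primitives -/

/-- Twice the Wirtinger derivative with respect to the conjugate variable. -/
noncomputable def dbar (f : ℂ → ℂ) (w : ℂ) : ℂ :=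
  fderiv ℝ f w 1 + Complex.I * fderiv ℝ f w Complex.I

theorem continuous_dbar {f : ℂ → ℂ} (hf : ContDiff ℝ ∞ f) : Continuous (dbar f) := by
  have h := hf.continuous_fderiv (by simp)
  unfold dbar
  fun_prop

theorem dbar_eq_of_eventuallyEq {f g : ℂ → ℂ} {w : ℂ} (h : f =ᶠ[𝓝 w] g) : dbar f w = dbar g w := by
  rw [dbar, dbar, h.fderiv_eq]

theorem dbar_const (c w : ℂ) : dbar (fun _ => c) w = 0 := by
  simp [dbar]

theorem dbar_sub {f g : ℂ → ℂ} {w : ℂ} (hf : DifferentiableAt ℝ f w)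
    (hg : DifferentiableAt ℝ g w) : dbar (fun z => f z - g z) w = dbar f w - dbar g w := by
  simp only [dbar, fderiv_fun_sub hf hg, sub_apply]
  ring

theorem support_dbar_subset (f : ℂ → ℂ) : Function.support (dbar f) ⊆ tsupport f := by
  intro w hw
  by_contra h
  refine hw ?_
  have : f =ᶠ[𝓝 w] fun _ => (0 : ℂ) := notMem_tsupport_iff_eventuallyEq.1 h
  rw [dbar_eq_of_eventuallyEq this, dbar_const]

theorem hasCompactSupport_dbar {f : ℂ → ℂ} (hf : HasCompactSupport f) :
    HasCompactSupport (dbar f) :=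
  hf.mono' (support_dbar_subset f)

theorem integrable_mul_of_continuousOn {a b : ℂ → ℂ} {K : Set ℂ} (hK : IsCompact K)
    (ha : ContinuousOn a K) (hb : Continuous b) (hbK : Function.support b ⊆ K) :
    Integrable fun w => a w * b w := by
  rw [← integrableOn_iff_integrable_of_support_subset (s := K)]
  · exact (ha.mul hb.continuousOn).integrableOn_compact hK
  · intro w hw
    exact hbK (right_ne_zero_of_mul hw)

/-- Integration by parts moves `∂̄` onto `q`, where the Cauchy–Riemann equations annihilate it. -/
theorem integral_mul_dbar_eq_zero {U : Set ℂ} (hU : IsOpen U) {q χ : ℂ → ℂ}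
    (hq : DifferentiableOn ℂ q U) (hχ : ContDiff ℝ ∞ χ) (hχc : HasCompactSupport χ)
    (hχU : tsupport χ ⊆ U) : ∫ w, q w * dbar χ w = 0 := by
  have hqt : ContinuousOn q (tsupport χ) := hq.continuousOn.mono hχU
  have hdq : ContinuousOn (deriv q) (tsupport χ) := (hq.deriv hU).continuousOn.mono hχU
  have hfd : ∀ w ∈ U, ∀ v, fderiv ℝ q w v = v * deriv q w := fun w hw v => by
    have h1 := hq.differentiableAt (hU.mem_nhds hw)
    rw [h1.fderiv_restrictScalars ℝ]
    simp
  have hcf : ∀ v : ℂ, Continuous fun w => fderiv ℝ χ w v := fun v =>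
    (hχ.continuous_fderiv (by simp)).clm_apply continuous_const
  have hsf : ∀ v : ℂ, Function.support (fun w => fderiv ℝ χ w v) ⊆ tsupport χ := fun v w hw => by
    refine support_fderiv_subset ℝ fun h => hw ?_
    simp [h]
  have hi1 : ∀ v : ℂ, Integrable fun w => q w * fderiv ℝ χ w v := fun v =>
    integrable_mul_of_continuousOn hχc hqt (hcf v) (hsf v)
  have hi2 : ∀ v : ℂ, Integrable fun w => fderiv ℝ q w v * χ w := fun v => by
    refine integrable_mul_of_continuousOn hχc ?_ hχ.continuous (subset_tsupport χ)
    exact (continuousOn_const.mul hdq).congr fun w hw => hfd w (hχU hw) v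
  have hi3 : Integrable fun w => q w * χ w :=
    integrable_mul_of_continuousOn hχc hqt hχ.continuous (subset_tsupport χ)
  have hparts : ∀ v : ℂ, ∫ w, q w * fderiv ℝ χ w v = -∫ w, fderiv ℝ q w v * χ w := fun v =>
    integral_mul_fderiv_eq_neg_fderiv_mul_of_integrable (hi2 v) (hi1 v) hi3
      (fun w hw => (hq.differentiableAt (hU.mem_nhds (hχU hw))).restrictScalars ℝ)
      (fun w _ => (hχ.differentiable (by simp)) w)
  have hsplit : (fun w => q w * dbar χ w) =
      fun w => q w * fderiv ℝ χ w 1 + Complex.I * (q w * fderiv ℝ χ w Complex.I) := by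
    ext w; simp only [dbar]; ring
  have hzero : (fun w => fderiv ℝ q w 1 * χ w + Complex.I * (fderiv ℝ q w Complex.I * χ w)) =
      fun _ => 0 := by
    ext w
    by_cases hw : w ∈ tsupport χ
    · simp only [hfd w (hχU hw)]
      linear_combination (deriv q w * χ w) * Complex.I_mul_I
    · simp [image_eq_zero_of_notMem_tsupport hw]
  have hsum := integral_add (hi2 1) ((hi2 Complex.I).const_mul Complex.I)
  rw [hzero, integral_zero, integral_const_mul] at hsum
  rw [hsplit, integral_add (hi1 1) ((hi1 _).const_mul _), integral_const_mul, hparts, hparts]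
  linear_combination hsum

/-- A smooth real cutoff function, equal to `1` on the unit disk. -/
noncomputable def diskCutoff (u : ℂ) : ℝ := Real.smoothTransition (2 - ‖u‖ ^ 2)

theorem contDiff_diskCutoff : ContDiff ℝ ∞ diskCutoff :=
  Real.smoothTransition.contDiff.comp (contDiff_const.sub (contDiff_norm_sq ℝ))

theorem diskCutoff_of_norm_le_one {u : ℂ} (hu : ‖u‖ ≤ 1) : diskCutoff u = 1 :=
  Real.smoothTransition.one_of_one_le (by nlinarith [norm_nonneg u])

theorem diskCutoff_of_two_le_sq {u : ℂ} (hu : 2 ≤ ‖u‖ ^ 2) : diskCutoff u = 0 :=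
  Real.smoothTransition.zero_of_nonpos (by linarith)

theorem hasCompactSupport_diskCutoff : HasCompactSupport diskCutoff := by
  refine HasCompactSupport.of_support_subset_isCompact (isCompact_closedBall (0 : ℂ) 2)
    fun u hu => ?_
  by_contra h
  rw [mem_closedBall_zero_iff, not_le] at h
  exact hu (diskCutoff_of_two_le_sq (by nlinarith))

/-- The cutoff function `diskCutoff` with complex values. -/
noncomputable def radialCutoff (u : ℂ) : ℂ := ((diskCutoff u : ℝ) : ℂ)

theorem contDiff_radialCutoff : ContDiff ℝ ∞ radialCutoff :=
  Complex.ofRealCLM.contDiff.comp contDiff_diskCutoff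

theorem radialCutoff_of_norm_le_one {u : ℂ} (hu : ‖u‖ ≤ 1) : radialCutoff u = 1 := by
  rw [radialCutoff, diskCutoff_of_norm_le_one hu, Complex.ofReal_one]

theorem hasCompactSupport_radialCutoff : HasCompactSupport radialCutoff :=
  hasCompactSupport_diskCutoff.comp_left (g := Complex.ofReal) Complex.ofReal_zero

theorem dbar_radialCutoff (u : ℂ) :
    dbar radialCutoff u = -2 * u * (deriv Real.smoothTransition (2 - ‖u‖ ^ 2) : ℝ) := by
  have h1 : HasFDerivAt (fun u : ℂ => 2 - ‖u‖ ^ 2) (-(2 • innerSL ℝ u)) u := by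
    exact (hasStrictFDerivAt_norm_sq u).hasFDerivAt.const_sub 2
  have h2 : HasDerivAt Real.smoothTransition (deriv Real.smoothTransition (2 - ‖u‖ ^ 2))
      (2 - ‖u‖ ^ 2) :=
    ((Real.smoothTransition.contDiff (n := 1)).differentiable (by simp) _).hasDerivAt
  have h3 := (Complex.ofRealCLM.hasFDerivAt (x := Real.smoothTransition (2 - ‖u‖ ^ 2))).comp u
    (h2.comp_hasFDerivAt u h1)
  have h4 : fderiv ℝ radialCutoff u = _ := h3.fderiv
  rw [dbar, h4]
  apply Complex.ext <;> simp [Complex.inner] <;> ring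

/-- The constant of the Cauchy–Pompeiu formula below. Only its nonvanishing matters: off `0` the
integrand is `-2` times a nonnegative continuous function that is not identically zero. -/
theorem integral_dbar_radialCutoff_div_ne_zero : ∫ u, u⁻¹ * dbar radialCutoff u ≠ 0 := by
  set k : ℂ → ℝ := fun u => deriv Real.smoothTransition (2 - ‖u‖ ^ 2) with hk
  have hψ : Continuous (deriv Real.smoothTransition) :=
    (Real.smoothTransition.contDiff (n := 1)).continuous_deriv (by simp)
  have hkc : Continuous k := hψ.comp (by fun_prop)
  have hmono : Monotone Real.smoothTransition := Real.smoothTransition.monotone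
  have hk0 : ∀ u, 0 ≤ k u := fun u => hmono.deriv_nonneg
  have hks : HasCompactSupport k := by
    refine HasCompactSupport.of_support_subset_isCompact (isCompact_closedBall (0 : ℂ) 2)
      fun u hu => ?_
    by_contra h
    refine hu ?_
    rw [mem_closedBall_zero_iff, not_le] at h
    have h2 : (2 - ‖u‖ ^ 2 : ℝ) < 0 := by nlinarith
    have : Real.smoothTransition =ᶠ[𝓝 (2 - ‖u‖ ^ 2)] fun _ => 0 := by
      filter_upwards [Iio_mem_nhds h2] with t ht
      exact Real.smoothTransition.zero_of_nonpos (le_of_lt ht)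
    simp only [hk]
    rw [this.deriv_eq, deriv_const]
  -- The transition rises from `0` to `1` on the unit interval, so its derivative is `1` at some
  -- `t`; the radius `√(2 - t)` corresponds to it.
  obtain ⟨t, ht, hd⟩ := exists_deriv_eq_slope Real.smoothTransition (zero_lt_one' ℝ)
    Real.smoothTransition.continuous.continuousOn
    ((Real.smoothTransition.contDiff (n := 1)).differentiable (by simp)).differentiableOn
  have hkne : k ((√(2 - t) : ℝ) : ℂ) ≠ 0 := by
    simp only [hk, Complex.norm_real, Real.norm_eq_abs, sq_abs]
    rw [Real.sq_sqrt (by linarith [ht.2]), sub_sub_cancel, hd]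
    simp
  have hpos := hkc.integral_pos_of_hasCompactSupport_nonneg_nonzero (μ := volume) hks hk0 hkne
  have heq : ∫ u, u⁻¹ * dbar radialCutoff u = ∫ u, ((-2 * k u : ℝ) : ℂ) := by
    refine integral_congr_ae ?_
    filter_upwards [compl_mem_ae_iff.2 (measure_singleton (0 : ℂ))] with u hu
    have hu0 : u ≠ 0 := hu
    rw [dbar_radialCutoff]
    push_cast
    field_simp
    rfl
  rw [heq, integral_complex_ofReal, integral_const_mul, Complex.ofReal_ne_zero]
  exact mul_ne_zero (by norm_num) hpos.ne'

/-- Cauchy–Pompeiu type representation of a holomorphic function by a smooth cutoff. -/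
theorem integral_dbar_cutoff {U : Set ℂ} (hU : IsOpen U) {g χ : ℂ → ℂ}
    (hg : DifferentiableOn ℂ g U) (hχ : ContDiff ℝ ∞ χ) (hχc : HasCompactSupport χ)
    (hχU : tsupport χ ⊆ U) {z : ℂ} (hz : z ∈ U) (hz1 : ∀ᶠ w in 𝓝 z, χ w = 1) :
    ∫ w, (w - z)⁻¹ * (dbar χ w * g w) = g z * ∫ u, u⁻¹ * dbar radialCutoff u := by
  have hd0 : ∀ᶠ w in 𝓝 z, dbar χ w = 0 := by
    filter_upwards [hz1.eventually_nhds] with w hw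
    rw [dbar_eq_of_eventuallyEq (g := fun _ => 1) hw, dbar_const]
  have hzs : z ∉ tsupport (dbar χ) := notMem_tsupport_iff_eventuallyEq.2 hd0
  set K := tsupport (dbar χ) with hK
  have hKc : IsCompact K := hasCompactSupport_dbar hχc
  have hKU : K ⊆ U := (closure_minimal (support_dbar_subset χ) (isClosed_tsupport χ)).trans hχU
  have hcinv : ContinuousOn (fun w => (w - z)⁻¹) K :=
    (continuousOn_id.sub continuousOn_const).inv₀ fun w hw h => hzs (by
      rwa [← show w = z from sub_eq_zero.1 h])
  have hi1 : Integrable fun w => (w - z)⁻¹ * dbar χ w :=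
    integrable_mul_of_continuousOn hKc hcinv (continuous_dbar hχ) (subset_tsupport _)
  have hi2 : Integrable fun w => ((w - z)⁻¹ * g w) * dbar χ w :=
    integrable_mul_of_continuousOn hKc (hcinv.mul (hg.continuousOn.mono hKU))
      (continuous_dbar hχ) (subset_tsupport _)
  -- The difference quotient is holomorphic across `z`, which reduces the formula to constant `g`.
  have h1 : ∫ w, dslope g z w * dbar χ w = 0 :=
    integral_mul_dbar_eq_zero hU
      ((Complex.differentiableOn_dslope (hU.mem_nhds hz)).2 hg) hχ hχc hχU
  have h2 : ∀ w, dslope g z w * dbar χ w =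
      ((w - z)⁻¹ * g w) * dbar χ w - g z * ((w - z)⁻¹ * dbar χ w) := fun w => by
    rcases eq_or_ne w z with rfl | hne
    · simp [hd0.self_of_nhds]
    · rw [dslope_of_ne _ hne, slope_def_field]
      ring
  simp only [h2] at h1
  rw [integral_sub hi2 (hi1.const_mul _), integral_const_mul, sub_eq_zero] at h1
  have h3 : ∫ w, (w - z)⁻¹ * (dbar χ w * g w) = ∫ w, ((w - z)⁻¹ * g w) * dbar χ w := by
    congr 1; ext w; ring
  rw [h3, h1]
  congr 1
  set ρ : ℂ → ℂ := fun w => radialCutoff (w - z) with hρ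
  have hρd : ContDiff ℝ ∞ ρ := contDiff_radialCutoff.comp (contDiff_id.sub contDiff_const)
  have hρc : HasCompactSupport ρ := by
    have := hasCompactSupport_radialCutoff.comp_homeomorph (Homeomorph.subRight z)
    exact this
  have hρ1 : ∀ᶠ w in 𝓝 z, ρ w = 1 := by
    filter_upwards [Metric.ball_mem_nhds z one_pos] with w hw
    exact radialCutoff_of_norm_le_one (by rw [← dist_eq_norm]; exact (Metric.mem_ball.1 hw).le)
  have hρ0 : ∀ᶠ w in 𝓝 z, dbar ρ w = 0 := by
    filter_upwards [hρ1.eventually_nhds] with w hw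
    rw [dbar_eq_of_eventuallyEq (g := fun _ => 1) hw, dbar_const]
  have hzρ : z ∉ tsupport (dbar ρ) := notMem_tsupport_iff_eventuallyEq.2 hρ0
  have hi3 : Integrable fun w => (w - z)⁻¹ * dbar ρ w :=
    integrable_mul_of_continuousOn (hasCompactSupport_dbar hρc)
      ((continuousOn_id.sub continuousOn_const).inv₀ fun w hw h => hzρ (by
      rwa [← show w = z from sub_eq_zero.1 h])) (continuous_dbar hρd) (subset_tsupport _)
  -- Any two cutoffs equal to `1` near `z` give the same integral: their difference is supported
  -- away from `z`, where the kernel is holomorphic.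
  have h4 : ∫ w, (w - z)⁻¹ * dbar (fun w => χ w - ρ w) w = 0 := by
    refine integral_mul_dbar_eq_zero (U := {z}ᶜ) isOpen_compl_singleton ?_ (hχ.sub hρd)
      (hχc.sub hρc) ?_
    · intro w hw
      exact ((differentiableAt_id.sub_const z).inv (sub_ne_zero.2 hw)).differentiableWithinAt
    · intro w hw h
      rw [mem_singleton_iff] at h
      subst h
      refine notMem_tsupport_iff_eventuallyEq.2 ?_ hw
      filter_upwards [hz1, hρ1] with v h1 h2
      simp [h1, h2]
  simp only [dbar_sub (hχ.differentiable (by simp) _) (hρd.differentiable (by simp) _),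
    mul_sub] at h4
  rw [integral_sub hi1 hi3, sub_eq_zero] at h4
  rw [h4, ← integral_sub_right_eq_self (fun u => u⁻¹ * dbar radialCutoff u) z]
  congr 1
  ext w
  simp only [dbar, hρ, fderiv_comp_sub]

theorem div_mem_slitPlane_of_norm_sub_lt {a b : ℂ} (h : ‖a - b‖ < ‖b‖) : a / b ∈ Complex.slitPlane := by
  have hb : b ≠ 0 := fun h0 => by
    rw [h0, norm_zero] at h
    exact absurd h (not_lt.2 (norm_nonneg _))
  have : a / b = 1 + (a - b) / b := by field_simp; ring
  rw [this]
  refine Complex.mem_slitPlane_of_norm_lt_one ?_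
  rwa [norm_div, div_lt_one (norm_pos_iff.2 hb)]

theorem hasDerivAt_neg_log_div {c c' z : ℂ} (h : ‖c - c'‖ < ‖c' - z‖) :
    HasDerivAt (fun z => -Complex.log ((c - z) / (c' - z))) ((c - z)⁻¹ - (c' - z)⁻¹) z := by
  have hs : (c - z) / (c' - z) ∈ Complex.slitPlane :=
    div_mem_slitPlane_of_norm_sub_lt (by rwa [sub_sub_sub_cancel_right])
  have h0 := Complex.slitPlane_ne_zero hs
  have h1 : c - z ≠ 0 := fun h => h0 (by simp [h])
  have h2 : c' - z ≠ 0 := fun h => h0 (by simp [h])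
  have hd := ((((hasDerivAt_id z).const_sub c).div ((hasDerivAt_id z).const_sub c') h2).clog hs).neg
  convert! hd using 1
  simp only [id, Pi.div_apply]
  field_simp
  ring

/-- The quotient `(c - z) / (c' - z)` stays in the slit plane, so its logarithm is single-valued and
its negative is a primitive of the difference of the two kernels. This is how poles are moved. -/
theorem isExactOn_inv_sub_of_near {V : Set ℂ} {c c' : ℂ}
    (hd : ∀ z ∈ V, ‖c - c'‖ < ‖c' - z‖) (h : Complex.IsExactOn (fun z => (c' - z)⁻¹) V) :
    Complex.IsExactOn (fun z => (c - z)⁻¹) V := by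
  obtain ⟨P, hP⟩ := h
  refine ⟨fun z => P z + -Complex.log ((c - z) / (c' - z)), fun z hz => ?_⟩
  have := (hP z hz).add (hasDerivAt_neg_log_div (hd z hz))
  convert! this using 1
  ring

theorem isExactOn_inv_sub_of_norm_lt {V : Set ℂ} {c : ℂ} (hd : ∀ z ∈ V, ‖z‖ < ‖c‖) :
    Complex.IsExactOn (fun z => (c - z)⁻¹) V := by
  refine ⟨fun z => -Complex.log ((c - z) / c), fun z hz => ?_⟩
  have hs : (c - z) / c ∈ Complex.slitPlane :=
    div_mem_slitPlane_of_norm_sub_lt (by simpa using hd z hz)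
  have hc : c ≠ 0 := fun h0 => (norm_nonneg z).not_gt (by simpa [h0] using hd z hz)
  have h0 := Complex.slitPlane_ne_zero hs
  have h1 : c - z ≠ 0 := fun h => h0 (by simp [h])
  have hd := ((((hasDerivAt_id z).const_sub c).div_const c).clog hs).neg
  convert! hd using 1
  simp only [id]
  field_simp

/-- For poles near `w₀` the logarithms relating their kernels to the one at `w₀` are uniformly
controlled, so they can be integrated and differentiated under the integral sign. -/
theorem isExactOn_setIntegral {V : Set ℂ} (hV : IsOpen V) {k : ℂ → ℂ} (hk : Integrable k)
    {δ : ℝ} (hδ : 0 < δ) {w₀ : ℂ} (hdist : ∀ z ∈ V, 2 * δ ≤ ‖w₀ - z‖)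
    (hgood : Complex.IsExactOn (fun z => (w₀ - z)⁻¹) V) {A : Set ℂ} (hA : MeasurableSet A)
    (hAb : A ⊆ Metric.ball w₀ δ) :
    Complex.IsExactOn (fun z => ∫ w in A, (w - z)⁻¹ * k w) V := by
  obtain ⟨P, hP⟩ := hgood
  have hnear : ∀ w ∈ A, ‖w - w₀‖ < δ := fun w hw => by
    rw [← dist_eq_norm]; exact hAb hw
  have hlow : ∀ w ∈ A, ∀ z ∈ V, δ ≤ ‖w - z‖ := fun w hw z hz => by
    have h1 := hdist z hz
    have h2 := hnear w hw
    have h3 : ‖w₀ - z‖ ≤ ‖w - w₀‖ + ‖w - z‖ := by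
      rw [norm_sub_rev w w₀]
      calc ‖w₀ - z‖ = ‖(w₀ - w) + (w - z)‖ := by congr 1; ring
        _ ≤ _ := norm_add_le _ _
    linarith
  have hinv : ∀ w ∈ A, ∀ z ∈ V, ‖(w - z)⁻¹‖ ≤ δ⁻¹ := fun w hw z hz => by
    rw [norm_inv]
    exact inv_anti₀ hδ (hlow w hw z hz)
  have hinv0 : ∀ z ∈ V, ‖(w₀ - z)⁻¹‖ ≤ δ⁻¹ := fun z hz => by
    rw [norm_inv]
    exact inv_anti₀ hδ (by linarith [hdist z hz])
  have hkA : Integrable k (volume.restrict A) := hk.integrableOn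
  have hint : ∀ z ∈ V, Integrable (fun w => (w - z)⁻¹ * k w) (volume.restrict A) := fun z hz => by
    refine hkA.bdd_mul (c := δ⁻¹) ?_ ?_
    · exact ((measurable_id.sub_const z).inv).aestronglyMeasurable
    · exact (ae_restrict_iff' hA).2 (Eventually.of_forall fun w hw => hinv w hw z hz)
  refine ⟨fun z => (∫ w in A, k w) * P z +
    ∫ w in A, -Complex.log ((w - z) / (w₀ - z)) * k w, fun z hz => ?_⟩
  have hmeas : ∀ z, AEStronglyMeasurable (fun w => -Complex.log ((w - z) / (w₀ - z)) * k w)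
      (volume.restrict A) := fun z => by
    refine AEStronglyMeasurable.mul ?_ hkA.aestronglyMeasurable
    exact (Complex.measurable_log.comp
      ((measurable_id.sub_const z).div_const _)).neg.aestronglyMeasurable
  have hsmall : ∀ w ∈ A, ‖(w - w₀) / (w₀ - z)‖ ≤ 1 / 2 := fun w hw => by
    have h1 := hdist z hz
    rw [norm_div, div_le_iff₀ (by linarith)]
    linarith [hnear w hw]
  have hne : w₀ - z ≠ 0 := norm_pos_iff.1 (by linarith [hdist z hz])
  have hlogint : Integrable (fun w => -Complex.log ((w - z) / (w₀ - z)) * k w)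
      (volume.restrict A) := by
    -- From `|log (1 + u)| ≤ 3 / 2 * |u|` with `|u| ≤ 1 / 2`.
    refine hkA.bdd_mul (c := 3 / 4) ?_ ?_
    · exact (Complex.measurable_log.comp
      ((measurable_id.sub_const z).div_const _)).neg.aestronglyMeasurable
    · refine (ae_restrict_iff' hA).2 (Eventually.of_forall fun w hw => ?_)
      have h1 := hsmall w hw
      have h2 : (w - z) / (w₀ - z) = 1 + (w - w₀) / (w₀ - z) := by field_simp; ring
      rw [norm_neg, h2]
      have := Complex.norm_log_one_add_half_le_self h1
      linarith
  have hder := hasDerivAt_integral_of_dominated_loc_of_deriv_le (μ := volume.restrict A)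
    (F := fun z w => -Complex.log ((w - z) / (w₀ - z)) * k w)
    (F' := fun z w => ((w - z)⁻¹ - (w₀ - z)⁻¹) * k w)
    (bound := fun w => (δ⁻¹ + δ⁻¹) * ‖k w‖) (hV.mem_nhds hz)
    (Eventually.of_forall hmeas) hlogint ?_ ?_ (hkA.norm.const_mul _) ?_
  · have h1 := ((hP z hz).const_mul (∫ w in A, k w)).add hder.2
    convert! h1 using 1
    simp only [sub_mul]
    rw [integral_sub (hint z hz) (hkA.const_mul _), integral_const_mul]
    ring
  · exact (((measurable_id.sub_const z).inv.sub_const _).aestronglyMeasurable).mul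
      hkA.aestronglyMeasurable
  · refine (ae_restrict_iff' hA).2 (Eventually.of_forall fun w hw x hx => ?_)
    rw [norm_mul]
    gcongr
    exact (norm_sub_le _ _).trans (add_le_add (hinv w hw x hx) (hinv0 x hx))
  · refine (ae_restrict_iff' hA).2 (Eventually.of_forall fun w hw x hx => ?_)
    refine (hasDerivAt_neg_log_div ?_).mul_const (k w)
    linarith [hnear w hw, hdist x hx]

/-- The support is covered by finitely many balls of radius `δ` centred at admissible poles; their
successive differences split the integral into pieces of the preceding kind. -/
theorem isExactOn_integral {V : Set ℂ} (hV : IsOpen V) {k : ℂ → ℂ} (hk : Continuous k)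
    (hkc : HasCompactSupport k) {δ : ℝ} (hδ : 0 < δ)
    (hdist : ∀ w, k w ≠ 0 → ∀ z ∈ V, 2 * δ ≤ ‖w - z‖)
    (hgood : ∀ w, k w ≠ 0 → Complex.IsExactOn (fun z => (w - z)⁻¹) V) :
    Complex.IsExactOn (fun z => ∫ w, (w - z)⁻¹ * k w) V := by
  have hki : Integrable k := hk.integrable_of_hasCompactSupport hkc
  have hint : ∀ z ∈ V, Integrable (fun w => (w - z)⁻¹ * k w) := fun z hz => by
    refine Integrable.mono' (hki.norm.const_mul ((2 * δ)⁻¹))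
      (((measurable_id.sub_const z).inv.aestronglyMeasurable).mul hki.aestronglyMeasurable)
      (Eventually.of_forall fun w => ?_)
    rw [norm_mul]
    by_cases hw : k w = 0
    · simp [hw]
    · gcongr
      rw [norm_inv]
      exact inv_anti₀ (by positivity) (hdist w hw z hz)
  have hcov : tsupport k ⊆ ⋃ w : Function.support k, Metric.ball (w : ℂ) δ := by
    intro x hx
    obtain ⟨y, hy, hxy⟩ := Metric.mem_closure_iff.1 hx δ hδ
    exact mem_iUnion.2 ⟨⟨y, hy⟩, hxy⟩
  obtain ⟨t, ht⟩ := hkc.isCompact.elim_finite_subcover _ (fun _ => Metric.isOpen_ball) hcov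
  have hind : ∀ s : Finset (Function.support k), Complex.IsExactOn
      (fun z => ∫ w in ⋃ i ∈ s, Metric.ball (i : ℂ) δ, (w - z)⁻¹ * k w) V := by
    classical
    intro s
    induction s using Finset.induction_on with
    | empty => exact ⟨fun _ => 0, fun z _ => by simpa using hasDerivAt_const z (0 : ℂ)⟩
    | insert i s _ ih =>
      have hm : MeasurableSet (⋃ j ∈ s, Metric.ball (j : ℂ) δ) :=
        Finset.measurableSet_biUnion _ fun _ _ => Metric.isOpen_ball.measurableSet
      obtain ⟨P₁, hP₁⟩ := ih
      obtain ⟨P₂, hP₂⟩ := isExactOn_setIntegral hV hki hδ (hdist i i.2) (hgood i i.2)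
        (Metric.isOpen_ball.measurableSet.diff hm) sdiff_subset
      refine ⟨fun z => P₁ z + P₂ z, fun z hz => ?_⟩
      have := (hP₁ z hz).add (hP₂ z hz)
      rw [← setIntegral_union disjoint_sdiff_right
        (Metric.isOpen_ball.measurableSet.diff hm) (hint z hz).integrableOn
        (hint z hz).integrableOn] at this
      rw [Finset.set_biUnion_insert, union_comm, ← union_sdiff_self]
      exact this
  obtain ⟨P, hP⟩ := hind t
  refine ⟨P, fun z hz => ?_⟩
  have := hP z hz
  beta_reduce at this ⊢
  rwa [setIntegral_eq_integral_of_forall_compl_eq_zero] at this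
  intro w hw
  have : w ∉ tsupport k := fun h => hw (ht h)
  simp [image_eq_zero_of_notMem_tsupport this]

/-- The `V n` may be disconnected, so only the component of a base point `x` is kept. There the
primitives vanishing at `x` agree, and compactness of paths shows that these components exhaust `U`.
-/
theorem isExactOn_of_monotone_exhaustion {U : Set ℂ} (hU : IsOpen U) (hUc : IsConnected U)
    {V : ℕ → Set ℂ} (hVo : ∀ n, IsOpen (V n)) (hVm : Monotone V) (hVU : ⋃ n, V n = U)
    {g : ℂ → ℂ} (hg : ∀ n, Complex.IsExactOn g (V n)) : Complex.IsExactOn g U := by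
  classical
  obtain ⟨x, hx⟩ := hUc.nonempty
  set W : ℕ → Set ℂ := fun n => connectedComponentIn (V n) x with hW
  have hWV : ∀ n, W n ⊆ V n := fun n => connectedComponentIn_subset _ _
  have hWo : ∀ n, IsOpen (W n) := fun n => (hVo n).connectedComponentIn
  have hWm : Monotone W := fun m n h => connectedComponentIn_mono x (hVm h)
  have hxW : ∀ n z, z ∈ W n → x ∈ W n := fun n z hz => by
    have : x ∈ V n := connectedComponentIn_nonempty_iff.1 ⟨z, hz⟩
    exact mem_connectedComponentIn this
  have hex : ∀ z ∈ U, ∃ n, z ∈ W n := by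
    intro z hz
    obtain ⟨γ, hγ⟩ := (hU.isConnected_iff_isPathConnected.1 hUc).joinedIn x hx z hz
    obtain ⟨n, hn⟩ := (isCompact_range γ.continuous).elim_directed_cover V hVo
      (by rw [hVU]; rintro _ ⟨t, rfl⟩; exact hγ t) hVm.directed_le
    have hsub := (isPreconnected_range γ.continuous).subset_connectedComponentIn
      ⟨0, γ.source⟩ hn
    exact ⟨n, hsub ⟨1, γ.target⟩⟩
  choose G hG0 hG using fun n => (hg n).with_val_at x 0
  have hagree : ∀ m n, m ≤ n → EqOn (G n) (G m) (W m) := by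
    intro m n hmn z hz
    have hd : ∀ w ∈ W m, HasDerivAt (fun z => G n z - G m z) 0 w := fun w hw => by
      simpa using (hG n w (hVm hmn (hWV m hw))).fun_sub (hG m w (hWV m hw))
    have := (hWo m).is_const_of_deriv_eq_zero isPreconnected_connectedComponentIn
      (fun w hw => (hd w hw).differentiableAt.differentiableWithinAt)
      (fun w hw => (hd w hw).deriv) hz (hxW m z hz)
    simp only [hG0, sub_zero] at this
    exact sub_eq_zero.1 this
  -- The primitives are glued by using the least admissible index at each point; by `hagree` this
  -- choice agrees with any `G n` on `W n`.
  set N : ℂ → ℕ := fun z => if h : ∃ n, z ∈ W n then Nat.find h else 0 with hN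
  refine ⟨fun z => G (N z) z, fun z hz => ?_⟩
  obtain ⟨n, hn⟩ := hex z hz
  refine (hG n z (hWV n hn)).congr_of_eventuallyEq ?_
  filter_upwards [(hWo n).mem_nhds hn] with w hw
  have hw' : ∃ n, w ∈ W n := ⟨n, hw⟩
  have hNw : N w = Nat.find hw' := dif_pos hw'
  rw [hNw]
  exact (hagree _ n (Nat.find_min' hw' hw) (Nat.find_spec hw')).symm

/-- If every function `z ↦ 1 / (c - z)` with a boundary point `c` has primitives on the
bounded open sets that stay away from the complement of the domain `U`, then all
holomorphic functions on `U` have primitives. -/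
theorem isExactOn_of_forall_frontier {U : Set ℂ} (hU : IsOpen U) (hUc : IsConnected U)
    (hUne : U ≠ univ)
    (hgood : ∀ V : Set ℂ, ∀ R δ : ℝ, 0 < δ → (∀ z ∈ V, ‖z‖ < R) →
      (∀ z ∈ V, ∀ c ∉ U, δ ≤ dist z c) → ∀ c ∈ frontier U,
        Complex.IsExactOn (fun z => (c - z)⁻¹) V)
    {g : ℂ → ℂ} (hg : DifferentiableOn ℂ g U) : Complex.IsExactOn g U := by
  have hFne : (Uᶜ).Nonempty := nonempty_compl.2 hUne
  have hFc : IsClosed Uᶜ := hU.isClosed_compl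
  have hcont : Continuous fun z => Metric.infDist z Uᶜ := Metric.continuous_infDist_pt _
  have hpos : ∀ z, 0 < Metric.infDist z Uᶜ → z ∈ U := fun z hz => by
    by_contra h
    rw [Metric.infDist_zero_of_mem (show z ∈ Uᶜ from h)] at hz
    exact lt_irrefl _ hz
  have key : ∀ R δ : ℝ, 0 < δ →
      Complex.IsExactOn g {z | ‖z‖ < R ∧ 4 * δ < Metric.infDist z Uᶜ} := by
    intro R δ hδ
    -- The cutoff will be `1` near `K` and supported in `t`, so its `∂̄` lives in `t \ K`, away from
    -- `V` but still inside `U`.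
    set V : Set ℂ := {z | ‖z‖ < R ∧ 4 * δ < Metric.infDist z Uᶜ} with hV
    set K : Set ℂ := {z | ‖z‖ ≤ R + 1 ∧ δ ≤ Metric.infDist z Uᶜ} with hK
    set t : Set ℂ := {z | ‖z‖ ≤ R + 2 ∧ δ / 2 ≤ Metric.infDist z Uᶜ} with ht
    have hVo : IsOpen V := (isOpen_lt continuous_norm continuous_const).inter
      (isOpen_lt continuous_const hcont)
    have hKc : IsClosed K := (isClosed_le continuous_norm continuous_const).inter
      (isClosed_le continuous_const hcont)
    have htc : IsClosed t := (isClosed_le continuous_norm continuous_const).inter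
      (isClosed_le continuous_const hcont)
    have htcpt : IsCompact t := (isCompact_closedBall (0 : ℂ) (R + 2)).of_isClosed_subset htc
      fun z hz => mem_closedBall_zero_iff.2 hz.1
    have hKt : K ⊆ interior t := by
      have ho : IsOpen {z : ℂ | ‖z‖ < R + 2 ∧ δ / 2 < Metric.infDist z Uᶜ} :=
        (isOpen_lt continuous_norm continuous_const).inter (isOpen_lt continuous_const hcont)
      refine fun z hz => mem_interior.2 ⟨_, fun w hw => ⟨hw.1.le, hw.2.le⟩, ho, ?_, ?_⟩
      · linarith [hz.1]
      · linarith [hz.2]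
    have htU : t ⊆ U := fun z hz => hpos z (by linarith [hz.2])
    have hVK : V ⊆ K := fun z hz => ⟨by linarith [hz.1], by linarith [hz.2]⟩
    obtain ⟨f, hf1, hf0, -⟩ := exists_contMDiffMap_one_nhds_of_subset_interior
      (n := (⊤ : ℕ∞)) (modelWithCornersSelf ℝ ℂ) hKc hKt
    set χ : ℂ → ℂ := fun w => ((f w : ℝ) : ℂ) with hχdef
    have hχ : ContDiff ℝ ∞ χ := Complex.ofRealCLM.contDiff.comp f.contMDiff.contDiff
    have hsupp : tsupport χ ⊆ t := closure_minimal (fun w hw => by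
      by_contra h
      exact hw (by simp [hχdef, hf0 w h])) htc
    have hχc : HasCompactSupport χ := htcpt.of_isClosed_subset (isClosed_tsupport _) hsupp
    have hχ1 : ∀ z ∈ K, ∀ᶠ w in 𝓝 z, χ w = 1 := fun z hz => by
      filter_upwards [(eventually_nhdsSet_iff_forall.1 hf1) z hz] with w hw
      simp [hχdef, hw]
    have hdK : ∀ w, dbar χ w ≠ 0 → w ∈ t ∧ w ∉ K := fun w hw =>
      ⟨hsupp (support_dbar_subset χ hw), fun h => hw (by
        rw [dbar_eq_of_eventuallyEq (g := fun _ => 1) (hχ1 w h), dbar_const])⟩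
    have hdistV : ∀ z ∈ V, ∀ c ∉ U, 4 * δ ≤ dist z c := fun z hz c hc =>
      hz.2.le.trans (Metric.infDist_le_dist_of_mem hc)
    have hcases : ∀ w ∈ t, w ∉ K → R + 1 < ‖w‖ ∨ ∃ c ∈ frontier U, ‖w - c‖ < δ := by
      intro w hw hwK
      by_cases h : ‖w‖ ≤ R + 1
      · right
        have h1 : Metric.infDist w Uᶜ < δ := by
          by_contra h2
          exact hwK ⟨h, not_lt.1 h2⟩
        obtain ⟨c, hc, hcd⟩ := hFc.exists_infDist_eq_dist hFne w
        refine ⟨c, ?_, by rw [← dist_eq_norm, ← hcd]; exact h1⟩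
        rw [hU.frontier_eq]
        refine ⟨?_, hc⟩
        have hwpos : 0 < dist w c := by
          rw [← hcd]; linarith [hw.2]
        -- The nearest point `c` of the complement is a frontier point, since the open ball reaching
        -- up to it lies in `U`.
        have hball : Metric.ball w (dist w c) ⊆ U := fun v hv => by
          by_contra hvU
          have := Metric.infDist_le_dist_of_mem (x := w) (show v ∈ Uᶜ from hvU)
          rw [hcd, dist_comm w v] at this
          exact absurd (Metric.mem_ball.1 hv) (not_lt.2 this)
        refine closure_mono hball ?_
        rw [closure_ball w hwpos.ne']
        exact Metric.mem_closedBall.2 (dist_comm c w).le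
      · exact Or.inl (not_le.1 h)
    have hexact : Complex.IsExactOn (fun z => ∫ w, (w - z)⁻¹ * (dbar χ w * g w)) V := by
      -- Poles beyond radius `R + 1` are at distance at least `1` from `V`; those within `δ` of the
      -- frontier are at distance at least `4 * δ - δ`.
      refine isExactOn_integral hVo (δ := min 1 (3 * δ) / 2) ?_ ?_ (by positivity) ?_ ?_
      · rw [continuous_iff_continuousAt]
        intro w
        by_cases hw : w ∈ tsupport (dbar χ)
        · have hwU : w ∈ U := htU (hsupp (closure_minimal (support_dbar_subset χ)
            (isClosed_tsupport χ) hw))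
          exact (continuous_dbar hχ).continuousAt.mul
            (hg.continuousOn.continuousAt (hU.mem_nhds hwU))
        · have : (fun w => dbar χ w * g w) =ᶠ[𝓝 w] fun _ => 0 := by
            filter_upwards [notMem_tsupport_iff_eventuallyEq.1 hw] with v hv
            simp [hv]
          exact continuousAt_const.congr this.symm
      · exact (hasCompactSupport_dbar hχc).mul_right
      · intro w hw z hz
        obtain ⟨hwt, hwK⟩ := hdK w (left_ne_zero_of_mul hw)
        rw [mul_div_cancel₀ _ (two_ne_zero)]
        rcases hcases w hwt hwK with h | ⟨c, hc, hcw⟩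
        · have := norm_sub_norm_le w z
          linarith [hz.1, min_le_left 1 (3 * δ)]
        · have h1 := hdistV z hz c (by rw [hU.frontier_eq] at hc; exact hc.2)
          rw [dist_comm, dist_eq_norm] at h1
          have h2 : ‖c - z‖ ≤ ‖w - c‖ + ‖w - z‖ := by
            rw [norm_sub_rev w c]
            calc ‖c - z‖ = ‖(c - w) + (w - z)‖ := by congr 1; ring
              _ ≤ _ := norm_add_le _ _
          linarith [min_le_right 1 (3 * δ)]
      · intro w hw
        obtain ⟨hwt, hwK⟩ := hdK w (left_ne_zero_of_mul hw)
        rcases hcases w hwt hwK with h | ⟨c, hc, hcw⟩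
        · exact isExactOn_inv_sub_of_norm_lt fun z hz => by linarith [hz.1]
        · refine isExactOn_inv_sub_of_near (c' := c) (fun z hz => ?_)
            (hgood V R (4 * δ) (by positivity) (fun z hz => hz.1) hdistV c hc)
          have h1 := hdistV z hz c (by rw [hU.frontier_eq] at hc; exact hc.2)
          rw [dist_comm, dist_eq_norm] at h1
          linarith
    obtain ⟨P, hP⟩ := hexact
    refine ⟨fun z => P z * (∫ u, u⁻¹ * dbar radialCutoff u)⁻¹, fun z hz => ?_⟩
    have := (hP z hz).mul_const (∫ u, u⁻¹ * dbar radialCutoff u)⁻¹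
    beta_reduce at this
    rwa [integral_dbar_cutoff hU hg hχ hχc (hsupp.trans htU) (htU (interior_subset (hKt (hVK hz))))
      (hχ1 z (hVK hz)), mul_inv_cancel_right₀ integral_dbar_radialCutoff_div_ne_zero] at this
  refine isExactOn_of_monotone_exhaustion hU hUc
    (V := fun n : ℕ => {z | ‖z‖ < n ∧ 4 * ((1 : ℝ) / (n + 1)) < Metric.infDist z Uᶜ})
    (fun n => (isOpen_lt continuous_norm continuous_const).inter
      (isOpen_lt continuous_const hcont)) ?_ ?_ fun n => key _ _ (by positivity)
  · intro m n hmn z hz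
    refine ⟨hz.1.trans_le (by exact_mod_cast hmn), lt_of_le_of_lt ?_ hz.2⟩
    have : (1 : ℝ) / (n + 1) ≤ 1 / (m + 1) := Nat.one_div_le_one_div hmn
    linarith
  · refine Subset.antisymm (iUnion_subset fun n z hz => hpos z (lt_trans (by positivity) hz.2))
      fun z hz => ?_
    have hd : 0 < Metric.infDist z Uᶜ :=
      (hFc.notMem_iff_infDist_pos hFne).1 (fun h => h hz)
    obtain ⟨m, hm⟩ := exists_nat_gt ‖z‖
    obtain ⟨n, hn⟩ := exists_nat_one_div_lt (show 0 < Metric.infDist z Uᶜ / 4 by positivity)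
    refine mem_iUnion.2 ⟨max m n, hm.trans_le (by exact_mod_cast le_max_left m n), ?_⟩
    have : (1 : ℝ) / ((max m n : ℕ) + 1) ≤ 1 / (n + 1) := Nat.one_div_le_one_div (le_max_right m n)
    linarith

/-- A primitive `G` of `h' / h` is a logarithm of `h` up to a constant; the root is a multiple of
`exp (G / 2)`. -/
theorem hasHolomorphicSqrt_of_isExactOn {U : Set ℂ} (hU : IsOpen U) (hUc : IsPreconnected U)
    (hex : ∀ g : ℂ → ℂ, DifferentiableOn ℂ g U → Complex.IsExactOn g U) :
    HasHolomorphicSqrt U := by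
  intro h hh hne
  rcases U.eq_empty_or_nonempty with rfl | ⟨x, hx⟩
  · exact ⟨h, hh, fun z hz => absurd hz (notMem_empty z)⟩
  obtain ⟨G, hG⟩ := hex (fun z => deriv h z / h z) ((hh.deriv hU).div hh hne)
  have hd : ∀ w ∈ U, HasDerivAt (fun z => h z * Complex.exp (-G z)) 0 w := fun w hw => by
    have h1 := (hh.differentiableAt (hU.mem_nhds hw)).hasDerivAt.mul (hG w hw).neg.cexp
    convert! h1 using 1
    have := hne w hw
    field_simp
    simp
  have hconst : ∀ w ∈ U, h w * Complex.exp (-G w) = h x * Complex.exp (-G x) := fun w hw =>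
    hU.is_const_of_deriv_eq_zero hUc
      (fun w hw => (hd w hw).differentiableAt.differentiableWithinAt)
      (fun w hw => (hd w hw).deriv) hw hx
  obtain ⟨r, hr⟩ := IsAlgClosed.exists_pow_nat_eq (h x * Complex.exp (-G x)) two_pos
  refine ⟨fun z => r * Complex.exp (G z / 2), fun z hz => ?_, fun z hz => ?_⟩
  · exact ((((hG z hz).div_const 2).cexp).const_mul r).differentiableAt.differentiableWithinAt
  · rw [mul_pow, hr, ← hconst z hz, ← Complex.exp_nat_mul, mul_assoc, ← Complex.exp_add]
    have : -G z + ((2 : ℕ) : ℂ) * (G z / 2) = 0 := by push_cast; ring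
    rw [this, Complex.exp_zero, mul_one]

/-! ### The unbounded component of the complement of a compact set -/

theorem isPreconnected_norm_gt {R : ℝ} (hR : 0 ≤ R) : IsPreconnected {z : ℂ | R < ‖z‖} := by
  have h : {z : ℂ | R < ‖z‖} =
      (fun p : ℝ × ℝ => (p.1 : ℂ) * Complex.exp (p.2 * Complex.I)) '' (Ioi R ×ˢ univ) := by
    ext z
    constructor
    · intro hz
      exact ⟨(‖z‖, z.arg), ⟨hz, mem_univ _⟩, Complex.norm_mul_exp_arg_mul_I z⟩
    · rintro ⟨p, ⟨hp, -⟩, rfl⟩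
      rw [mem_ofPred_eq, norm_mul, Complex.norm_exp_ofReal_mul_I, mul_one, Complex.norm_real,
        Real.norm_of_nonneg (hR.trans (le_of_lt hp))]
      exact hp
  rw [h]
  exact (isPreconnected_Ioi.prod isPreconnected_univ).image _ (by fun_prop)

theorem exists_norm_gt (R : ℝ) : ∃ z : ℂ, R < ‖z‖ :=
  ⟨((|R| + 1 : ℝ) : ℂ), by
    rw [Complex.norm_real, Real.norm_of_nonneg (by positivity)]
    linarith [le_abs_self R]⟩

theorem not_isBounded_norm_gt (R : ℝ) : ¬ Bornology.IsBounded {z : ℂ | R < ‖z‖} := by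
  intro h
  obtain ⟨M, hM⟩ := isBounded_iff_forall_norm_le.1 h
  obtain ⟨z, hz⟩ := exists_norm_gt (max R M)
  exact absurd (hM z ((le_max_left _ _).trans_lt hz)) (not_le.2 ((le_max_right _ _).trans_lt hz))

section UnboundedComponent

variable {C : Set ℂ} {R : ℝ}

theorem norm_gt_subset_compl (hR : ∀ z ∈ C, ‖z‖ ≤ R) : {z : ℂ | R < ‖z‖} ⊆ Cᶜ :=
  fun z hz h => absurd (hR z h) (not_le.2 hz)

theorem norm_gt_subset_unboundedComponent (hR0 : 0 ≤ R) (hR : ∀ z ∈ C, ‖z‖ ≤ R) :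
    {z : ℂ | R < ‖z‖} ⊆ unboundedComponent Cᶜ := by
  intro z hz
  refine ⟨norm_gt_subset_compl hR hz, fun hb => not_isBounded_norm_gt R (hb.subset ?_)⟩
  exact (isPreconnected_norm_gt hR0).subset_connectedComponentIn hz (norm_gt_subset_compl hR)

theorem subset_unboundedComponent (hR0 : 0 ≤ R) (hR : ∀ z ∈ C, ‖z‖ ≤ R) {S : Set ℂ}
    (hS : IsPreconnected S) (hSC : S ⊆ Cᶜ) {x : ℂ} (hx : x ∈ S) (hxR : R < ‖x‖) :
    S ⊆ unboundedComponent Cᶜ := by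
  intro z hz
  refine ⟨hSC hz, fun hb => not_isBounded_norm_gt R (hb.subset ?_)⟩
  have h1 : S ∪ {z : ℂ | R < ‖z‖} ⊆ connectedComponentIn Cᶜ z :=
    (hS.union x hx hxR (isPreconnected_norm_gt hR0)).subset_connectedComponentIn (Or.inl hz)
      (union_subset hSC (norm_gt_subset_compl hR))
  exact subset_union_right.trans h1

theorem unboundedComponent_eq (hR0 : 0 ≤ R) (hR : ∀ z ∈ C, ‖z‖ ≤ R) {x : ℂ} (hx : R < ‖x‖) :
    unboundedComponent Cᶜ = connectedComponentIn Cᶜ x := by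
  have hxC : x ∈ Cᶜ := norm_gt_subset_compl hR hx
  refine Subset.antisymm (fun z hz => ?_) (subset_unboundedComponent hR0 hR
    isPreconnected_connectedComponentIn (connectedComponentIn_subset _ _)
    (mem_connectedComponentIn hxC) hx)
  have : ∃ y ∈ connectedComponentIn Cᶜ z, R < ‖y‖ := by
    by_contra! h
    exact hz.2 (isBounded_iff_forall_norm_le.2 ⟨R, h⟩)
  obtain ⟨y, hy, hyR⟩ := this
  have h1 : y ∈ connectedComponentIn Cᶜ x :=
    (isPreconnected_norm_gt hR0).subset_connectedComponentIn hx (norm_gt_subset_compl hR) hyR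
  rw [connectedComponentIn_eq h1, ← connectedComponentIn_eq hy]
  exact mem_connectedComponentIn hz.1

theorem isOpen_unboundedComponent (hC : IsCompact C) : IsOpen (unboundedComponent Cᶜ) := by
  obtain ⟨R, hR0, hR⟩ := hC.isBounded.exists_pos_norm_le
  obtain ⟨x, hx⟩ := exists_norm_gt R
  rw [unboundedComponent_eq hR0.le hR hx]
  exact hC.isClosed.isOpen_compl.connectedComponentIn

theorem isPreconnected_unboundedComponent (hC : IsCompact C) :
    IsPreconnected (unboundedComponent Cᶜ) := by
  obtain ⟨R, hR0, hR⟩ := hC.isBounded.exists_pos_norm_le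
  obtain ⟨x, hx⟩ := exists_norm_gt R
  rw [unboundedComponent_eq hR0.le hR hx]
  exact isPreconnected_connectedComponentIn

theorem mem_of_mem_closure_unboundedComponent (hC : IsCompact C) {z : ℂ}
    (hz : z ∈ closure (unboundedComponent Cᶜ)) (hzU : z ∉ unboundedComponent Cᶜ) : z ∈ C := by
  by_contra h
  obtain ⟨R, hR0, hR⟩ := hC.isBounded.exists_pos_norm_le
  obtain ⟨x, hx⟩ := exists_norm_gt R
  rw [unboundedComponent_eq hR0.le hR hx] at hz hzU
  have hzo : connectedComponentIn Cᶜ z ∈ 𝓝 z :=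
    hC.isClosed.isOpen_compl.connectedComponentIn.mem_nhds (mem_connectedComponentIn h)
  obtain ⟨y, hy1, hy2⟩ := mem_closure_iff_nhds.1 hz _ hzo
  apply hzU
  rw [connectedComponentIn_eq hy2, ← connectedComponentIn_eq hy1]
  exact mem_connectedComponentIn h

end UnboundedComponent

/-! ### Inversion and existence of the exterior map -/

theorem differentiableOn_invFunOn {f : ℂ → ℂ} {U V : Set ℂ} (hU : IsOpen U)
    (hf : DifferentiableOn ℂ f U) (hb : BijOn f U V) (hd : ∀ z ∈ U, deriv f z ≠ 0) :
    DifferentiableOn ℂ (Function.invFunOn f U) V := by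
  intro w hw
  obtain ⟨z, hz, rfl⟩ := hb.surjOn hw
  have hs : HasStrictDerivAt f (deriv f z) z := (hf.analyticAt (hU.mem_nhds hz)).hasStrictDerivAt
  have hleft : LeftInvOn (Function.invFunOn f U) f U := hb.injOn.leftInvOn_invFunOn
  have hright : ∀ᶠ y in 𝓝 (f z), f (Function.invFunOn f U y) = y := by
    have : f '' U ∈ 𝓝 (f z) := by
      rw [← hs.map_nhds_eq (hd z hz)]
      exact image_mem_map (hU.mem_nhds hz)
    filter_upwards [this] with y hy using Function.invFunOn_eq hy
  have hcont : ContinuousAt (Function.invFunOn f U) (f z) := by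
    rw [ContinuousAt, hleft hz, ← hs.map_nhds_eq (hd z hz), tendsto_map'_iff]
    refine tendsto_id.congr' ?_
    filter_upwards [hU.mem_nhds hz] with y hy
    exact (hleft hy).symm
  have hs' : HasDerivAt f (deriv f z) (Function.invFunOn f U (f z)) := by
    rw [hleft hz]; exact hs.hasDerivAt
  exact (hs'.of_local_left_inverse hcont (hd z hz) hright).differentiableAt.differentiableWithinAt

/-- The image of the unbounded component under the inversion centred at `c₀`, with the image of
infinity added. -/
def invertedComponent (C : Set ℂ) (c₀ : ℂ) : Set ℂ :=
  {ζ | ζ = 0 ∨ c₀ + ζ⁻¹ ∈ unboundedComponent Cᶜ}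

section Inversion

variable {C : Set ℂ} {c₀ : ℂ}

theorem eventually_mem_unboundedComponent (hC : IsCompact C) :
    ∀ᶠ z in Bornology.cobounded ℂ, z ∈ unboundedComponent Cᶜ := by
  obtain ⟨R, hR0, hR⟩ := hC.isBounded.exists_pos_norm_le
  filter_upwards [tendsto_norm_cobounded_atTop.eventually (eventually_gt_atTop R)] with z hz
  exact norm_gt_subset_unboundedComponent hR0.le hR hz

theorem tendsto_add_inv_cobounded (c₀ : ℂ) :
    Tendsto (fun ζ : ℂ => c₀ + ζ⁻¹) (𝓝[≠] 0) (Bornology.cobounded ℂ) := by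
  have := (tendsto_add_const_cobounded c₀).comp (tendsto_inv₀_nhdsNE_zero (α := ℂ))
  refine this.congr fun ζ => ?_
  simp [add_comm]

theorem isOpen_invertedComponent (hC : IsCompact C) : IsOpen (invertedComponent C c₀) := by
  rw [isOpen_iff_mem_nhds]
  intro ζ hζ
  rcases eq_or_ne ζ 0 with rfl | hne
  · have h := (tendsto_add_inv_cobounded c₀).eventually (eventually_mem_unboundedComponent hC)
    rw [eventually_nhdsWithin_iff] at h
    filter_upwards [h] with x hx
    by_cases h0 : x = 0
    · exact Or.inl h0
    · exact Or.inr (hx h0)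
  · have h1 := hζ.resolve_left hne
    have hc : ContinuousAt (fun ζ : ℂ => c₀ + ζ⁻¹) ζ := continuousAt_const.add (continuousAt_inv₀ hne)
    filter_upwards [hc.preimage_mem_nhds ((isOpen_unboundedComponent hC).mem_nhds h1)] with x hx
    exact Or.inr hx

theorem sub_ne_zero_of_mem_unboundedComponent (hc₀ : c₀ ∈ C) {z : ℂ}
    (hz : z ∈ unboundedComponent Cᶜ) : z - c₀ ≠ 0 := fun h => hz.1 (by rwa [sub_eq_zero.1 h])

theorem inv_sub_mem_invertedComponent {z : ℂ}
    (hz : z ∈ unboundedComponent Cᶜ) : (z - c₀)⁻¹ ∈ invertedComponent C c₀ :=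
  Or.inr (by simpa using hz)

theorem isConnected_invertedComponent (hC : IsCompact C) (hc₀ : c₀ ∈ C) :
    IsConnected (invertedComponent C c₀) := by
  set S := (fun z : ℂ => (z - c₀)⁻¹) '' unboundedComponent Cᶜ with hS
  have hSc : IsPreconnected S := (isPreconnected_unboundedComponent hC).image _
    ((continuousOn_id.sub continuousOn_const).inv₀ fun z hz =>
      sub_ne_zero_of_mem_unboundedComponent hc₀ hz)
  refine ⟨⟨0, Or.inl rfl⟩, hSc.subset_closure ?_ ?_⟩
  · rintro _ ⟨z, hz, rfl⟩
    exact inv_sub_mem_invertedComponent hz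
  · intro ζ hζ
    have hmem : ∀ ξ : ℂ, ξ ≠ 0 → ξ ∈ invertedComponent C c₀ → ξ ∈ S := fun ξ h0 hξ =>
      ⟨c₀ + ξ⁻¹, hξ.resolve_left h0, by simp⟩
    rcases eq_or_ne ζ 0 with rfl | hne
    · have h : ∀ᶠ x in 𝓝[≠] (0 : ℂ), x ∈ S := by
        filter_upwards [self_mem_nhdsWithin, mem_nhdsWithin_of_mem_nhds
          ((isOpen_invertedComponent hC (c₀ := c₀)).mem_nhds (Or.inl rfl))] with x h0 hx
        exact hmem x h0 hx
      exact mem_closure_iff_frequently.2 (h.frequently.filter_mono nhdsWithin_le_nhds)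
    · exact subset_closure (hmem ζ hne hζ)

theorem inv_sub_notMem_invertedComponent {x : ℂ} (hx : x ∈ C) (hne : x ≠ c₀) :
    (x - c₀)⁻¹ ∉ invertedComponent C c₀ := by
  rintro (h | h)
  · exact hne (sub_eq_zero.1 (inv_eq_zero.1 h))
  · rw [inv_inv, add_sub_cancel] at h
    exact h.1 hx

/-- Connectedness of `C` enters here. Points `x` of `C` parametrize the poles `(x - c₀)⁻¹`, with
`c₀` standing for the pole at infinity. Having a primitive on `V` is a locally constant property of
`x`, and it holds near `c₀` because far poles have a logarithm on the bounded set `V`. -/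
theorem isExactOn_inv_sub_of_mem_frontier_invertedComponent (hC : IsCompact C)
    (hCc : IsPreconnected C) (hc₀ : c₀ ∈ C) {V : Set ℂ} {R δ : ℝ} (hδ : 0 < δ)
    (hR : ∀ z ∈ V, ‖z‖ < R) (hV : ∀ z ∈ V, ∀ c ∉ invertedComponent C c₀, δ ≤ dist z c) {c : ℂ}
    (hc : c ∈ frontier (invertedComponent C c₀)) :
    Complex.IsExactOn (fun z => (c - z)⁻¹) V := by
  classical
  rw [(isOpen_invertedComponent hC).frontier_eq] at hc
  have hc0 : c ≠ 0 := fun h => hc.2 (Or.inl h)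
  have hxC : c₀ + c⁻¹ ∈ C := by
    refine mem_of_mem_closure_unboundedComponent hC ?_ fun h => hc.2 (Or.inr h)
    have hcont : ContinuousAt (fun ζ : ℂ => c₀ + ζ⁻¹) c :=
      continuousAt_const.add (continuousAt_inv₀ hc0)
    rw [mem_closure_iff_frequently]
    refine hcont.tendsto.frequently ?_
    have h1 := mem_closure_iff_frequently.1 hc.1
    have h2 : ∀ᶠ ζ in 𝓝 c, ζ ≠ 0 := isOpen_ne.mem_nhds hc0
    exact (h1.and_eventually h2).mono fun ζ hζ => hζ.1.resolve_left hζ.2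
  set good : ℂ → Bool := fun x =>
    decide (x = c₀ ∨ Complex.IsExactOn (fun z => ((x - c₀)⁻¹ - z)⁻¹) V) with hgood
  have hcont : ContinuousOn good C := by
    intro x hx
    suffices h : ∀ᶠ y in 𝓝[C] x, good y = good x from
      continuousWithinAt_const.congr_of_eventuallyEq h rfl
    rcases eq_or_ne x c₀ with rfl | hne
    · filter_upwards [mem_nhdsWithin_of_mem_nhds
        -- Within this radius of `c₀` the pole has modulus larger than `|R| + 1`, hence than every
        -- point of `V`.
        (Metric.ball_mem_nhds x (show 0 < (|R| + 1)⁻¹ by positivity))] with y hy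
      simp only [hgood, true_or, decide_true, decide_eq_true_eq]
      by_cases hyx : y = x
      · exact Or.inl hyx
      · refine Or.inr (isExactOn_inv_sub_of_norm_lt fun z hz => ?_)
        rw [norm_inv, ← dist_eq_norm]
        have h1 : |R| + 1 < (dist y x)⁻¹ :=
          (lt_inv_comm₀ (dist_pos.2 hyx) (by positivity)).1 (Metric.mem_ball.1 hy)
        linarith [hR z hz, le_abs_self R]
    · have hci : ContinuousAt (fun y : ℂ => (y - c₀)⁻¹) x :=
        (continuousAt_id.sub continuousAt_const).inv₀ (sub_ne_zero.2 hne)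
      filter_upwards [self_mem_nhdsWithin, mem_nhdsWithin_of_mem_nhds (isOpen_ne.mem_nhds hne),
        mem_nhdsWithin_of_mem_nhds (hci.preimage_mem_nhds (Metric.ball_mem_nhds _ hδ))]
        with y hyC hyne hy
      have hyd : dist (y - c₀)⁻¹ (x - c₀)⁻¹ < δ := hy
      have hxn := inv_sub_notMem_invertedComponent hx hne
      have hyn := inv_sub_notMem_invertedComponent hyC hyne
      simp only [hgood, hne, false_or, decide_eq_decide, show ¬ y = c₀ from hyne]
      constructor
      · refine isExactOn_inv_sub_of_near fun z hz => ?_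
        have h1 := hV z hz _ hyn
        rw [dist_comm, dist_eq_norm] at h1 hyd
        linarith
      · refine isExactOn_inv_sub_of_near fun z hz => ?_
        have h1 := hV z hz _ hxn
        rw [dist_comm, dist_eq_norm] at h1
        rw [dist_eq_norm] at hyd
        linarith
  have hconst := hCc.constant hcont hxC hc₀
  have hfin : good (c₀ + c⁻¹) = true := by
    rw [hconst]; simp [hgood]
  have h2 := (of_decide_eq_true hfin).resolve_left (by simpa using hc0)
  simpa using h2

/-- Existence of the normalized exterior conformal map. -/
theorem exists_isNormalizedExteriorMap (hC : IsCompact C) (hCc : IsConnected C)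
    (hnt : C.Nontrivial) : ∃ T, IsNormalizedExteriorMap T (unboundedComponent Cᶜ) := by
  obtain ⟨c₀, hc₀, a, ha, hne⟩ := hnt
  set U := invertedComponent C c₀ with hUdef
  have hUo : IsOpen U := isOpen_invertedComponent hC
  have hUc : IsConnected U := isConnected_invertedComponent hC hc₀
  have h0U : (0 : ℂ) ∈ U := Or.inl rfl
  have hUne : U ≠ univ := fun h =>
    inv_sub_notMem_invertedComponent ha hne.symm (by rw [← hUdef, h]; exact mem_univ _)
  have hsq : HasHolomorphicSqrt U := hasHolomorphicSqrt_of_isExactOn hUo hUc.isPreconnected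
    fun g hg => isExactOn_of_forall_frontier hUo hUc hUne
      (fun V R δ hδ hR hV c hc => isExactOn_inv_sub_of_mem_frontier_invertedComponent hC
        hCc.isPreconnected hc₀ hδ hR hV hc) hg
  obtain ⟨f, hf, hfs⟩ := exists_isDiskEmbedding_surjOn hUo hUc.isPreconnected h0U hUne hsq
  set d := deriv f 0 with hd
  have hd0 : d ≠ 0 := hf.deriv_ne_zero 0 h0U
  have hdn : (0 : ℝ) < ‖d‖ := norm_pos_iff.2 hd0
  have hdnc : ((‖d‖ : ℝ) : ℂ) ≠ 0 := by exact_mod_cast hdn.ne'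
  -- This rotation makes the derivative at infinity `e / d = 1 / ‖d‖`, which is positive.
  set e : ℂ := d / ‖d‖ with he
  have he0 : e ≠ 0 := div_ne_zero hd0 hdnc
  have hen : ‖e‖ = 1 := by simp [he, hd0]
  set P := unboundedComponent Cᶜ with hP
  have hPo : IsOpen P := isOpen_unboundedComponent hC
  have hs0 : ∀ z ∈ P, z - c₀ ≠ 0 := fun z hz => sub_ne_zero_of_mem_unboundedComponent hc₀ hz
  have hmemU : ∀ z ∈ P, (z - c₀)⁻¹ ∈ U := fun z hz => inv_sub_mem_invertedComponent hz
  have hf0 : ∀ ζ ∈ U, ζ ≠ 0 → f ζ ≠ 0 := fun ζ hζ h0 h =>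
    h0 (hf.injOn hζ h0U (by rw [h, hf.map_zero]))
  have hfP : ∀ z ∈ P, f ((z - c₀)⁻¹) ≠ 0 := fun z hz => hf0 _ (hmemU z hz) (inv_ne_zero (hs0 z hz))
  have hder : ∀ z ∈ P, HasDerivAt (fun z => e * (f ((z - c₀)⁻¹))⁻¹)
      (e * (-(deriv f ((z - c₀)⁻¹) * (-1 / (z - c₀) ^ 2)) / f ((z - c₀)⁻¹) ^ 2)) z := fun z hz => by
    have h1 : HasDerivAt (fun z : ℂ => (z - c₀)⁻¹) (-1 / (z - c₀) ^ 2) z :=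
      ((hasDerivAt_id z).sub_const c₀).fun_inv (hs0 z hz)
    have h2 := (hf.differentiableOn.differentiableAt (hUo.mem_nhds (hmemU z hz))).hasDerivAt
    exact ((h2.comp z h1).fun_inv (hfP z hz)).const_mul e
  have hbij : BijOn (fun z => e * (f ((z - c₀)⁻¹))⁻¹) P unitDiskExterior := by
    refine ⟨fun z hz => ?_, fun z hz w hw h => ?_, fun w hw => ?_⟩
    · have := mem_ball_zero_iff.1 (hf.mapsTo (hmemU z hz))
      simp only [unitDiskExterior, mem_ofPred_eq, norm_mul, hen, one_mul, norm_inv]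
      exact (one_lt_inv₀ (norm_pos_iff.2 (hfP z hz))).2 this
    · have h1 := inv_injective (mul_left_cancel₀ he0 h)
      have h2 := inv_injective (hf.injOn (hmemU z hz) (hmemU w hw) h1)
      exact sub_left_injective h2
    · have hw1 : 1 < ‖w‖ := hw
      have hw0 : w ≠ 0 := norm_pos_iff.1 (by linarith)
      have : e / w ∈ f '' U := by
        rw [hfs, mem_ball_zero_iff, norm_div, hen]
        exact (div_lt_one (by linarith)).2 hw1
      obtain ⟨ζ, hζ, hζw⟩ := this
      have hζ0 : ζ ≠ 0 := fun h => by
        rw [h, hf.map_zero] at hζw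
        exact div_ne_zero he0 hw0 hζw.symm
      refine ⟨c₀ + ζ⁻¹, hζ.resolve_left hζ0, ?_⟩
      simp only [add_sub_cancel_left, inv_inv, hζw]
      field_simp
  have hdiff : DifferentiableOn ℂ (fun z => e * (f ((z - c₀)⁻¹))⁻¹) P := fun z hz =>
    (hder z hz).differentiableAt.differentiableWithinAt
  refine ⟨fun z => e * (f ((z - c₀)⁻¹))⁻¹, ⟨hbij, hdiff,
    differentiableOn_invFunOn hPo hdiff hbij fun z hz => ?_⟩, ‖d‖⁻¹, by positivity, ?_⟩
  · rw [(hder z hz).deriv]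
    exact mul_ne_zero he0 (div_ne_zero (neg_ne_zero.2 (mul_ne_zero
      (hf.deriv_ne_zero _ (hmemU z hz)) (div_ne_zero (by simp) (pow_ne_zero _ (hs0 z hz)))))
      (pow_ne_zero _ (hfP z hz)))
  · have hslope : Tendsto (fun ζ => ζ / f ζ) (𝓝[≠] 0) (𝓝 d⁻¹) := by
      have h1 := hasDerivAt_iff_tendsto_slope.1
        (hf.differentiableOn.differentiableAt (hUo.mem_nhds h0U)).hasDerivAt
      refine (h1.inv₀ hd0).congr fun ζ => ?_
      simp [slope_def_field, hf.map_zero]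
    have hsub : Tendsto (fun z : ℂ => z - c₀) (Bornology.cobounded ℂ) (Bornology.cobounded ℂ) := by
      exact tendsto_sub_const_cobounded c₀
    have hinv : Tendsto (fun z : ℂ => (z - c₀)⁻¹) (Bornology.cobounded ℂ) (𝓝[≠] 0) :=
      tendsto_inv₀_cobounded'.comp hsub
    have hratio : Tendsto (fun z : ℂ => 1 - c₀ * z⁻¹) (Bornology.cobounded ℂ) (𝓝 1) := by
      simpa using ((tendsto_inv₀_cobounded (α := ℂ)).const_mul c₀).const_sub 1
    have hlim := ((hslope.comp hinv).const_mul e).mul hratio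
    have hval : e * d⁻¹ * 1 = ((‖d‖⁻¹ : ℝ) : ℂ) := by
      rw [he]; push_cast; field_simp
    rw [hval] at hlim
    refine hlim.congr' ?_
    filter_upwards [eventually_mem_unboundedComponent hC,
      (Bornology.le_cofinite ℂ) (finite_singleton (0 : ℂ)).compl_mem_cofinite] with z hz hz0
    have hz0' : z ≠ 0 := hz0
    have h1 := hs0 z hz
    have h2 := hfP z hz
    simp only [Function.comp]
    field_simp

end Inversion

/-! ### The Schwarz lemma at infinity -/

/-- The function `ζ ↦ 1 / g (r / ζ)`, extended by `0` to the origin. -/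
noncomputable def invAtInfinity (r : ℝ) (g : ℂ → ℂ) (ζ : ℂ) : ℂ :=
  if ζ = 0 then 0 else (g (r / ζ))⁻¹

section ExteriorSchwarz

variable {r : ℝ} {g : ℂ → ℂ} {a : ℂ}

theorem tendsto_const_div_nhdsNE_zero (hr : 0 < r) :
    Tendsto (fun ζ : ℂ => (r : ℂ) / ζ) (𝓝[≠] 0) (Bornology.cobounded ℂ) := by
  have hr' : (r : ℂ) ≠ 0 := by exact_mod_cast hr.ne'
  have := (tendsto_mul_left_cobounded (α := ℂ) hr').comp (tendsto_inv₀_nhdsNE_zero (α := ℂ))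
  exact this.congr fun ζ => (div_eq_mul_inv _ _).symm

theorem hasDerivAt_invAtInfinity_zero (hr : 0 < r) (ha : a ≠ 0)
    (hlim : Tendsto (fun w => g w / w) (Bornology.cobounded ℂ) (𝓝 a)) :
    HasDerivAt (invAtInfinity r g) (a * r)⁻¹ 0 := by
  have hr' : (r : ℂ) ≠ 0 := by exact_mod_cast hr.ne'
  rw [hasDerivAt_iff_tendsto_slope]
  have h1 := ((hlim.comp (tendsto_const_div_nhdsNE_zero hr)).mul_const (r : ℂ)).inv₀
    (mul_ne_zero ha hr')
  refine h1.congr' ?_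
  filter_upwards [self_mem_nhdsWithin] with ζ hζ
  have hζ0 : ζ ≠ 0 := hζ
  simp only [Function.comp, slope_def_field, invAtInfinity, if_neg hζ0, if_true, sub_zero]
  rcases eq_or_ne (g (r / ζ)) 0 with h0 | h0
  · simp [h0]
  · field_simp

theorem lt_norm_const_div (hr : 0 < r) {ζ : ℂ} (h0 : ζ ≠ 0) (hζ : ‖ζ‖ < 1) :
    r < ‖(r : ℂ) / ζ‖ := by
  rw [norm_div, Complex.norm_real, Real.norm_of_nonneg hr.le, lt_div_iff₀ (norm_pos_iff.2 h0)]
  nlinarith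

theorem differentiableOn_invAtInfinity (hr : 0 < r) (ha : a ≠ 0)
    (hlim : Tendsto (fun w => g w / w) (Bornology.cobounded ℂ) (𝓝 a))
    (hg : DifferentiableOn ℂ g {w | r < ‖w‖}) (hg0 : ∀ w, r < ‖w‖ → g w ≠ 0) :
    DifferentiableOn ℂ (invAtInfinity r g) (Metric.ball 0 1) := by
  intro ζ hζ
  rw [mem_ball_zero_iff] at hζ
  rcases eq_or_ne ζ 0 with rfl | h0
  · exact (hasDerivAt_invAtInfinity_zero hr ha hlim).differentiableAt.differentiableWithinAt
  · have hw := lt_norm_const_div hr h0 hζ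
    have h1 : DifferentiableAt ℂ g (r / ζ) :=
      hg.differentiableAt ((isOpen_lt continuous_const continuous_norm).mem_nhds hw)
    have h2 : DifferentiableAt ℂ (fun ζ : ℂ => (r : ℂ) / ζ) ζ :=
      (differentiableAt_const _).div differentiableAt_id h0
    have h3 : DifferentiableAt ℂ (fun ζ : ℂ => (g (r / ζ))⁻¹) ζ :=
      (h1.comp ζ h2).fun_inv (hg0 _ hw)
    refine (h3.congr_of_eventuallyEq ?_).differentiableWithinAt
    filter_upwards [isOpen_ne.mem_nhds h0] with ξ hξ
    exact if_neg hξ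

theorem mapsTo_invAtInfinity (hr : 0 < r) (hm : ∀ w, r < ‖w‖ → 1 < ‖g w‖) :
    MapsTo (invAtInfinity r g) (Metric.ball 0 1) (Metric.ball 0 1) := by
  intro ζ hζ
  rw [mem_ball_zero_iff] at *
  by_cases h0 : ζ = 0
  · simp [invAtInfinity, h0]
  · rw [invAtInfinity, if_neg h0, norm_inv]
    exact inv_lt_one_of_one_lt₀ (hm _ (lt_norm_const_div hr h0 hζ))

/-- The Schwarz lemma at infinity. -/
theorem norm_le_mul_norm_of_exterior (hr : 0 < r) (ha : a ≠ 0)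
    (hlim : Tendsto (fun w => g w / w) (Bornology.cobounded ℂ) (𝓝 a))
    (hg : DifferentiableOn ℂ g {w | r < ‖w‖}) (hm : ∀ w, r < ‖w‖ → 1 < ‖g w‖) {w : ℂ}
    (hw : r < ‖w‖) : ‖w‖ ≤ r * ‖g w‖ := by
  have hg0 : ∀ w, r < ‖w‖ → g w ≠ 0 := fun w hw => norm_pos_iff.1 (by linarith [hm w hw])
  have hw0 : w ≠ 0 := norm_pos_iff.1 (hr.trans hw)
  have hr' : (r : ℂ) ≠ 0 := by exact_mod_cast hr.ne'
  have hζ : ‖(r : ℂ) / w‖ < 1 := by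
    rw [norm_div, Complex.norm_real, Real.norm_of_nonneg hr.le, div_lt_one (hr.trans hw)]
    exact hw
  have h := Complex.norm_le_norm_of_mapsTo_ball
    (differentiableOn_invAtInfinity hr ha hlim hg hg0)
    ((mapsTo_invAtInfinity hr hm).mono_right Metric.ball_subset_closedBall)
    (by simp [invAtInfinity]) hζ
  rw [invAtInfinity, if_neg (div_ne_zero hr' hw0), div_div_cancel₀ hr', norm_inv, norm_div,
    Complex.norm_real, Real.norm_of_nonneg hr.le] at h
  have h1 : 0 < ‖g w‖ := by linarith [hm w hw]
  have h2 : 0 < ‖w‖ := hr.trans hw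
  rw [inv_le_iff_one_le_mul₀ h1, div_mul_eq_mul_div, one_le_div h2] at h
  exact h

/-- The preceding inequality divided by `‖w‖`, in the limit `w → ∞`. -/
theorem one_le_mul_norm_of_exterior (hr : 0 < r) (ha : a ≠ 0)
    (hlim : Tendsto (fun w => g w / w) (Bornology.cobounded ℂ) (𝓝 a))
    (hg : DifferentiableOn ℂ g {w | r < ‖w‖}) (hm : ∀ w, r < ‖w‖ → 1 < ‖g w‖) :
    1 ≤ r * ‖a‖ := by
  have h := hlim.norm.const_mul r
  refine ge_of_tendsto h ?_
  filter_upwards [tendsto_norm_cobounded_atTop.eventually (eventually_gt_atTop r)] with w hw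
  have h1 := norm_le_mul_norm_of_exterior hr ha hlim hg hm hw
  rw [norm_div, ← mul_div_assoc, one_le_div (hr.trans hw)]
  exact h1

/-- The equality case of the Schwarz lemma: `invAtInfinity 1 g` fixes `0` with derivative `1`, hence
is the identity. -/
theorem eq_self_of_exterior
    (hlim : Tendsto (fun w => g w / w) (Bornology.cobounded ℂ) (𝓝 1))
    (hg : DifferentiableOn ℂ g {w | 1 < ‖w‖}) (hm : ∀ w, 1 < ‖w‖ → 1 < ‖g w‖) {w : ℂ}
    (hw : 1 < ‖w‖) : g w = w := by
  have hg0 : ∀ w, 1 < ‖w‖ → g w ≠ 0 := fun w hw => norm_pos_iff.1 (by linarith [hm w hw])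
  have hw0 : w ≠ 0 := norm_pos_iff.1 (by linarith)
  have hd := (hasDerivAt_invAtInfinity_zero one_pos one_ne_zero hlim).deriv
  simp only [Complex.ofReal_one, mul_one, inv_one] at hd
  have h00 : invAtInfinity 1 g 0 = 0 := by simp [invAtInfinity]
  have h := Complex.affine_of_mapsTo_ball_of_norm_dslope_eq_div (R₂ := 1)
    (differentiableOn_invAtInfinity one_pos one_ne_zero hlim hg hg0)
    (by
      rw [h00]
      exact (mapsTo_invAtInfinity one_pos hm).mono_right Metric.ball_subset_closedBall)
    (Metric.mem_ball_self one_pos) (by simp [hd])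
  have hζ : w⁻¹ ∈ Metric.ball (0 : ℂ) 1 := by
    rw [mem_ball_zero_iff, norm_inv]
    exact inv_lt_one_of_one_lt₀ hw
  have := h hζ
  simp only [dslope_same, hd, invAtInfinity, inv_eq_zero, hw0, if_false] at this
  simpa using this

end ExteriorSchwarz

/-! ### Normalized exterior maps and their inverses at infinity -/

section NormalizedMap

variable {T : ℂ → ℂ} {U : Set ℂ} {R l : ℝ}

theorem IsNormalizedExteriorMap.mapsTo_invFunOn (hT : IsNormalizedExteriorMap T U) {w : ℂ}
    (hw : 1 < ‖w‖) : Function.invFunOn T U w ∈ U ∧ T (Function.invFunOn T U w) = w := by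
  have h : w ∈ T '' U := hT.isBiholomorphism.bijOn.surjOn hw
  exact ⟨Function.invFunOn_mem h, Function.invFunOn_eq h⟩

theorem IsNormalizedExteriorMap.invFunOn_apply (hT : IsNormalizedExteriorMap T U) {z : ℂ}
    (hz : z ∈ U) : Function.invFunOn T U (T z) = z :=
  hT.isBiholomorphism.bijOn.injOn.leftInvOn_invFunOn hz

theorem IsNormalizedExteriorMap.one_lt_norm (hT : IsNormalizedExteriorMap T U) {z : ℂ}
    (hz : z ∈ U) : 1 < ‖T z‖ := hT.isBiholomorphism.bijOn.mapsTo hz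

/-- In the coordinate at infinity `T` has nonzero derivative at `0` and is open there, so values
near infinity are attained near infinity; injectivity leaves no other preimage. -/
theorem IsNormalizedExteriorMap.tendsto_invFunOn (hT : IsNormalizedExteriorMap T U)
    (hR : 0 < R) (hRU : {z : ℂ | R < ‖z‖} ⊆ U) :
    Tendsto (Function.invFunOn T U) (Bornology.cobounded ℂ) (Bornology.cobounded ℂ) := by
  obtain ⟨l, hl, hlim⟩ := hT.normalized
  have hl' : (l : ℂ) ≠ 0 := by exact_mod_cast hl.ne'
  have hR' : (R : ℂ) ≠ 0 := by exact_mod_cast hR.ne'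
  have hd := differentiableOn_invAtInfinity hR hl' hlim
    (hT.isBiholomorphism.differentiableOn.mono hRU)
    fun w hw => norm_pos_iff.1 (by linarith [hT.one_lt_norm (hRU hw)])
  have hs := (hd.analyticAt (Metric.ball_mem_nhds 0 one_pos)).hasStrictDerivAt
  rw [(hasDerivAt_invAtInfinity_zero hR hl' hlim).deriv] at hs
  have hmap := hs.map_nhds_eq (inv_ne_zero (mul_ne_zero hl' hR'))
  have h00 : invAtInfinity R T 0 = 0 := by simp [invAtInfinity]
  rw [h00] at hmap
  rw [← tendsto_norm_atTop_iff_cobounded, tendsto_atTop]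
  intro M
  set ρ := min 1 (R / (|M| + 1)) with hρ
  have hρ0 : 0 < ρ := by positivity
  have him : invAtInfinity R T '' Metric.ball 0 ρ ∈ 𝓝 (0 : ℂ) := by
    rw [← hmap]
    exact image_mem_map (Metric.ball_mem_nhds 0 hρ0)
  filter_upwards [tendsto_inv₀_cobounded' (mem_nhdsWithin_of_mem_nhds him),
    tendsto_inv₀_cobounded' (α := ℂ) self_mem_nhdsWithin] with w hw hw0
  obtain ⟨ζ, hζ, hζw⟩ := hw
  have hw0' : w⁻¹ ≠ 0 := hw0
  have hζ0 : ζ ≠ 0 := fun h => hw0' (by rw [← hζw, h, h00])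
  rw [mem_ball_zero_iff] at hζ
  rw [invAtInfinity, if_neg hζ0] at hζw
  have hUm := hRU (lt_norm_const_div hR hζ0 (hζ.trans_le (min_le_left _ _)))
  rw [← inv_injective hζw, hT.invFunOn_apply hUm, norm_div, Complex.norm_real,
    Real.norm_of_nonneg hR.le, le_div_iff₀ (norm_pos_iff.2 hζ0)]
  have h1 : ‖ζ‖ ≤ R / (|M| + 1) := hζ.le.trans (min_le_right _ _)
  rw [le_div_iff₀ (by positivity)] at h1
  nlinarith [norm_nonneg ζ, le_abs_self M]

theorem IsNormalizedExteriorMap.tendsto_invFunOn_div (hT : IsNormalizedExteriorMap T U)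
    (hR : 0 < R) (hRU : {z : ℂ | R < ‖z‖} ⊆ U) (hl : 0 < l)
    (hlim : Tendsto (fun z => T z / z) (Bornology.cobounded ℂ) (𝓝 (l : ℂ))) :
    Tendsto (fun w => Function.invFunOn T U w / w) (Bornology.cobounded ℂ) (𝓝 (l : ℂ)⁻¹) := by
  have hl' : (l : ℂ) ≠ 0 := by exact_mod_cast hl.ne'
  refine ((hlim.comp (hT.tendsto_invFunOn hR hRU)).inv₀ hl').congr' ?_
  filter_upwards [tendsto_norm_cobounded_atTop.eventually (eventually_gt_atTop 1)] with w hw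
  simp only [Function.comp, (hT.mapsTo_invFunOn hw).2, inv_div]

/-- The limit of `S (T⁻¹ w) / w` at infinity. -/
theorem IsNormalizedExteriorMap.tendsto_comp_div (hT : IsNormalizedExteriorMap T U)
    (hR : 0 < R) (hRU : {z : ℂ | R < ‖z‖} ⊆ U) (hl : 0 < l)
    (hlim : Tendsto (fun z => T z / z) (Bornology.cobounded ℂ) (𝓝 (l : ℂ))) {S : ℂ → ℂ} {m : ℂ}
    (hS : Tendsto (fun z => S z / z) (Bornology.cobounded ℂ) (𝓝 m)) :
    Tendsto (fun w => S (Function.invFunOn T U w) / w) (Bornology.cobounded ℂ)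
      (𝓝 (m * (l : ℂ)⁻¹)) := by
  have h1 := hT.tendsto_invFunOn hR hRU
  refine ((hS.comp h1).mul (hT.tendsto_invFunOn_div hR hRU hl hlim)).congr' ?_
  filter_upwards [h1.eventually (tendsto_norm_cobounded_atTop.eventually (eventually_gt_atTop 0))]
    with w hw
  have : Function.invFunOn T U w ≠ 0 := norm_pos_iff.1 hw
  simp only [Function.comp]
  field_simp

/-- Both `S ∘ T⁻¹` and `T ∘ S⁻¹` are self-maps of the exterior disk, so the Schwarz lemma gives `s /
t ≥ 1` and `t / s ≥ 1`; rigidity then applies. -/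
theorem IsNormalizedExteriorMap.eqOn (hR : 0 < R) (hRU : {z : ℂ | R < ‖z‖} ⊆ U) {S : ℂ → ℂ}
    (hS : IsNormalizedExteriorMap S U) (hT : IsNormalizedExteriorMap T U) : EqOn S T U := by
  have key : ∀ {S T : ℂ → ℂ}, IsNormalizedExteriorMap S U → IsNormalizedExteriorMap T U →
      DifferentiableOn ℂ (fun w => S (Function.invFunOn T U w)) {w | 1 < ‖w‖} ∧
      ∀ w, 1 < ‖w‖ → 1 < ‖S (Function.invFunOn T U w)‖ := fun {S T} hS hT =>
    ⟨hS.isBiholomorphism.differentiableOn.comp hT.isBiholomorphism.differentiableOn_inv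
      fun w hw => (hT.mapsTo_invFunOn hw).1,
    fun w hw => hS.one_lt_norm (hT.mapsTo_invFunOn hw).1⟩
  obtain ⟨s, hs, hslim⟩ := hS.normalized
  obtain ⟨t, ht, htlim⟩ := hT.normalized
  have hs' : (s : ℂ) ≠ 0 := by exact_mod_cast hs.ne'
  have ht' : (t : ℂ) ≠ 0 := by exact_mod_cast ht.ne'
  have h1 := one_le_mul_norm_of_exterior one_pos (mul_ne_zero hs' (inv_ne_zero ht'))
    (hT.tendsto_comp_div hR hRU ht htlim hslim) (key hS hT).1 (key hS hT).2
  have h2 := one_le_mul_norm_of_exterior one_pos (mul_ne_zero ht' (inv_ne_zero hs'))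
    (hS.tendsto_comp_div hR hRU hs hslim htlim) (key hT hS).1 (key hT hS).2
  rw [one_mul, norm_mul, norm_inv, Complex.norm_real, Complex.norm_real,
    Real.norm_of_nonneg hs.le, Real.norm_of_nonneg ht.le, ← div_eq_mul_inv] at h1 h2
  rw [one_le_div ht] at h1
  rw [one_le_div hs] at h2
  have hst : s = t := le_antisymm h2 h1
  intro z hz
  have hlim1 := hT.tendsto_comp_div hR hRU ht htlim hslim
  rw [hst, mul_inv_cancel₀ ht'] at hlim1
  have := eq_self_of_exterior hlim1 (key hS hT).1 (key hS hT).2 (hT.one_lt_norm hz)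
  rwa [hT.invFunOn_apply hz] at this

/-- The inverse of an exterior map in the coordinate at infinity: `ζ ↦ ζ * T⁻¹ (1 / ζ)`. -/
noncomputable def inverseAtInfinity (T : ℂ → ℂ) (U : Set ℂ) (l : ℝ) (ζ : ℂ) : ℂ :=
  if ζ = 0 then (l : ℂ)⁻¹ else ζ * Function.invFunOn T U ζ⁻¹

theorem one_lt_norm_inv {ζ : ℂ} (h0 : ζ ≠ 0) (hζ : ‖ζ‖ < 1) : 1 < ‖ζ⁻¹‖ := by
  rw [norm_inv]
  exact (one_lt_inv₀ (norm_pos_iff.2 h0)).2 hζ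

theorem invFunOn_eq_mul_inverseAtInfinity {w : ℂ} (hw : w ≠ 0) :
    Function.invFunOn T U w = w * inverseAtInfinity T U l w⁻¹ := by
  rw [inverseAtInfinity, if_neg (inv_ne_zero hw), inv_inv, mul_inv_cancel_left₀ hw]

/-- The singularity at `0` is removable, because `T⁻¹ w / w → l⁻¹` at infinity. -/
theorem IsNormalizedExteriorMap.differentiableOn_inverseAtInfinity
    (hT : IsNormalizedExteriorMap T U)
    (hR : 0 < R) (hRU : {z : ℂ | R < ‖z‖} ⊆ U) (hl : 0 < l)
    (hlim : Tendsto (fun z => T z / z) (Bornology.cobounded ℂ) (𝓝 (l : ℂ))) :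
    DifferentiableOn ℂ (inverseAtInfinity T U l) (Metric.ball 0 1) := by
  rw [← Complex.differentiableOn_compl_singleton_and_continuousAt_iff
    (Metric.ball_mem_nhds (0 : ℂ) one_pos)]
  constructor
  · rintro ζ ⟨hζ, h0⟩
    have h0' : ζ ≠ 0 := h0
    rw [mem_ball_zero_iff] at hζ
    have h1 : DifferentiableAt ℂ (Function.invFunOn T U) ζ⁻¹ :=
      hT.isBiholomorphism.differentiableOn_inv.differentiableAt
        ((isOpen_lt continuous_const continuous_norm).mem_nhds (one_lt_norm_inv h0' hζ))
    have h2 : DifferentiableAt ℂ (fun ζ => ζ * Function.invFunOn T U ζ⁻¹) ζ :=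
      differentiableAt_id.mul (h1.comp ζ (differentiableAt_inv h0'))
    refine (h2.congr_of_eventuallyEq ?_).differentiableWithinAt
    filter_upwards [isOpen_ne.mem_nhds h0'] with ξ hξ
    exact if_neg hξ
  · rw [continuousAt_iff_punctured_nhds]
    have h1 := (hT.tendsto_invFunOn_div hR hRU hl hlim).comp (tendsto_inv₀_nhdsNE_zero (α := ℂ))
    have h00 : inverseAtInfinity T U l 0 = (l : ℂ)⁻¹ := if_pos rfl
    rw [h00]
    refine h1.congr' ?_
    filter_upwards [self_mem_nhdsWithin] with ζ hζ
    have hζ0 : ζ ≠ 0 := hζ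
    simp [inverseAtInfinity, if_neg hζ0, mul_comm]

theorem IsNormalizedExteriorMap.norm_le (hT : IsNormalizedExteriorMap T U)
    (hR : 0 < R) (hRU : {z : ℂ | R < ‖z‖} ⊆ U) {z : ℂ} (hz : z ∈ U) : ‖z‖ ≤ R * ‖T z‖ := by
  obtain ⟨l, hl, hlim⟩ := hT.normalized
  have hl' : (l : ℂ) ≠ 0 := by exact_mod_cast hl.ne'
  by_cases h : R < ‖z‖
  · exact norm_le_mul_norm_of_exterior hR hl' hlim
      (hT.isBiholomorphism.differentiableOn.mono hRU) (fun w hw => hT.one_lt_norm (hRU hw)) h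
  · nlinarith [hT.one_lt_norm hz, not_lt.1 h]

/-- The bound depends only on a radius beyond which everything lies in `U`. For sets converging to
`C` one radius serves all large indices, whence normality. -/
theorem IsNormalizedExteriorMap.norm_inverseAtInfinity_le (hT : IsNormalizedExteriorMap T U)
    (hR : 0 < R) (hRU : {z : ℂ | R < ‖z‖} ⊆ U) (hl : 0 < l)
    (hlim : Tendsto (fun z => T z / z) (Bornology.cobounded ℂ) (𝓝 (l : ℂ))) {ζ : ℂ}
    (hζ : ‖ζ‖ < 1) : ‖inverseAtInfinity T U l ζ‖ ≤ R := by
  have hl' : (l : ℂ) ≠ 0 := by exact_mod_cast hl.ne'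
  by_cases h0 : ζ = 0
  · rw [inverseAtInfinity, if_pos h0, norm_inv, Complex.norm_real, Real.norm_of_nonneg hl.le,
      inv_le_iff_one_le_mul₀ hl]
    have := one_le_mul_norm_of_exterior hR hl' hlim
      (hT.isBiholomorphism.differentiableOn.mono hRU) (fun w hw => hT.one_lt_norm (hRU hw))
    rwa [Complex.norm_real, Real.norm_of_nonneg hl.le] at this
  · obtain ⟨h1, h2⟩ := hT.mapsTo_invFunOn (one_lt_norm_inv h0 hζ)
    have h3 := hT.norm_le hR hRU h1
    rw [h2, norm_inv, ← div_eq_mul_inv, le_div_iff₀ (norm_pos_iff.2 h0)] at h3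
    rw [inverseAtInfinity, if_neg h0, norm_mul]
    linarith

/-- Says that `T⁻¹` omits `c`, in a form without pole that is suited to Hurwitz' theorem on the
whole disk. -/
theorem IsNormalizedExteriorMap.inverseAtInfinity_sub_ne_zero (hT : IsNormalizedExteriorMap T U)
    (hl : 0 < l) {c : ℂ} (hc : c ∉ U) {ζ : ℂ} (hζ : ‖ζ‖ < 1) :
    inverseAtInfinity T U l ζ - c * ζ ≠ 0 := by
  have hl' : (l : ℂ) ≠ 0 := by exact_mod_cast hl.ne'
  by_cases h0 : ζ = 0
  · simp [inverseAtInfinity, h0, hl']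
  · obtain ⟨h1, h2⟩ := hT.mapsTo_invFunOn (one_lt_norm_inv h0 hζ)
    rw [inverseAtInfinity, if_neg h0, mul_comm c, ← mul_sub]
    exact mul_ne_zero h0 (sub_ne_zero.2 fun h => hc (h ▸ h1))

end NormalizedMap

/-! ### Convergence under Hausdorff approximation -/

theorem tendstoLocallyUniformlyOn_of_subseq {U : Set ℂ} (hU : IsOpen U) {f : ℕ → ℂ → ℂ}
    {g : ℂ → ℂ} (h : ∀ φ : ℕ → ℕ, StrictMono φ → ∃ ψ : ℕ → ℕ, StrictMono ψ ∧
      TendstoLocallyUniformlyOn (fun n => f (φ (ψ n))) g atTop U) :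
    TendstoLocallyUniformlyOn f g atTop U := by
  rw [tendstoLocallyUniformlyOn_iff_forall_isCompact hU]
  intro K hKU hK
  rw [Metric.tendstoUniformlyOn_iff]
  by_contra! hcon
  obtain ⟨ε, hε, hcon⟩ := hcon
  obtain ⟨φ, hφ, hbad⟩ := extraction_of_frequently_atTop hcon
  obtain ⟨ψ, -, hψ⟩ := h φ hφ
  have h1 := Metric.tendstoUniformlyOn_iff.1
    ((tendstoLocallyUniformlyOn_iff_forall_isCompact hU).1 hψ K hKU hK) ε hε
  obtain ⟨n, hn⟩ := h1.exists
  obtain ⟨x, hx, hle⟩ := hbad (ψ n)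
  exact (hn x hx).not_ge hle

/-- Compact sets `K n` converging to `C` in the Hausdorff distance, together with the normalized
exterior maps of `C` and of all the `K n`. -/
structure IsExteriorApproximation (C : Set ℂ) (T : ℂ → ℂ) (K : ℕ → Set ℂ) (S : ℕ → ℂ → ℂ) :
    Prop where
  isCompact : IsCompact C
  nontrivial : C.Nontrivial
  isNormalizedExteriorMap : IsNormalizedExteriorMap T (unboundedComponent Cᶜ)
  nonempty : ∀ n, (K n).Nonempty
  tendsto : Tendsto (fun n => Metric.hausdorffEDist (K n) C) atTop (𝓝 0)
  isNormalizedExteriorMap_seq : ∀ n, IsNormalizedExteriorMap (S n) (K n)ᶜ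

namespace IsExteriorApproximation

variable {C : Set ℂ} {T : ℂ → ℂ} {K : ℕ → Set ℂ} {S : ℕ → ℂ → ℂ}

theorem eventually_subset_compl (h : IsExteriorApproximation C T K S) {A : Set ℂ}
    (hA : IsCompact A) (hAC : A ⊆ Cᶜ) : ∀ᶠ n in atTop, A ⊆ (K n)ᶜ := by
  obtain ⟨δ, hδ, hsub⟩ := h.isCompact.exists_thickening_subset_open hA.isClosed.isOpen_compl
    (subset_compl_comm.1 hAC)
  filter_upwards [h.tendsto.eventually_lt_const (ENNReal.ofReal_pos.2 hδ)] with n hn z hz hzK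
  obtain ⟨y, hy, hzy⟩ := Metric.exists_edist_lt_of_hausdorffEDist_lt hzK hn
  refine hsub (Metric.mem_thickening_iff.2 ⟨y, hy, ?_⟩) hz
  rwa [edist_dist, ENNReal.ofReal_lt_ofReal_iff hδ] at hzy

theorem exists_seq_tendsto (h : IsExteriorApproximation C T K S) {c : ℂ} (hc : c ∈ C) :
    ∃ x : ℕ → ℂ, (∀ n, x n ∈ K n) ∧ Tendsto x atTop (𝓝 c) := by
  have hex : ∀ n : ℕ, ∃ y ∈ K n, edist c y ≤
      Metric.hausdorffEDist (K n) C + ENNReal.ofReal (1 / (n + 1)) := by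
    intro n
    -- An infinite distance makes the bound trivial, and any point of `K n` will do.
    rcases eq_or_ne (Metric.hausdorffEDist (K n) C) ⊤ with htop | htop
    · obtain ⟨y, hy⟩ := h.nonempty n
      exact ⟨y, hy, by simp [htop]⟩
    · have hlt : Metric.hausdorffEDist C (K n) <
          Metric.hausdorffEDist (K n) C + ENNReal.ofReal (1 / (n + 1)) := by
        rw [Metric.hausdorffEDist_comm]
        exact ENNReal.lt_add_right htop (ENNReal.ofReal_pos.2 (by positivity)).ne'
      obtain ⟨y, hy, hcy⟩ := Metric.exists_edist_lt_of_hausdorffEDist_lt hc hlt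
      exact ⟨y, hy, hcy.le⟩
  choose x hxK hx using hex
  refine ⟨x, hxK, tendsto_iff_edist_tendsto_0.2 ?_⟩
  have hz : Tendsto (fun n : ℕ => ENNReal.ofReal (1 / ((n : ℝ) + 1))) atTop (𝓝 0) := by
    rw [← ENNReal.ofReal_zero]
    exact ENNReal.tendsto_ofReal tendsto_one_div_add_atTop_nhds_zero_nat
  have hsum := h.tendsto.add hz
  rw [add_zero] at hsum
  exact tendsto_of_tendsto_of_tendsto_of_le_of_le tendsto_const_nhds hsum (fun _ => zero_le)
    fun n => by rw [edist_comm]; exact hx n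

theorem exists_radius (h : IsExteriorApproximation C T K S) (M : ℝ) : ∃ R > 0, M ≤ R ∧
    {z : ℂ | R < ‖z‖} ⊆ unboundedComponent Cᶜ ∧ ∀ᶠ n in atTop, {z : ℂ | R < ‖z‖} ⊆ (K n)ᶜ := by
  obtain ⟨R, hR0, hR⟩ := h.isCompact.isBounded.exists_pos_norm_le
  refine ⟨max (R + 1) M, by positivity, le_max_right _ _, ?_, ?_⟩
  · refine Subset.trans (fun z hz => ?_) (norm_gt_subset_unboundedComponent hR0.le hR)
    have h1 : max (R + 1) M < ‖z‖ := hz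
    have := (le_max_left _ _).trans_lt h1
    exact show R < ‖z‖ by linarith
  · filter_upwards [h.tendsto.eventually_lt_const zero_lt_one] with n hn z hz hzK
    have h1 : max (R + 1) M < ‖z‖ := hz
    obtain ⟨y, hy, hzy⟩ := Metric.exists_edist_lt_of_hausdorffEDist_lt hzK hn
    rw [edist_dist, ENNReal.ofReal_lt_one, dist_eq_norm] at hzy
    have h2 := norm_sub_norm_le z y
    have := (le_max_left _ _).trans_lt h1
    linarith [hR y hy]

/-- For large `n` the map `S n ∘ T⁻¹` is defined on `{|w| > r}`: the part in a large disk has its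
image in a compact subset of `Cᶜ`, and the rest is sent beyond radius `R`. The Schwarz lemma at
infinity then gives `r * m n / l ≥ 1`. -/
theorem eventually_le_mul (h : IsExteriorApproximation C T K S) {l : ℝ} (hl : 0 < l)
    (hlim : Tendsto (fun z => T z / z) (Bornology.cobounded ℂ) (𝓝 (l : ℂ))) {m : ℕ → ℝ}
    (hm : ∀ n, 0 < m n)
    (hmlim : ∀ n, Tendsto (fun z => S n z / z) (Bornology.cobounded ℂ) (𝓝 (m n : ℂ)))
    {r : ℝ} (hr : 1 < r) : ∀ᶠ n in atTop, l ≤ r * m n := by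
  obtain ⟨R, hR, -, hRU, hRK⟩ := h.exists_radius 0
  set F := Function.invFunOn T (unboundedComponent Cᶜ) with hF
  have hT := h.isNormalizedExteriorMap
  have htend := hT.tendsto_invFunOn hR hRU
  have hbig : ∀ᶠ w in Bornology.cobounded ℂ, R < ‖F w‖ :=
    (tendsto_norm_cobounded_atTop.comp htend).eventually (eventually_gt_atTop R)
  obtain ⟨M, -, hM⟩ := (Metric.hasBasis_cobounded_compl_closedBall (0 : ℂ)).eventually_iff.1 hbig
  set A : Set ℂ := {w | r ≤ ‖w‖} ∩ Metric.closedBall 0 M with hA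
  have hAc : IsCompact A :=
    (isCompact_closedBall (0 : ℂ) M).inter_left (isClosed_le continuous_const continuous_norm)
  have hAΔ : A ⊆ unitDiskExterior := fun w hw => hr.trans_le hw.1
  have hFA : IsCompact (F '' A) :=
    hAc.image_of_continuousOn (hT.isBiholomorphism.differentiableOn_inv.continuousOn.mono hAΔ)
  have hFAC : F '' A ⊆ Cᶜ := by
    rintro _ ⟨w, hw, rfl⟩
    exact (hT.mapsTo_invFunOn (hAΔ hw)).1.1
  filter_upwards [h.eventually_subset_compl hFA hFAC, hRK] with n hn hnR
  have hFK : ∀ w, r < ‖w‖ → F w ∈ (K n)ᶜ := fun w hw => by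
    by_cases hwM : w ∈ Metric.closedBall (0 : ℂ) M
    · exact hn ⟨w, ⟨le_of_lt hw, hwM⟩, rfl⟩
    · exact hnR (hM hwM)
  have hS := h.isNormalizedExteriorMap_seq n
  have hl' : (l : ℂ) ≠ 0 := by exact_mod_cast hl.ne'
  have hm' : (m n : ℂ) ≠ 0 := by exact_mod_cast (hm n).ne'
  have h1 := one_le_mul_norm_of_exterior (by linarith) (mul_ne_zero hm' (inv_ne_zero hl'))
    (hT.tendsto_comp_div hR hRU hl hlim (hmlim n))
    (hS.isBiholomorphism.differentiableOn.comp
      (hT.isBiholomorphism.differentiableOn_inv.mono fun w (hw : r < ‖w‖) => hr.trans hw)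
      fun w hw => hFK w hw)
    fun w hw => hS.one_lt_norm (hFK w hw)
  rw [norm_mul, norm_inv, Complex.norm_real, Complex.norm_real, Real.norm_of_nonneg hl.le,
    Real.norm_of_nonneg (hm n).le, ← mul_assoc, ← div_eq_mul_inv, one_le_div hl] at h1
  exact h1

/-- A subsequential limit of the inverse maps, in the coordinate at infinity, is the inverse map
of the limit set. -/
theorem eqOn_of_tendstoLocallyUniformlyOn (h : IsExteriorApproximation C T K S) {l : ℝ}
    (hl : 0 < l) (hlim : Tendsto (fun z => T z / z) (Bornology.cobounded ℂ) (𝓝 (l : ℂ)))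
    {m : ℕ → ℝ} (hm : ∀ n, 0 < m n)
    (hmlim : ∀ n, Tendsto (fun z => S n z / z) (Bornology.cobounded ℂ) (𝓝 (m n : ℂ)))
    {a : ℕ → ℕ} (ha : Tendsto a atTop atTop) {H : ℂ → ℂ}
    (hH : TendstoLocallyUniformlyOn (fun n => inverseAtInfinity (S (a n)) (K (a n))ᶜ (m (a n))) H
      atTop (Metric.ball 0 1)) :
    EqOn H (inverseAtInfinity T (unboundedComponent Cᶜ) l) (Metric.ball 0 1) := by
  obtain ⟨R, hR, -, hRU, hRK⟩ := h.exists_radius 0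
  have hT := h.isNormalizedExteriorMap
  have hl' : (l : ℂ) ≠ 0 := by exact_mod_cast hl.ne'
  have h0B : (0 : ℂ) ∈ Metric.ball (0 : ℂ) 1 := Metric.mem_ball_self one_pos
  have hdiff : ∀ᶠ n in atTop, DifferentiableOn ℂ
      (inverseAtInfinity (S (a n)) (K (a n))ᶜ (m (a n))) (Metric.ball 0 1) := by
    filter_upwards [ha.eventually hRK] with n hn
    exact (h.isNormalizedExteriorMap_seq _).differentiableOn_inverseAtInfinity hR hn (hm _)
      (hmlim _)
  have hHd : DifferentiableOn ℂ H (Metric.ball 0 1) := hH.differentiableOn hdiff Metric.isOpen_ball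
  -- Hurwitz' alternative, for the zero-free approximants built from points of `K (a n)` tending to
  -- `c`.
  have hdich : ∀ c ∈ C, ∀ ζ₀ ∈ Metric.ball (0 : ℂ) 1, H ζ₀ - c * ζ₀ = 0 →
      ∀ ζ ∈ Metric.ball (0 : ℂ) 1, H ζ - c * ζ = 0 := by
    intro c hc ζ₀ hζ₀ h0
    obtain ⟨x, hxK, hx⟩ := h.exists_seq_tendsto hc
    refine eqOn_zero_of_tendstoLocallyUniformlyOn_of_ne_zero Metric.isOpen_ball
      (convex_ball _ _).isPreconnected (g := fun ζ => H ζ - c * ζ)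
      (f := fun n ζ => inverseAtInfinity (S (a n)) (K (a n))ᶜ (m (a n)) ζ - x (a n) * ζ)
      ?_ ?_ ?_ hζ₀ h0
    · filter_upwards [hdiff] with n hn
      exact hn.sub (differentiableOn_id.const_mul _)
    · refine Eventually.of_forall fun n ζ hζ => ?_
      exact (h.isNormalizedExteriorMap_seq _).inverseAtInfinity_sub_ne_zero (hm _)
        (fun hx => hx (hxK _)) (mem_ball_zero_iff.1 hζ)
    · rw [tendstoLocallyUniformlyOn_iff_forall_isCompact Metric.isOpen_ball]
      intro A hA hAc
      refine ((tendstoLocallyUniformlyOn_iff_forall_isCompact Metric.isOpen_ball).1 hH A hA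
        hAc).sub ?_
      rw [Metric.tendstoUniformlyOn_iff]
      intro ε hε
      filter_upwards [Metric.tendsto_nhds.1 (hx.comp ha) ε hε] with n hn ζ hζ
      have h1 := (mem_ball_zero_iff.1 (hA hζ)).le
      rw [dist_eq_norm, ← sub_mul, norm_mul]
      rw [dist_comm, dist_eq_norm] at hn
      calc _ ≤ ‖c - x (a n)‖ * 1 := by gcongr
        _ < ε := by rwa [mul_one]
  -- If `H ζ = c ζ` identically, then `H 0 = 0`, which is a zero for a second point `c'` as well;
  -- then `c ζ = c' ζ` at `ζ = 1 / 2`.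
  have hne : ∀ c ∈ C, ∀ ζ ∈ Metric.ball (0 : ℂ) 1, H ζ - c * ζ ≠ 0 := by
    intro c hc ζ hζ h0
    have hz := hdich c hc ζ hζ h0
    have h00 : H 0 = 0 := by simpa using hz 0 h0B
    obtain ⟨c', hc', hcc'⟩ := h.nontrivial.exists_ne c
    have hz' := hdich c' hc' 0 h0B (by simp [h00])
    have hhalf : (1 / 2 : ℂ) ∈ Metric.ball (0 : ℂ) 1 := by
      rw [mem_ball_zero_iff]; norm_num
    have h1 := hz _ hhalf
    have h2 := hz' _ hhalf
    exact hcc' (by linear_combination 2 * h1 - 2 * h2)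
  obtain ⟨c, hc⟩ := h.nontrivial.nonempty
  have hH0 : H 0 ≠ 0 := by simpa using hne c hc 0 h0B
  have hH0lim : Tendsto (fun n => ((m (a n) : ℝ) : ℂ)⁻¹) atTop (𝓝 (H 0)) := by
    refine (hH.tendsto_at h0B).congr fun n => ?_
    exact if_pos rfl
  have hnorm : ∀ n, ‖((m (a n) : ℝ) : ℂ)⁻¹‖ = (m (a n))⁻¹ := fun n => by
    rw [norm_inv, Complex.norm_real, Real.norm_of_nonneg (hm _).le]
  have hH0real : H 0 = (‖H 0‖ : ℝ) := by
    refine tendsto_nhds_unique hH0lim ?_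
    refine ((Complex.continuous_ofReal.tendsto _).comp hH0lim.norm).congr fun n => ?_
    simp only [Function.comp, hnorm]
    push_cast
    rfl
  -- The upper bound on the derivative of `T ∘ G` at infinity, from `eventually_le_mul` as `r`
  -- decreases to `1`; the Schwarz lemma for `T ∘ G` gives the lower one.
  have hH0le : ‖H 0‖ * l ≤ 1 := by
    refine le_of_forall_gt_imp_ge_of_dense fun r hr => ?_
    refine le_of_tendsto (hH0lim.norm.mul_const l) ?_
    filter_upwards [ha.eventually (h.eventually_le_mul hl hlim hm hmlim hr)] with n hn
    rw [hnorm, ← div_eq_inv_mul, div_le_iff₀ (hm _)]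
    exact hn
  set G : ℂ → ℂ := fun w => w * H w⁻¹ with hG
  have hinvB : ∀ w : ℂ, 1 < ‖w‖ → w⁻¹ ∈ Metric.ball (0 : ℂ) 1 := fun w hw => by
    rw [mem_ball_zero_iff, norm_inv]
    exact inv_lt_one_of_one_lt₀ hw
  have hw0 : ∀ w : ℂ, 1 < ‖w‖ → w ≠ 0 := fun w hw => norm_pos_iff.1 (by linarith)
  have hGd : DifferentiableOn ℂ G {w | 1 < ‖w‖} := by
    refine differentiableOn_id.mul (hHd.comp ?_ hinvB)
    exact fun w hw => (differentiableAt_inv (hw0 w hw)).differentiableWithinAt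
  have hGC : G '' {w | 1 < ‖w‖} ⊆ Cᶜ := by
    rintro _ ⟨w, hw, rfl⟩ hwC
    refine hne _ hwC w⁻¹ (hinvB w hw) ?_
    have := hw0 w hw
    simp only [hG]
    field_simp
    ring
  have hGlim : Tendsto (fun w => G w / w) (Bornology.cobounded ℂ) (𝓝 (H 0)) := by
    have h1 := (hHd.continuousOn.continuousAt (Metric.ball_mem_nhds 0 one_pos)).tendsto.comp
      (tendsto_inv₀_cobounded (α := ℂ))
    refine h1.congr' ?_
    filter_upwards [tendsto_norm_cobounded_atTop.eventually (eventually_gt_atTop 1)] with w hw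
    have := hw0 w hw
    simp only [hG, Function.comp]
    field_simp
  have hGinf : Tendsto G (Bornology.cobounded ℂ) (Bornology.cobounded ℂ) := by
    rw [← tendsto_norm_atTop_iff_cobounded]
    have h1 := tendsto_norm_cobounded_atTop (E := ℂ) |>.atTop_mul_pos (norm_pos_iff.2 hH0)
      hGlim.norm
    refine h1.congr' ?_
    filter_upwards [tendsto_norm_cobounded_atTop.eventually (eventually_gt_atTop 1)] with w hw
    rw [norm_div, mul_div_cancel₀]
    linarith
  -- The image is connected, avoids `C` and reaches arbitrarily far out.
  have hGP : G '' {w | 1 < ‖w‖} ⊆ unboundedComponent Cᶜ := by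
    obtain ⟨R', hR'0, hR'⟩ := h.isCompact.isBounded.exists_pos_norm_le
    obtain ⟨w, hw1, hw2⟩ := (((tendsto_norm_cobounded_atTop.comp hGinf).eventually
      (eventually_gt_atTop R')).and
      (tendsto_norm_cobounded_atTop.eventually (eventually_gt_atTop 1))).exists
    exact subset_unboundedComponent hR'0.le hR'
      ((isPreconnected_norm_gt zero_le_one).image _ hGd.continuousOn) hGC
      (mem_image_of_mem G hw2) hw1
  have hTGlim : Tendsto (fun w => T (G w) / w) (Bornology.cobounded ℂ) (𝓝 (l * H 0)) := by
    refine ((hlim.comp hGinf).mul hGlim).congr' ?_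
    filter_upwards [hGinf.eventually (tendsto_norm_cobounded_atTop.eventually
      (eventually_gt_atTop 0))] with w hw
    have : G w ≠ 0 := norm_pos_iff.1 hw
    simp only [Function.comp]
    field_simp
  have hTGd : DifferentiableOn ℂ (fun w => T (G w)) {w | 1 < ‖w‖} :=
    hT.isBiholomorphism.differentiableOn.comp hGd fun w hw => hGP (mem_image_of_mem G hw)
  have hTGm : ∀ w, 1 < ‖w‖ → 1 < ‖T (G w)‖ := fun w hw =>
    hT.one_lt_norm (hGP (mem_image_of_mem G hw))
  have h1 := one_le_mul_norm_of_exterior one_pos (mul_ne_zero hl' hH0) hTGlim hTGd hTGm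
  rw [one_mul, norm_mul, Complex.norm_real, Real.norm_of_nonneg hl.le, mul_comm] at h1
  have h2 : ‖H 0‖ * l = 1 := le_antisymm hH0le h1
  have h3 : (l : ℂ) * H 0 = 1 := by
    rw [hH0real, mul_comm]
    exact_mod_cast h2
  rw [h3] at hTGlim
  intro ζ hζ
  by_cases hζ0 : ζ = 0
  · rw [inverseAtInfinity, if_pos hζ0, hζ0]
    exact eq_inv_of_mul_eq_one_right h3
  · have hw := one_lt_norm_inv hζ0 (mem_ball_zero_iff.1 hζ)
    have h4 := eq_self_of_exterior hTGlim hTGd hTGm hw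
    rw [inverseAtInfinity, if_neg hζ0]
    have h5 := hT.invFunOn_apply (hGP (mem_image_of_mem G hw))
    rw [h4] at h5
    rw [h5]
    simp [hG, hζ0]

theorem tendstoLocallyUniformlyOn_inverseAtInfinity (h : IsExteriorApproximation C T K S) {l : ℝ}
    (hl : 0 < l) (hlim : Tendsto (fun z => T z / z) (Bornology.cobounded ℂ) (𝓝 (l : ℂ)))
    {m : ℕ → ℝ} (hm : ∀ n, 0 < m n)
    (hmlim : ∀ n, Tendsto (fun z => S n z / z) (Bornology.cobounded ℂ) (𝓝 (m n : ℂ))) :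
    TendstoLocallyUniformlyOn (fun n => inverseAtInfinity (S n) (K n)ᶜ (m n))
      (inverseAtInfinity T (unboundedComponent Cᶜ) l) atTop (Metric.ball 0 1) := by
  obtain ⟨R, hR, -, hRU, hRK⟩ := h.exists_radius 0
  obtain ⟨N, hN⟩ := eventually_atTop.1 hRK
  refine tendstoLocallyUniformlyOn_of_subseq Metric.isOpen_ball fun φ hφ => ?_
  -- Holomorphy at `0` and the bound `R` are available only from index `N` on, hence the shift.
  have hφN : ∀ n, N ≤ φ (n + N) := fun n => (Nat.le_add_left N n).trans (hφ.le_apply)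
  obtain ⟨H, ψ, hψ, hH⟩ := exists_subseq_tendstoLocallyUniformlyOn_of_bounded
    (U := Metric.ball 0 1) Metric.isOpen_ball
    (f := fun n => inverseAtInfinity (S (φ (n + N))) (K (φ (n + N)))ᶜ (m (φ (n + N)))) (M := R)
    (fun n => (h.isNormalizedExteriorMap_seq _).differentiableOn_inverseAtInfinity hR
      (hN _ (hφN n)) (hm _) (hmlim _))
    fun n ζ hζ => (h.isNormalizedExteriorMap_seq _).norm_inverseAtInfinity_le hR
      (hN _ (hφN n)) (hm _) (hmlim _) (mem_ball_zero_iff.1 hζ)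
  have hψN : StrictMono fun n => ψ n + N := fun i j hij => Nat.add_lt_add_right (hψ hij) N
  refine ⟨fun n => ψ n + N, hψN, hH.congr_right ?_⟩
  exact h.eqOn_of_tendstoLocallyUniformlyOn hl hlim hm hmlim (hφ.comp hψN).tendsto_atTop hH

theorem tendstoLocallyUniformlyOn_invFunOn (h : IsExteriorApproximation C T K S) :
    TendstoLocallyUniformlyOn (fun n => Function.invFunOn (S n) (K n)ᶜ)
      (Function.invFunOn T (unboundedComponent Cᶜ)) atTop unitDiskExterior := by
  obtain ⟨l, hl, hlim⟩ := h.isNormalizedExteriorMap.normalized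
  choose m hm hmlim using fun n => (h.isNormalizedExteriorMap_seq n).normalized
  have hH := h.tendstoLocallyUniformlyOn_inverseAtInfinity hl hlim hm hmlim
  rw [tendstoLocallyUniformlyOn_iff_forall_isCompact Metric.isOpen_ball] at hH
  rw [tendstoLocallyUniformlyOn_iff_forall_isCompact
    (show IsOpen unitDiskExterior from isOpen_lt continuous_const continuous_norm)]
  intro A hA hAc
  have hA0 : ∀ w ∈ A, w ≠ 0 := fun w hw => norm_pos_iff.1 (zero_lt_one.trans (hA hw))
  have hsub : Inv.inv '' A ⊆ Metric.ball (0 : ℂ) 1 := by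
    rintro _ ⟨w, hw, rfl⟩
    rw [mem_ball_zero_iff, norm_inv]
    exact inv_lt_one_of_one_lt₀ (hA hw)
  have hcpt : IsCompact (Inv.inv '' A) :=
    hAc.image_of_continuousOn fun w hw => (continuousAt_inv₀ (hA0 w hw)).continuousWithinAt
  obtain ⟨M, hM0, hM⟩ := hAc.isBounded.exists_pos_norm_le
  rw [Metric.tendstoUniformlyOn_iff]
  intro ε hε
  filter_upwards [Metric.tendstoUniformlyOn_iff.1 (hH _ hsub hcpt) (ε / M) (by positivity)]
    with n hn w hw
  have h1 := hn w⁻¹ (mem_image_of_mem _ hw)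
  rw [invFunOn_eq_mul_inverseAtInfinity (l := l) (hA0 w hw),
    invFunOn_eq_mul_inverseAtInfinity (l := m n) (hA0 w hw), dist_eq_norm, ← mul_sub, norm_mul]
  rw [dist_eq_norm, lt_div_iff₀ hM0] at h1
  calc _ ≤ M * ‖_‖ := by gcongr; exact hM w hw
    _ < ε := by rwa [mul_comm]

/-- Points of bounded modulus thus have uniformly bounded images under `S n`, as needed on the
bounded components. The reason is that `inverseAtInfinity` stays above `l⁻¹ / 4` in modulus on a
fixed disk for large `n`, so that the inverse has modulus at least `|w| / (4 * l)`. -/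
theorem exists_eventually_lt_norm_invFunOn (h : IsExteriorApproximation C T K S) (R : ℝ) :
    ∃ M, ∀ᶠ n in atTop, ∀ w, M < ‖w‖ → R < ‖Function.invFunOn (S n) (K n)ᶜ w‖ := by
  obtain ⟨l, hl, hlim⟩ := h.isNormalizedExteriorMap.normalized
  choose m hm hmlim using fun n => (h.isNormalizedExteriorMap_seq n).normalized
  obtain ⟨R₀, hR₀, -, hRU, hRK⟩ := h.exists_radius 0
  have hH := h.tendstoLocallyUniformlyOn_inverseAtInfinity hl hlim hm hmlim
  have hcont := ((h.isNormalizedExteriorMap.differentiableOn_inverseAtInfinity hR₀ hRU hl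
    hlim).continuousOn.continuousAt (Metric.ball_mem_nhds 0 one_pos))
  have h0 : inverseAtInfinity T (unboundedComponent Cᶜ) l 0 = (l : ℂ)⁻¹ := if_pos rfl
  have hnear : ∀ᶠ ζ in 𝓝 (0 : ℂ),
      l⁻¹ / 2 < ‖inverseAtInfinity T (unboundedComponent Cᶜ) l ζ‖ := by
    refine hcont.norm.eventually_const_lt ?_
    beta_reduce
    rw [h0, norm_inv, Complex.norm_real, Real.norm_of_nonneg hl.le]
    exact half_lt_self (by positivity)
  obtain ⟨ρ, hρ, hρs⟩ := Metric.nhds_basis_closedBall.mem_iff.1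
    (inter_mem hnear (Metric.ball_mem_nhds (0 : ℂ) one_pos))
  have hunif := Metric.tendstoUniformlyOn_iff.1
    ((tendstoLocallyUniformlyOn_iff_forall_isCompact Metric.isOpen_ball).1 hH _
      (fun ζ hζ => (hρs hζ).2) (isCompact_closedBall 0 ρ)) (l⁻¹ / 4) (by positivity)
  refine ⟨max ρ⁻¹ (4 * l * |R|), ?_⟩
  filter_upwards [hunif] with n hn w hw
  have hw1 : ρ⁻¹ < ‖w‖ := (le_max_left _ _).trans_lt hw
  have hw2 : 4 * l * |R| < ‖w‖ := (le_max_right _ _).trans_lt hw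
  have hwpos : 0 < ‖w‖ := lt_trans (by positivity) hw1
  have hwB : w⁻¹ ∈ Metric.closedBall (0 : ℂ) ρ := by
    rw [mem_closedBall_zero_iff, norm_inv]
    exact (inv_lt_of_inv_lt₀ hρ hw1).le
  have h1 := hn _ hwB
  have h2 : l⁻¹ / 2 < ‖inverseAtInfinity T (unboundedComponent Cᶜ) l w⁻¹‖ := (hρs hwB).1
  rw [dist_eq_norm] at h1
  have h3 := norm_sub_norm_le (inverseAtInfinity T (unboundedComponent Cᶜ) l w⁻¹)
    (inverseAtInfinity (S n) (K n)ᶜ (m n) w⁻¹)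
  have h4 : l⁻¹ / 4 < ‖inverseAtInfinity (S n) (K n)ᶜ (m n) w⁻¹‖ := by linarith
  rw [invFunOn_eq_mul_inverseAtInfinity (l := m n) (norm_pos_iff.1 hwpos), norm_mul]
  calc R ≤ 4 * l * |R| * (l⁻¹ / 4) := by
        have : 4 * l * |R| * (l⁻¹ / 4) = |R| := by field_simp
        rw [this]
        exact le_abs_self R
    _ ≤ ‖w‖ * (l⁻¹ / 4) := by gcongr
    _ < _ := by gcongr

/-- A quantitative open mapping theorem: the inverse maps send a small closed disk about `T z₀` onto
a set containing a fixed ball about `z₀`, so by injectivity `S n` sends that ball back into the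
disk. -/
theorem exists_ball_eventually_dist_lt (h : IsExteriorApproximation C T K S) {z₀ : ℂ}
    (hz₀ : z₀ ∈ unboundedComponent Cᶜ) {ε : ℝ} (hε : 0 < ε) :
    ∃ δ > 0, ∀ᶠ n in atTop, ∀ z ∈ Metric.ball z₀ δ, dist (S n z) (T z₀) ≤ ε := by
  have hT := h.isNormalizedExteriorMap
  set F := Function.invFunOn T (unboundedComponent Cᶜ) with hF
  have hΔo : IsOpen unitDiskExterior := isOpen_lt continuous_const continuous_norm
  set w₀ := T z₀ with hw₀
  have hFw₀ : F w₀ = z₀ := hT.invFunOn_apply hz₀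
  obtain ⟨s, hs, hsΔ⟩ := Metric.nhds_basis_closedBall.mem_iff.1
    (hΔo.mem_nhds (show w₀ ∈ unitDiskExterior from hT.one_lt_norm hz₀))
  set ρ := min s ε with hρ
  have hρ0 : 0 < ρ := lt_min hs hε
  have hρΔ : Metric.closedBall w₀ ρ ⊆ unitDiskExterior :=
    (Metric.closedBall_subset_closedBall (min_le_left _ _)).trans hsΔ
  have hFinj : ∀ w ∈ Metric.sphere w₀ ρ, F w ≠ z₀ := fun w hw he => by
    have hwΔ := hρΔ (Metric.sphere_subset_closedBall hw)
    have : T (F w) = w := (hT.mapsTo_invFunOn hwΔ).2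
    rw [he] at this
    exact Metric.ne_of_mem_sphere hw hρ0.ne' this.symm
  obtain ⟨d, hd, hdF⟩ : ∃ d > 0, ∀ w ∈ Metric.sphere w₀ ρ, d ≤ ‖F w - z₀‖ := by
    obtain ⟨x, hx, hmin⟩ := (isCompact_sphere w₀ ρ).exists_isMinOn
      (NormedSpace.sphere_nonempty.2 hρ0.le)
      (((hT.isBiholomorphism.differentiableOn_inv.continuousOn.mono
        (Metric.sphere_subset_closedBall.trans hρΔ)).sub continuousOn_const).norm)
    exact ⟨‖F x - z₀‖, norm_pos_iff.2 (sub_ne_zero.2 (hFinj x hx)), fun z hz => hmin hz⟩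
  have hunif := Metric.tendstoUniformlyOn_iff.1
    ((tendstoLocallyUniformlyOn_iff_forall_isCompact hΔo).1 h.tendstoLocallyUniformlyOn_invFunOn _
      hρΔ (isCompact_closedBall w₀ ρ)) (d / 8) (by positivity)
  -- On the circle `‖Fn w - Fn w₀‖ ≥ d - d / 8 - d / 8 ≥ d / 2`, so the image of the disk contains
  -- the ball of radius `d / 4` about `Fn w₀`; the point `z` is within `d / 8 + d / 8` of that
  -- centre.
  refine ⟨d / 8, by positivity, ?_⟩
  filter_upwards [hunif] with n hn z hz
  have hS := h.isNormalizedExteriorMap_seq n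
  set Fn := Function.invFunOn (S n) (K n)ᶜ with hFn
  have hcl : closure (Metric.ball w₀ ρ) ⊆ unitDiskExterior :=
    Metric.closure_ball_subset_closedBall.trans hρΔ
  have hnw₀ := hn w₀ (Metric.mem_closedBall_self hρ0.le)
  rw [← hF, hFw₀] at hnw₀
  have hsph : ∀ w ∈ Metric.sphere w₀ ρ, d / 2 ≤ ‖Fn w - Fn w₀‖ := fun w hw => by
    have h1 := hn w (Metric.sphere_subset_closedBall hw)
    rw [← hF] at h1
    have h2 := hdF w hw
    rw [← dist_eq_norm] at h2 ⊢
    have h3 := dist_triangle4 (F w) (Fn w) (Fn w₀) z₀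
    rw [dist_comm (Fn w₀) z₀] at h3
    linarith
  have hfreq : ∃ᶠ w in 𝓝 w₀, Fn w ≠ Fn w₀ := by
    have h1 : ∀ᶠ w in 𝓝[≠] w₀, Fn w ≠ Fn w₀ := by
      filter_upwards [self_mem_nhdsWithin, mem_nhdsWithin_of_mem_nhds
        (Metric.closedBall_mem_nhds w₀ hρ0)] with w hw hwB he
      have h2 := (hS.mapsTo_invFunOn (hρΔ hwB)).2
      have h3 := (hS.mapsTo_invFunOn (hρΔ (Metric.mem_closedBall_self hρ0.le))).2
      rw [← hFn] at h2 h3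
      exact hw (by rw [mem_singleton_iff, ← h2, he, h3])
    exact h1.frequently.filter_mono nhdsWithin_le_nhds
  have himg := DiffContOnCl.ball_subset_image_closedBall
    (DifferentiableOn.diffContOnCl (hS.isBiholomorphism.differentiableOn_inv.mono hcl)) hρ0 hsph
    hfreq
  have hzm : z ∈ Metric.ball (Fn w₀) (d / 2 / 2) := by
    rw [Metric.mem_ball] at hz ⊢
    have := dist_triangle z z₀ (Fn w₀)
    linarith
  obtain ⟨w, hw, rfl⟩ := himg hzm
  rw [(hS.mapsTo_invFunOn (hρΔ hw)).2]
  exact (Metric.mem_closedBall.1 hw).trans (min_le_right _ _)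

theorem tendstoLocallyUniformlyOn (h : IsExteriorApproximation C T K S) :
    TendstoLocallyUniformlyOn S T atTop (unboundedComponent Cᶜ) := by
  rw [Metric.tendstoLocallyUniformlyOn_iff]
  intro ε hε z₀ hz₀
  obtain ⟨δ, hδ, hev⟩ := h.exists_ball_eventually_dist_lt hz₀ (show 0 < ε / 2 by positivity)
  have hc := (h.isNormalizedExteriorMap.isBiholomorphism.differentiableOn.continuousOn) z₀ hz₀
  refine ⟨Metric.ball z₀ δ ∩ {z | dist (T z) (T z₀) < ε / 2}, inter_mem
    (mem_nhdsWithin_of_mem_nhds (Metric.ball_mem_nhds z₀ hδ))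
    (Metric.tendsto_nhds.1 hc (ε / 2) (by positivity)), ?_⟩
  filter_upwards [hev] with n hn z hz
  have h1 := hn z hz.1
  have h2 : dist (T z) (T z₀) < ε / 2 := hz.2
  linarith [dist_triangle_right (T z) (S n z) (T z₀)]

/-- The index from which `S n` is holomorphic depends on the compact set, so Weierstrass' theorem is
applied ball by ball. -/
theorem tendstoLocallyUniformlyOn_deriv (h : IsExteriorApproximation C T K S) :
    TendstoLocallyUniformlyOn (fun n => deriv (S n)) (deriv T) atTop
      (unboundedComponent Cᶜ) := by
  have hPo := isOpen_unboundedComponent h.isCompact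
  rw [Metric.tendstoLocallyUniformlyOn_iff]
  intro ε hε z₀ hz₀
  obtain ⟨r, hr, hrP⟩ := Metric.nhds_basis_closedBall.mem_iff.1 (hPo.mem_nhds hz₀)
  have hev := h.eventually_subset_compl (isCompact_closedBall z₀ r) fun z hz => (hrP hz).1
  have hlim := (h.tendstoLocallyUniformlyOn.mono (Metric.ball_subset_closedBall.trans hrP)).deriv
    (by
      filter_upwards [hev] with n hn
      exact (h.isNormalizedExteriorMap_seq n).isBiholomorphism.differentiableOn.mono
        (Metric.ball_subset_closedBall.trans hn)) Metric.isOpen_ball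
  obtain ⟨t, ht, htn⟩ := Metric.tendstoLocallyUniformlyOn_iff.1 hlim ε hε z₀
    (Metric.mem_ball_self hr)
  refine ⟨t, mem_nhdsWithin_of_mem_nhds ?_, htn⟩
  rwa [Metric.isOpen_ball.nhdsWithin_eq (Metric.mem_ball_self hr)] at ht

/-- If `‖S n z‖ ≥ 1 + ε`, then `S n z` lies in a fixed compact set `A` of the exterior disk, on
which the inverse maps converge. So `z` is close to `F '' A`, a compact subset of the unbounded
component, from which `z₀` has positive distance. -/
theorem tendstoLocallyUniformlyOn_norm (h : IsExteriorApproximation C T K S) :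
    TendstoLocallyUniformlyOn (fun n z => ‖S n z‖) (fun _ => (1 : ℝ)) atTop
      (Cᶜ \ unboundedComponent Cᶜ) := by
  have hT := h.isNormalizedExteriorMap
  have hΔo : IsOpen unitDiskExterior := isOpen_lt continuous_const continuous_norm
  rw [Metric.tendstoLocallyUniformlyOn_iff]
  rintro ε hε z₀ ⟨hz₀C, hz₀P⟩
  obtain ⟨M, hM⟩ := h.exists_eventually_lt_norm_invFunOn (‖z₀‖ + 1)
  obtain ⟨r, hr, hrC⟩ := Metric.nhds_basis_closedBall.mem_iff.1
    (h.isCompact.isClosed.isOpen_compl.mem_nhds hz₀C)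
  set A : Set ℂ := {w | 1 + ε ≤ ‖w‖} ∩ Metric.closedBall 0 M with hA
  have hAc : IsCompact A :=
    (isCompact_closedBall (0 : ℂ) M).inter_left (isClosed_le continuous_const continuous_norm)
  have hAΔ : A ⊆ unitDiskExterior := fun w hw => (lt_add_of_pos_right 1 hε).trans_le hw.1
  set F := Function.invFunOn T (unboundedComponent Cᶜ) with hF
  have hFA : IsCompact (F '' A) :=
    hAc.image_of_continuousOn (hT.isBiholomorphism.differentiableOn_inv.continuousOn.mono hAΔ)
  have hz₀A : z₀ ∈ (F '' A)ᶜ := by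
    rintro ⟨w, hw, rfl⟩
    exact hz₀P (hT.mapsTo_invFunOn (hAΔ hw)).1
  obtain ⟨η, hη, hηA⟩ := Metric.isOpen_iff.1 hFA.isClosed.isOpen_compl z₀ hz₀A
  have hunif := Metric.tendstoUniformlyOn_iff.1
    ((tendstoLocallyUniformlyOn_iff_forall_isCompact hΔo).1 h.tendstoLocallyUniformlyOn_invFunOn _
      hAΔ hAc) (η / 2) (by positivity)
  have hδ : 0 < min (min r 1) (η / 2) := by positivity
  refine ⟨Metric.ball z₀ (min (min r 1) (η / 2)),
    mem_nhdsWithin_of_mem_nhds (Metric.ball_mem_nhds z₀ hδ), ?_⟩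
  filter_upwards [hM, hunif, h.eventually_subset_compl (isCompact_closedBall z₀ r) hrC]
    with n hnM hn hnK z hz
  have hS := h.isNormalizedExteriorMap_seq n
  rw [Metric.mem_ball, lt_min_iff, lt_min_iff] at hz
  have hzK : z ∈ (K n)ᶜ := hnK (Metric.mem_closedBall.2 hz.1.1.le)
  have h1 := hS.one_lt_norm hzK
  have hinv := hS.invFunOn_apply hzK
  have hzn : ‖z‖ < ‖z₀‖ + 1 := by
    have h2 := norm_sub_norm_le z z₀
    have h3 := hz.1.2
    rw [dist_eq_norm] at h3
    linarith
  have hleM : ‖S n z‖ ≤ M := by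
    by_contra! hlt
    have := hnM _ hlt
    rw [hinv] at this
    linarith
  rw [Real.dist_eq, abs_sub_comm, abs_of_pos (by linarith)]
  by_contra! hge
  have hmem : S n z ∈ A := ⟨show 1 + ε ≤ ‖S n z‖ by linarith, mem_closedBall_zero_iff.2 hleM⟩
  have h2 := hn _ hmem
  rw [hinv] at h2
  refine hηA ?_ (mem_image_of_mem F hmem)
  rw [Metric.mem_ball]
  linarith [dist_triangle (F (S n z)) z z₀, hz.2]

end IsExteriorApproximation

/-! ### Points have zero Sobolev capacity -/

/-- The classical gradient of a real function on the plane, as a complex number. -/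
noncomputable def complexGradient (v : ℂ → ℝ) (z : ℂ) : ℂ :=
  ⟨fderiv ℝ v z 1, fderiv ℝ v z Complex.I⟩

theorem norm_complexGradient_le (v : ℂ → ℝ) (z : ℂ) :
    ‖complexGradient v z‖ ≤ 2 * ‖fderiv ℝ v z‖ := by
  refine (Complex.norm_le_abs_re_add_abs_im _).trans ?_
  have h1 := (fderiv ℝ v z).le_opNorm 1
  have h2 := (fderiv ℝ v z).le_opNorm Complex.I
  rw [norm_one, mul_one, Real.norm_eq_abs] at h1
  rw [Complex.norm_I, mul_one, Real.norm_eq_abs] at h2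
  simp only [complexGradient]
  linarith

theorem continuous_complexGradient {v : ℂ → ℝ} (hv : ContDiff ℝ ∞ v) :
    Continuous (complexGradient v) := by
  have h := hv.continuous_fderiv (by simp)
  have h1 : complexGradient v =
      fun z => ((fderiv ℝ v z 1 : ℝ) : ℂ) + ((fderiv ℝ v z Complex.I : ℝ) : ℂ) * Complex.I := by
    ext z
    apply Complex.ext <;> simp [complexGradient]
  rw [h1]
  fun_prop

theorem hasCompactSupport_complexGradient {v : ℂ → ℝ} (hvc : HasCompactSupport v) :
    HasCompactSupport (complexGradient v) := by
  refine (hvc.fderiv ℝ).mono fun z hz h0 => hz ?_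
  apply Complex.ext <;> simp [complexGradient, h0]

theorem hasWeakGradient_complexGradient {v : ℂ → ℝ} (hv : ContDiff ℝ ∞ v)
    (hvc : HasCompactSupport v) : HasWeakGradient v (complexGradient v) := by
  intro φ hφ hφc
  have hfd : ∀ {f : ℂ → ℝ}, ContDiff ℝ ∞ f → ∀ e : ℂ, Continuous fun z => fderiv ℝ f z e :=
    fun hf e => (hf.continuous_fderiv (by simp)).clm_apply continuous_const
  have key : ∀ e : ℂ, ∫ z, v z * fderiv ℝ φ z e = -∫ z, fderiv ℝ v z e * φ z := fun e =>
    integral_mul_fderiv_eq_neg_fderiv_mul_of_integrable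
      (((hfd hv e).mul hφ.continuous).integrable_of_hasCompactSupport hφc.mul_left)
      ((hv.continuous.mul (hfd hφ e)).integrable_of_hasCompactSupport hvc.mul_right)
      ((hv.continuous.mul hφ.continuous).integrable_of_hasCompactSupport hφc.mul_left)
      (fun z _ => hv.differentiable (by simp) z) (fun z _ => hφ.differentiable (by simp) z)
  exact ⟨key 1, key Complex.I⟩

theorem sobolevCapacity_le_of_contDiff {E : Set ℂ} {v : ℂ → ℝ} (hv : ContDiff ℝ ∞ v)
    (hvc : HasCompactSupport v) {U : Set ℂ} (hU : IsOpen U) (hEU : E ⊆ U)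
    (hvU : ∀ z ∈ U, 1 ≤ v z) :
    sobolevCapacity E ≤ (∫⁻ z, ‖v z‖ₑ ^ 2) + ∫⁻ z, ‖complexGradient v z‖ₑ ^ 2 :=
  sInf_le ⟨v, complexGradient v, hv.continuous.memLp_of_hasCompactSupport hvc,
    (continuous_complexGradient hv).memLp_of_hasCompactSupport
      (hasCompactSupport_complexGradient hvc),
    hasWeakGradient_complexGradient hv hvc, ⟨U, hU, hEU, Eventually.of_forall hvU⟩, rfl⟩

theorem fderiv_diskCutoff_ne_zero {u : ℂ} (hu : fderiv ℝ diskCutoff u ≠ 0) :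
    1 ≤ ‖u‖ ∧ ‖u‖ < 2 := by
  constructor
  · by_contra! h
    refine hu ?_
    have : diskCutoff =ᶠ[𝓝 u] fun _ => 1 := by
      filter_upwards [(isOpen_lt continuous_norm continuous_const).mem_nhds h] with w hw
      exact diskCutoff_of_norm_le_one (le_of_lt hw)
    rw [this.fderiv_eq, fderiv_const_apply]
  · by_contra! h
    refine hu ?_
    have : diskCutoff =ᶠ[𝓝 u] fun _ => 0 := by
      filter_upwards [(isOpen_lt continuous_const (continuous_norm.pow 2)).mem_nhds
        (show 2 < ‖u‖ ^ 2 by nlinarith)] with w hw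
      exact diskCutoff_of_two_le_sq (le_of_lt hw)
    rw [this.fderiv_eq, fderiv_const_apply]

theorem exists_norm_fderiv_diskCutoff_le : ∃ M, ∀ u, ‖fderiv ℝ diskCutoff u‖ ≤ M :=
  (hasCompactSupport_diskCutoff.fderiv ℝ).exists_bound_of_continuous
    (contDiff_diskCutoff.continuous_fderiv (by simp))

/-- An average of `N` cutoff functions around `p` at the scales `4 ^ (-(N + k))`. -/
noncomputable def multiscaleCutoff (p : ℂ) (N : ℕ) (z : ℂ) : ℝ :=
  (N : ℝ)⁻¹ * ∑ k ∈ Finset.range N, diskCutoff ((4 ^ (N + k) : ℝ) • (z - p))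

section Multiscale

variable {p : ℂ} {N : ℕ}

theorem hasFDerivAt_diskCutoff_scaled (a : ℝ) (z : ℂ) :
    HasFDerivAt (fun z => diskCutoff (a • (z - p)))
      (a • fderiv ℝ diskCutoff (a • (z - p))) z := by
  have h1 : HasFDerivAt (fun z : ℂ => a • (z - p)) (a • ContinuousLinearMap.id ℝ ℂ) z :=
    ((hasFDerivAt_id z).sub_const p).const_smul a
  have h2 := ((contDiff_diskCutoff.differentiable (by simp))
    (a • (z - p))).hasFDerivAt.comp z h1
  convert! h2 using 1
  ext v
  simp

theorem contDiff_multiscaleCutoff : ContDiff ℝ ∞ (multiscaleCutoff p N) := by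
  unfold multiscaleCutoff
  refine contDiff_const.mul (ContDiff.sum fun k _ => ?_)
  exact contDiff_diskCutoff.comp ((contDiff_id.sub contDiff_const).const_smul (4 ^ (N + k) : ℝ))

theorem fderiv_multiscaleCutoff (z : ℂ) : fderiv ℝ (multiscaleCutoff p N) z =
    (N : ℝ)⁻¹ • ∑ k ∈ Finset.range N, (4 ^ (N + k) : ℝ) •
      fderiv ℝ diskCutoff ((4 ^ (N + k) : ℝ) • (z - p)) :=
  ((HasFDerivAt.fun_sum fun k _ => hasFDerivAt_diskCutoff_scaled (4 ^ (N + k) : ℝ) z).const_mul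
    _).fderiv

theorem norm_scaled (k : ℕ) (z : ℂ) : ‖(4 ^ k : ℝ) • (z - p)‖ = 4 ^ k * dist z p := by
  rw [norm_smul, Real.norm_of_nonneg (by positivity), dist_eq_norm]

theorem multiscaleCutoff_eq_one (hN : N ≠ 0) {z : ℂ} (hz : (4 : ℝ) ^ (N + N) * dist z p ≤ 1) :
    multiscaleCutoff p N z = 1 := by
  have hone : ∀ k ∈ Finset.range N, diskCutoff ((4 ^ (N + k) : ℝ) • (z - p)) = 1 := fun k hk => by
    apply diskCutoff_of_norm_le_one
    rw [norm_scaled]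
    refine le_trans ?_ hz
    gcongr
    · norm_num
    · exact (Finset.mem_range.1 hk).le
  rw [multiscaleCutoff, Finset.sum_congr rfl hone]
  have : (N : ℝ) ≠ 0 := by exact_mod_cast hN
  simp [this]

theorem multiscaleCutoff_mem_Icc (z : ℂ) : multiscaleCutoff p N z ∈ Icc (0 : ℝ) 1 := by
  have h0 : ∀ u, 0 ≤ diskCutoff u := fun u => Real.smoothTransition.nonneg _
  have h1 : ∀ u, diskCutoff u ≤ 1 := fun u => Real.smoothTransition.le_one _
  constructor
  · exact mul_nonneg (by positivity) (Finset.sum_nonneg fun k _ => h0 _)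
  · rw [multiscaleCutoff, ← div_eq_inv_mul]
    refine div_le_one_of_le₀ ?_ (by positivity)
    calc _ ≤ ∑ _k ∈ Finset.range N, (1 : ℝ) := Finset.sum_le_sum fun k _ => h1 _
      _ = N := by simp

theorem multiscaleCutoff_eq_zero {z : ℂ} (hz : z ∉ Metric.closedBall p (2 / 4 ^ N)) :
    multiscaleCutoff p N z = 0 := by
  rw [Metric.mem_closedBall, not_le, div_lt_iff₀ (by positivity)] at hz
  have hzero : ∀ k ∈ Finset.range N, diskCutoff ((4 ^ (N + k) : ℝ) • (z - p)) = 0 :=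
    fun k _ => by
    apply diskCutoff_of_two_le_sq
    rw [norm_scaled]
    have h1 : (4 : ℝ) ^ N * dist z p ≤ 4 ^ (N + k) * dist z p := by
      gcongr
      · norm_num
      · exact Nat.le_add_right N k
    nlinarith
  rw [multiscaleCutoff, Finset.sum_congr rfl hzero]
  simp

theorem hasCompactSupport_multiscaleCutoff : HasCompactSupport (multiscaleCutoff p N) :=
  HasCompactSupport.of_support_subset_isCompact (isCompact_closedBall p (2 / 4 ^ N))
    fun z hz => by
      by_contra h
      exact hz (multiscaleCutoff_eq_zero h)

/-- At every point at most one scale contributes to the gradient. -/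
theorem norm_fderiv_multiscaleCutoff_sq_le {M : ℝ} (hM : ∀ u, ‖fderiv ℝ diskCutoff u‖ ≤ M)
    (z : ℂ) : ‖fderiv ℝ (multiscaleCutoff p N) z‖ ^ 2 ≤ ∑ k ∈ Finset.range N,
      (Metric.closedBall p (2 / 4 ^ (N + k))).indicator
        (fun _ => ((N : ℝ)⁻¹ * (4 ^ (N + k) * M)) ^ 2) z := by
  set t : ℕ → ℂ →L[ℝ] ℝ := fun k => (4 ^ (N + k) : ℝ) •
      fderiv ℝ diskCutoff ((4 ^ (N + k) : ℝ) • (z - p)) with ht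
  have hnn : ∀ k ∈ Finset.range N, 0 ≤ (Metric.closedBall p (2 / 4 ^ (N + k))).indicator
        (fun _ => ((N : ℝ)⁻¹ * (4 ^ (N + k) * M)) ^ 2) z := fun k _ =>
    indicator_nonneg (fun _ _ => sq_nonneg _) _
  rw [fderiv_multiscaleCutoff]
  by_cases hex : ∃ k ∈ Finset.range N, t k ≠ 0
  · obtain ⟨k, hk, hkt⟩ := hex
    have hb : ∀ j, t j ≠ 0 → 1 ≤ 4 ^ (N + j) * dist z p ∧ 4 ^ (N + j) * dist z p < 2 := fun j hj => by
      have := fderiv_diskCutoff_ne_zero (right_ne_zero_of_smul hj)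
      rwa [norm_scaled] at this
    have hlt : ∀ i j, i < j → t i ≠ 0 → t j = 0 := by
      intro i j hij hi
      by_contra hj
      have h1 := (hb i hi).1
      have h2 := (hb j hj).2
      -- The gradient at scale `k` lives where `1 ≤ 4 ^ (N + k) * dist z p < 2`; the ratio `4` makes
      -- these annuli disjoint.
      have h3 : (4 : ℝ) ^ (N + i) * 4 ≤ 4 ^ (N + j) := by
        rw [← pow_succ]
        exact pow_le_pow_right₀ (by norm_num) (by omega)
      have h4 := mul_le_mul_of_nonneg_right h3 (dist_nonneg (x := z) (y := p))
      nlinarith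
    have hsum : ∑ j ∈ Finset.range N, t j = t k := by
      refine Finset.sum_eq_single k (fun j _ hjk => ?_) fun h => absurd hk h
      rcases lt_or_gt_of_ne hjk with hlt' | hgt
      · by_contra hj
        exact hkt (hlt j k hlt' hj)
      · exact hlt k j hgt hkt
    rw [hsum]
    refine le_trans ?_ (Finset.single_le_sum hnn hk)
    rw [indicator_of_mem]
    · rw [norm_smul, norm_smul, Real.norm_of_nonneg (by positivity),
        Real.norm_of_nonneg (by positivity)]
      gcongr
      exact hM _
    · rw [Metric.mem_closedBall, le_div_iff₀ (by positivity), mul_comm]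
      exact (hb k hkt).2.le
  · push Not at hex
    rw [Finset.sum_eq_zero hex]
    simpa using Finset.sum_nonneg hnn

theorem lintegral_multiscaleCutoff_le :
    ∫⁻ z, ‖multiscaleCutoff p N z‖ₑ ^ 2 ≤ ENNReal.ofReal (2 / 4 ^ N) ^ 2 * NNReal.pi := by
  rw [← Complex.volume_closedBall p, ← lintegral_indicator_one
    (Metric.isClosed_closedBall.measurableSet)]
  refine lintegral_mono fun z => ?_
  by_cases hz : z ∈ Metric.closedBall p (2 / 4 ^ N)
  · rw [indicator_of_mem hz, Pi.one_apply]
    refine pow_le_one' ?_ 2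
    obtain ⟨h0, h1⟩ := multiscaleCutoff_mem_Icc (p := p) (N := N) z
    rw [Real.enorm_eq_ofReal h0]
    exact ENNReal.ofReal_le_one.2 h1
  · simp [multiscaleCutoff_eq_zero hz]

/-- The Dirichlet energy is scale-invariant in the plane: each scale contributes at most `16 * M² *
π / N²` whatever `k` is, and there are `N` scales. -/
theorem lintegral_complexGradient_multiscaleCutoff_le (hN : N ≠ 0) {M : ℝ}
    (hM : ∀ u, ‖fderiv ℝ diskCutoff u‖ ≤ M) :
    ∫⁻ z, ‖complexGradient (multiscaleCutoff p N) z‖ₑ ^ 2 ≤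
      ENNReal.ofReal (16 * M ^ 2 * (N : ℝ)⁻¹) * NNReal.pi := by
  have hN' : (N : ℝ) ≠ 0 := by exact_mod_cast hN
  have hpt : ∀ z, ‖complexGradient (multiscaleCutoff p N) z‖ₑ ^ 2 ≤ ∑ k ∈ Finset.range N,
      (Metric.closedBall p (2 / 4 ^ (N + k))).indicator
        (fun _ => ENNReal.ofReal (4 * ((N : ℝ)⁻¹ * (4 ^ (N + k) * M)) ^ 2)) z := by
    intro z
    have h1 : ‖complexGradient (multiscaleCutoff p N) z‖ ^ 2 ≤ ∑ k ∈ Finset.range N,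
        (Metric.closedBall p (2 / 4 ^ (N + k))).indicator
          (fun _ => 4 * ((N : ℝ)⁻¹ * (4 ^ (N + k) * M)) ^ 2) z := by
      have h2 := norm_fderiv_multiscaleCutoff_sq_le (p := p) (N := N) hM z
      have h3 := norm_complexGradient_le (multiscaleCutoff p N) z
      have h4 : ‖complexGradient (multiscaleCutoff p N) z‖ ^ 2 ≤
          4 * ‖fderiv ℝ (multiscaleCutoff p N) z‖ ^ 2 := by
        nlinarith [norm_nonneg (complexGradient (multiscaleCutoff p N) z)]
      refine h4.trans ((mul_le_mul_of_nonneg_left h2 (by norm_num)).trans_eq ?_)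
      rw [Finset.mul_sum]
      refine Finset.sum_congr rfl fun k _ => ?_
      by_cases hz : z ∈ Metric.closedBall p (2 / 4 ^ (N + k))
      · rw [indicator_of_mem hz, indicator_of_mem hz]
      · rw [indicator_of_notMem hz, indicator_of_notMem hz, mul_zero]
    rw [← ofReal_norm, ← ENNReal.ofReal_pow (norm_nonneg _)]
    refine (ENNReal.ofReal_le_ofReal h1).trans ?_
    rw [ENNReal.ofReal_sum_of_nonneg fun k _ => indicator_nonneg (fun _ _ => by positivity) _]
    refine Finset.sum_le_sum fun k _ => ?_
    by_cases hz : z ∈ Metric.closedBall p (2 / 4 ^ (N + k))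
    · rw [indicator_of_mem hz, indicator_of_mem hz]
    · rw [indicator_of_notMem hz, indicator_of_notMem hz, ENNReal.ofReal_zero]
  refine (lintegral_mono hpt).trans ?_
  rw [lintegral_finsetSum _ fun k _ =>
    measurable_const.indicator Metric.isClosed_closedBall.measurableSet]
  have hterm : ∀ k ∈ Finset.range N, ∫⁻ z, (Metric.closedBall p (2 / 4 ^ (N + k))).indicator
        (fun _ => ENNReal.ofReal (4 * ((N : ℝ)⁻¹ * (4 ^ (N + k) * M)) ^ 2)) z =
      ENNReal.ofReal (16 * M ^ 2 * (N : ℝ)⁻¹ ^ 2) * NNReal.pi := fun k _ => by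
    rw [lintegral_indicator_const Metric.isClosed_closedBall.measurableSet,
      Complex.volume_closedBall, ← mul_assoc, ← ENNReal.ofReal_pow (by positivity),
      ← ENNReal.ofReal_mul (by positivity)]
    congr 2
    field_simp
    ring
  rw [Finset.sum_congr rfl hterm, Finset.sum_const, Finset.card_range, nsmul_eq_mul, ← mul_assoc,
    ← ENNReal.ofReal_natCast, ← ENNReal.ofReal_mul (by positivity)]
  apply le_of_eq
  congr 2
  field_simp

end Multiscale

/-- Averaging `N` cutoffs with disjoint gradients makes the Dirichlet energy `O(1 / N)`; starting
the scales at `4 ^ (-N)` makes the `L²` norm tend to zero too. -/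
theorem sobolevCapacity_singleton (p : ℂ) : sobolevCapacity {p} = 0 := by
  obtain ⟨M, hM⟩ := exists_norm_fderiv_diskCutoff_le
  have hle : ∀ N : ℕ, N ≠ 0 → sobolevCapacity {p} ≤
      ENNReal.ofReal (2 / 4 ^ N) ^ 2 * NNReal.pi +
        ENNReal.ofReal (16 * M ^ 2 * (N : ℝ)⁻¹) * NNReal.pi := fun N hN => by
    refine (sobolevCapacity_le_of_contDiff (contDiff_multiscaleCutoff (p := p))
      hasCompactSupport_multiscaleCutoff (U := Metric.ball p (1 / 4 ^ (N + N)))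
      Metric.isOpen_ball (by simp) fun z hz => ?_).trans
      (add_le_add lintegral_multiscaleCutoff_le
        (lintegral_complexGradient_multiscaleCutoff_le hN hM))
    rw [Metric.mem_ball, lt_div_iff₀ (by positivity), mul_comm] at hz
    exact (multiscaleCutoff_eq_one hN hz.le).ge
  have h4 : Tendsto (fun N : ℕ => (2 : ℝ) / 4 ^ N) atTop (𝓝 0) := by
    have := (tendsto_pow_atTop_nhds_zero_of_lt_one (r := (1 / 4 : ℝ)) (by norm_num)
      (by norm_num)).const_mul 2
    rw [mul_zero] at this
    refine this.congr fun N => ?_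
    rw [one_div, inv_pow, div_eq_mul_inv]
  have h5 : Tendsto (fun N : ℕ => 16 * M ^ 2 * (N : ℝ)⁻¹) atTop (𝓝 0) := by
    simpa using (tendsto_inv_atTop_nhds_zero_nat (𝕜 := ℝ)).const_mul (16 * M ^ 2)
  have h4' : Tendsto (fun N : ℕ => ENNReal.ofReal (2 / 4 ^ N) ^ 2 * NNReal.pi) atTop (𝓝 0) := by
    have := ENNReal.Tendsto.mul_const (b := (NNReal.pi : ℝ≥0∞))
      (((ENNReal.continuous_pow 2).tendsto _).comp (ENNReal.tendsto_ofReal h4))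
      (Or.inr ENNReal.coe_ne_top)
    simpa using this
  have h5' : Tendsto (fun N : ℕ => ENNReal.ofReal (16 * M ^ 2 * (N : ℝ)⁻¹) * NNReal.pi) atTop
      (𝓝 0) := by
    have := ENNReal.Tendsto.mul_const (b := (NNReal.pi : ℝ≥0∞))
      (ENNReal.tendsto_ofReal h5) (Or.inr ENNReal.coe_ne_top)
    simpa using this
  have hsum := h4'.add h5'
  rw [add_zero] at hsum
  refine le_antisymm (ge_of_tendsto hsum ?_) zero_le
  filter_upwards [eventually_ne_atTop 0] with N hN using hle N hN

theorem mainTheorem4 (C : Set ℂ) (hC_compact : IsCompact C) (hC_conn : IsConnected C)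
    (hC_cap : 0 < sobolevCapacity C) :
    ∃ T : ℂ → ℂ,
      -- existence and uniqueness (on the unbounded component) of the normalized map
      IsNormalizedExteriorMap T (unboundedComponent Cᶜ) ∧
      (∀ S : ℂ → ℂ, IsNormalizedExteriorMap S (unboundedComponent Cᶜ) →
        EqOn S T (unboundedComponent Cᶜ)) ∧
      -- convergence, for every approximation of the obstacle by smooth Jordan domains
      ∀ (O : ℕ → Set ℂ) (Tn : ℕ → ℂ → ℂ),
        (∀ n, IsSmoothJordanDomain (O n)) →
        Tendsto (fun n => Metric.hausdorffEDist (closure (O n)) C) atTop (𝓝 0) →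
        (∀ n, IsNormalizedExteriorMap (Tn n) (closure (O n))ᶜ) →
        -- compact subsets of the limit open set lie in the approximating domains eventually
        (∀ K : Set ℂ, IsCompact K → K ⊆ Cᶜ → ∀ᶠ n in atTop, K ⊆ (closure (O n))ᶜ) ∧
        TendstoLocallyUniformlyOn (fun n => Function.invFunOn (Tn n) (closure (O n))ᶜ)
          (Function.invFunOn T (unboundedComponent Cᶜ)) atTop unitDiskExterior ∧
        TendstoLocallyUniformlyOn Tn T atTop (unboundedComponent Cᶜ) ∧
        TendstoLocallyUniformlyOn (fun n => deriv (Tn n)) (deriv T) atTop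
          (unboundedComponent Cᶜ) ∧
        TendstoLocallyUniformlyOn (fun n z => ‖Tn n z‖) (fun _ => (1 : ℝ)) atTop
          (Cᶜ \ unboundedComponent Cᶜ) := by
  -- Otherwise `C` is a single point, whose capacity is zero.
  have hnt : C.Nontrivial := by
    rw [← not_subsingleton_iff]
    intro hs
    obtain ⟨p, hp⟩ := hC_conn.nonempty
    rw [hs.eq_singleton_of_mem hp, sobolevCapacity_singleton] at hC_cap
    exact lt_irrefl _ hC_cap
  obtain ⟨T, hT⟩ := exists_isNormalizedExteriorMap hC_compact hC_conn hnt
  obtain ⟨R, hR0, hR⟩ := hC_compact.isBounded.exists_pos_norm_le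
  refine ⟨T, hT, fun S hS => IsNormalizedExteriorMap.eqOn hR0
    (norm_gt_subset_unboundedComponent hR0.le hR) hS hT, fun O Tn hO hlim hTn => ?_⟩
  have h : IsExteriorApproximation C T (fun n => closure (O n)) Tn :=
    ⟨hC_compact, hnt, hT, fun n => (hO n).isConnected.nonempty.closure, hlim, hTn⟩
  exact ⟨fun A hA hAC => h.eventually_subset_compl hA hAC, h.tendstoLocallyUniformlyOn_invFunOn,
    h.tendstoLocallyUniformlyOn, h.tendstoLocallyUniformlyOn_deriv,
    h.tendstoLocallyUniformlyOn_norm⟩
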